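/- Let $n\ge 3$ and $\epsilon\in\{1,-1\}$, and let $\mathbb{Q}_\epsilon^n$ be the simply connected space form of constant sectional curvature $\epsilon$, that is, the unit sphere $\mathbb{S}^n$ if $\epsilon=1$ and hyperbolic space $\mathbb{H}^n$ if $\epsilon=-1$. Fix a point $o\in\mathbb{Q}_\epsilon^n$ and give $\mathbb{Q}_\epsilon^n\times\mathbb{R}$ the product metric. A hypersurface of $\mathbb{Q}_\epsilon^n\times\mathbb{R}$ is called rotational if it is invariant under all maps $(x,t)\mapsto(g(x),t)$, where $g$ is an isometry of $\mathbb{Q}_\epsilon^n$ fixing $o$, and strictly convex if, with respect to a suitable unit normal field, all its principal curvatures are positive. The scalar curvature is the non-normalized one, $S=\sum_{i\neq j}K(X_i,X_j)$ for an orthonormal frame $X_1,\dots,X_n$. Let $c>\epsilon n(n-1)$. Then $c/(n(n-1))>\epsilon$, and there is a properly embedded, strictly convex, rotational smooth hypersurface $\Sigma$ of $\mathbb{Q}_\epsilon^n\times\mathbb{R}$ with constant scalar curvature $c$. Necessarily it has constant sectional curvature $c/(n(n-1))$: every properly embedded, strictly convex, rotational smooth hypersurface of $\mathbb{Q}_\epsilon^n\times\mathbb{R}$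 with constant scalar curvature $c$ has constant sectional curvature $c/(n(n-1))$. Furthermore, $\Sigma$ can be chosen so that: (i) if $c>0$, $\Sigma$ is an embedded $n$-sphere which is symmetric with respect to a horizontal hyperplane $\mathbb{Q}_\epsilon^n\times\{t_0\}$; (ii) if $c\le 0$ (so that $\epsilon=-1$), $\Sigma$ is an entire graph over $\mathbb{H}^n$ which is contained in $\mathbb{H}^n\times[0,+\infty)$, meets $\mathbb{H}^n\times\{0\}$ at a single point, where it is tangent to it, and has height function unbounded above. -/

import Mathlib

open scoped Manifold ContDiff
open Set

noncomputable section

namespace ProductSpaceForm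

/-- Euclidean `n`-space. -/
abbrev Euc (n : ℕ) := EuclideanSpace ℝ (Fin n)

/-- The linear space `(ℝ × ℝⁿ) × ℝ` that contains `Q_ε^n × ℝ`: a point is `((x₀, x), t)`,
where `(x₀, x)` is the space form coordinate and `t` is the height. -/
abbrev Ambient (n : ℕ) := (ℝ × Euc n) × ℝ

/-- The flat bilinear form `ε x₀ y₀ + ⟨x, y⟩` on `ℝ × ℝⁿ`: Euclidean if `ε = 1`,
Lorentzian if `ε = -1`. -/
def baseForm {n : ℕ} (ε : ℝ) (x y : ℝ × Euc n) : ℝ :=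
  ε * x.1 * y.1 + inner ℝ x.2 y.2

/-- The simply connected space form `Q_ε^n` of curvature `ε`: the unit sphere if `ε = 1`, the upper
sheet of the hyperboloid `-x₀² + |x|² = -1` if `ε = -1`. Its Riemannian metric is the
restriction of `baseForm ε` to the tangent spaces. -/
def spaceForm (n : ℕ) (ε : ℝ) : Set (ℝ × Euc n) :=
  {x | baseForm ε x x = ε ∧ (ε = -1 → 0 < x.1)}

/-- The bilinear form `baseForm ε + dt²`. Restricted to the tangent spaces of `Q_ε^n × ℝ`
it is the Riemannian product metric. -/
def form {n : ℕ} (ε : ℝ) (p q : Ambient n) : ℝ :=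
  baseForm ε p.1 q.1 + p.2 * q.2

/-- The Riemannian product `Q_ε^n × ℝ`. -/
def productSpace (n : ℕ) (ε : ℝ) : Set (Ambient n) :=
  {p | p.1 ∈ spaceForm n ε}

/-! ### Partial derivatives and curvature in coordinates -/

/-- The `i`-th partial derivative. -/
def pderiv {n : ℕ} {F : Type*} [NormedAddCommGroup F] [NormedSpace ℝ F]
    (i : Fin n) (f : Euc n → F) (u : Euc n) : F :=
  fderiv ℝ f u (EuclideanSpace.single i 1)

/-- The Christoffel symbol `Γ^k_{ij}` of the Levi-Civita connection of the metric `g`. -/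
def christoffel {n : ℕ} (g : Euc n → Matrix (Fin n) (Fin n) ℝ) (k i j : Fin n) (u : Euc n) : ℝ :=
  (1 / 2) * ∑ l, (g u)⁻¹ k l *
    (pderiv i (fun y => g y j l) u + pderiv j (fun y => g y i l) u - pderiv l (fun y => g y i j) u)

/-- The component `R^l_{ijk}` of the curvature tensor, `R(∂_i, ∂_j) ∂_k = ∑_l R^l_{ijk} ∂_l`,
with `R(X, Y) Z = ∇_X ∇_Y Z - ∇_Y ∇_X Z - ∇_{[X, Y]} Z`. -/
def riemann {n : ℕ} (g : Euc n → Matrix (Fin n) (Fin n) ℝ) (l i j k : Fin n) (u : Euc n) : ℝ :=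
  pderiv i (christoffel g l j k) u - pderiv j (christoffel g l i k) u
    + ∑ m, (christoffel g m j k u * christoffel g l i m u
      - christoffel g m i k u * christoffel g l j m u)

/-- The inner product `g(v, w)` of the tangent vectors `∑ v_i ∂_i` and `∑ w_j ∂_j`. -/
def metricPair {n : ℕ} (g : Euc n → Matrix (Fin n) (Fin n) ℝ) (u v w : Euc n) : ℝ :=
  ∑ i, ∑ j, g u i j * v i * w j

/-- The sectional curvature `g(R(v, w) w, v) / (g(v, v) g(w, w) - g(v, w)²)` of the plane spanned
by the tangent vectors `∑ v_i ∂_i` and `∑ w_i ∂_i`. -/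
def sectionalCurvature {n : ℕ} (g : Euc n → Matrix (Fin n) (Fin n) ℝ) (u v w : Euc n) : ℝ :=
  (∑ i, ∑ j, ∑ k, ∑ l, ∑ m, g u l m * riemann g l i j k u * v i * w j * w k * v m) /
    (metricPair g u v v * metricPair g u w w - metricPair g u v w ^ 2)

/-- The (non normalized) scalar curvature: the metric trace of the Ricci tensor
`Ric(Y, Z) = trace (X ↦ R(X, Y) Z)`. Equivalently, the sum of the sectional curvatures
`K(X_i, X_j)` over all ordered pairs `i ≠ j` of an orthonormal basis. -/
def scalarCurvature {n : ℕ} (g : Euc n → Matrix (Fin n) (Fin n) ℝ) (u : Euc n) : ℝ :=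
  ∑ j, ∑ k, (g u)⁻¹ j k * ∑ i, riemann g i i j k u

/-! ### Hypersurfaces of `Q_ε^n × ℝ` -/

/-- `X : U → S` is a smooth local parametrization of the set `S`: a smooth injective immersion of an
open subset `U` of `ℝⁿ` which is a homeomorphism onto a relatively open subset of `S`. -/
structure IsLocalParam {n : ℕ} (S : Set (Ambient n)) (U : Set (Euc n)) (X : Euc n → Ambient n) :
    Prop where
  isOpen : IsOpen U
  smooth : ContDiffOn ℝ ∞ X U
  mapsTo : MapsTo X U S
  injOn : InjOn X U
  immersion : ∀ u ∈ U, Function.Injective (fderiv ℝ X u)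
  isOpenMap : ∀ W ⊆ U, IsOpen W → ∃ V : Set (Ambient n), IsOpen V ∧ X '' W = S ∩ V

/-- `S` is a properly embedded smooth hypersurface of `Q_ε^n × ℝ`, that is, a closed embedded
`n`-dimensional submanifold. (As `Q_ε^n × ℝ` is closed in the ambient linear space, being
closed in one or in the other is the same.) -/
structure IsProperlyEmbeddedHypersurface {n : ℕ} (ε : ℝ) (S : Set (Ambient n)) : Prop where
  subset : S ⊆ productSpace n ε
  locally_param : ∀ p ∈ S, ∃ U X, IsLocalParam S U X ∧ p ∈ X '' U
  isClosed : IsClosed S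

/-- The first fundamental form (the induced metric) in a local parametrization. -/
def inducedMetric {n : ℕ} (ε : ℝ) (X : Euc n → Ambient n) (u : Euc n) :
    Matrix (Fin n) (Fin n) ℝ :=
  Matrix.of fun i j => form ε (pderiv i X u) (pderiv j X u)

/-- The induced metric of `S` has constant scalar curvature `c`. -/
def HasConstantScalarCurvature {n : ℕ} (ε : ℝ) (S : Set (Ambient n)) (c : ℝ) : Prop :=
  ∀ U X, IsLocalParam S U X → ∀ u ∈ U, scalarCurvature (inducedMetric ε X) u = c

/-- The induced metric of `S` has constant sectional curvature `K`. -/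
def HasConstantSectionalCurvature {n : ℕ} (ε : ℝ) (S : Set (Ambient n)) (K : ℝ) : Prop :=
  ∀ U X, IsLocalParam S U X → ∀ u ∈ U, ∀ v w : Euc n, LinearIndependent ℝ ![v, w] →
    sectionalCurvature (inducedMetric ε X) u v w = K

/-- `N` is a continuous unit normal field along `S` in `Q_ε^n × ℝ`: at each point it is tangent to
`Q_ε^n × ℝ` (orthogonal to the position vector of the space form factor), orthogonal
to the tangent space of `S`, and of length one. -/
structure IsUnitNormalField {n : ℕ} (ε : ℝ) (S : Set (Ambient n)) (N : Ambient n → Ambient n) :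
    Prop where
  continuousOn : ContinuousOn N S
  unit : ∀ p ∈ S, form ε (N p) (N p) = 1
  tangent : ∀ p ∈ S, baseForm ε (N p).1 p.1 = 0
  normal : ∀ U X, IsLocalParam S U X → ∀ u ∈ U, ∀ v : Euc n, form ε (N (X u)) (fderiv ℝ X u v) = 0

/-- The second fundamental form with respect to `N` in a local parametrization. Since `N` is tangent
to `Q_ε^n × ℝ`, the coefficient `⟨∂_i ∂_j X, N⟩` equals `⟨∇_{∂_i} ∂_j X, N⟩ = ⟨A ∂_i, ∂_j⟩`, where `∇`
is the connection of `Q_ε^n × ℝ` and `A = -∇N` is the shape operator. -/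
def secondForm {n : ℕ} (ε : ℝ) (N : Ambient n → Ambient n) (X : Euc n → Ambient n) (u : Euc n) :
    Matrix (Fin n) (Fin n) ℝ :=
  Matrix.of fun i j => form ε (pderiv i (pderiv j X) u) (N (X u))

/-- `k` is a principal curvature, that is, an eigenvalue of the shape operator:
`⟨A v, ·⟩ = k ⟨v, ·⟩` for some nonzero tangent vector `v`. -/
def IsPrincipalCurvature {n : ℕ} (ε : ℝ) (N : Ambient n → Ambient n) (X : Euc n → Ambient n)
    (u : Euc n) (k : ℝ) : Prop :=
  ∃ v : Fin n → ℝ, v ≠ 0 ∧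
    (secondForm ε N X u).mulVec v = k • (inducedMetric ε X u).mulVec v

/-- With respect to a suitable orientation all principal curvatures of `S` are positive. -/
def IsStrictlyConvex {n : ℕ} (ε : ℝ) (S : Set (Ambient n)) : Prop :=
  ∃ N, IsUnitNormalField ε S N ∧ ∀ U X, IsLocalParam S U X → ∀ u ∈ U, ∀ k : ℝ,
    IsPrincipalCurvature ε N X u k → 0 < k

/-- `S` is rotational: it is invariant under every rotation about the vertical axis `{o} × ℝ`,
`o = (1, 0)`. These are the maps `((x₀, x), t) ↦ ((x₀, A x), t)` with `A` orthogonal. -/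
def IsRotational {n : ℕ} (S : Set (Ambient n)) : Prop :=
  ∀ A : Euc n ≃ₗᵢ[ℝ] Euc n, ∀ p ∈ S, (((p.1.1, A p.1.2), p.2) : Ambient n) ∈ S

/-- `S` is an embedded smooth `n`-sphere: the image of a smooth embedding of the unit sphere. -/
def IsEmbeddedSphere {n : ℕ} (S : Set (Ambient n)) : Prop :=
  ∃ F : Metric.sphere (0 : Euc (n + 1)) 1 → Ambient n,
    ContMDiff (𝓡 n) 𝓘(ℝ, Ambient n) ∞ F ∧ Function.Injective F ∧
      (∀ q, Function.Injective (mfderiv (𝓡 n) 𝓘(ℝ, Ambient n) F q)) ∧ range F = S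

/-- `S` is symmetric with respect to some horizontal hyperplane `Q_ε^n × {t₀}`. -/
def IsSymmetricHorizontal {n : ℕ} (S : Set (Ambient n)) : Prop :=
  ∃ t₀ : ℝ, ∀ p ∈ S, ((p.1, 2 * t₀ - p.2) : Ambient n) ∈ S

/-- `S` is the graph of a smooth function on all of `Q_ε^n`. -/
def IsEntireGraph {n : ℕ} (ε : ℝ) (S : Set (Ambient n)) : Prop :=
  ∃ φ : ℝ × Euc n → ℝ, ContDiff ℝ ∞ φ ∧ S = {p | p.1 ∈ spaceForm n ε ∧ p.2 = φ p.1}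

/-- `S` lies in the half-space `t ≥ 0`, it meets the hyperplane `t = 0` at a single point, where it
is tangent to it, and its height function is unbounded above. -/
structure IsBowl {n : ℕ} (S : Set (Ambient n)) : Prop where
  nonneg : ∀ p ∈ S, 0 ≤ p.2
  tangent_at_single_point : ∃ p₀ ∈ S, p₀.2 = 0 ∧ (∀ p ∈ S, p.2 = 0 → p = p₀) ∧
    ∀ U X, IsLocalParam S U X → ∀ u ∈ U, X u = p₀ → ∀ v : Euc n, (fderiv ℝ X u v).2 = 0
  unbounded : ∀ M : ℝ, ∃ p ∈ S, M < p.2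

end ProductSpaceForm

end

/-!
Existence. A rotational hypersurface of constant sectional curvature `K > ε` can be written down:
it has the equation `x₀ = ψ(t)`, where `ψ'' = ε K / (K - ε) ψ` and `(K - ε) ψ'² = 1 - ε K + ε K ψ²`
(`IsProfile`). Thus `ψ` is a catenary in `𝕊ⁿ × ℝ`, and a cosine, an affine function or a hyperbolic
sine in `ℍⁿ × ℝ`, according to the sign of `K`. Its second fundamental form is
`h = w g + (ε / w) dt²` with `w = √(K - ε)` (`IsProfile.secondForm_eq`), which is positive definite,
and the Gauss equation gives the curvature tensor `K g ∧ g`. If `K > 0` the hypersurface is the image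
of a round sphere under an explicit embedding; if `K ≤ 0` it is the graph of a function of `x₀`.

The Gauss equation (`IsLocalParam.gauss_equation`) is proved in an arbitrary local parametrization,
by differentiating the equations `g_{ml} Γ^l_{jk} = ⟨∂_j ∂_k X, ∂_m X⟩`. As the second fundamental form is
tensorial, no change of coordinates is ever needed for the curvature tensor.

Rigidity. Let `S` be strictly convex and rotational, of constant scalar curvature `n (n - 1) K`.
Reflections that fix a point show that the horizontal part of the unit normal is a multiple `-κ x` of
the horizontal position `x`, off the axis. Then `κ` is the principal curvature in the directions of
the parallels, `h = κ g + m dt²` (`exists_secondForm_eq`), and the hypersurface has constant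
sectional curvature as soon as `κ² + ε = K`. The scalar curvature equation has the first integral
`(κ² + ε - K) |x|ⁿ`, which is locally constant off the axis and vanishes on the axis. Were it
nonzero somewhere, its level set would be a closed hypersurface away from the axis. This is
impossible, as the profile curve is strictly concave as a graph over the axis: a function
`log |x|² + μ t` has no local minimum (`not_eventually_log_le`), whereas `log |x|² + η |t - t₀|` would
attain its minimum at a point with `t ≠ t₀` for suitable `η` and `t₀` (`firstIntegral_eq_zero`). No
connectedness of `S` is needed. The points of the axis are reached by continuity.
-/

noncomputable section

namespace ProductSpaceForm

/-! ### The ambient bilinear form -/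

section Form
variable {n : ℕ}

/-- The form `baseForm ε + dt²` as a continuous bilinear map. -/
def formL (n : ℕ) (ε : ℝ) : Ambient n →L[ℝ] Ambient n →L[ℝ] ℝ :=
  LinearMap.toContinuousBilinearMap <| LinearMap.mk₂ ℝ (form ε)
    (fun p q r => by simp only [form, baseForm, Prod.fst_add, Prod.snd_add, inner_add_left]; ring)
    (fun a p q => by
      simp only [form, baseForm, Prod.smul_fst, Prod.smul_snd, inner_smul_left, smul_eq_mul,
        RCLike.conj_to_real]; ring)
    (fun p q r => by simp only [form, baseForm, Prod.fst_add, Prod.snd_add, inner_add_right]; ring)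
    (fun a p q => by
      simp only [form, baseForm, Prod.smul_fst, Prod.smul_snd, inner_smul_right, smul_eq_mul]; ring)

theorem formL_apply (ε : ℝ) (p q : Ambient n) : formL n ε p q = form ε p q := rfl

theorem form_comm (ε : ℝ) (p q : Ambient n) : form ε p q = form ε q p := by
  simp only [form, baseForm, real_inner_comm p.1.2]; ring

theorem baseForm_comm (ε : ℝ) (p q : ℝ × Euc n) : baseForm ε p q = baseForm ε q p := by
  simp only [baseForm, real_inner_comm p.2]; ring

theorem form_add_left (ε : ℝ) (p q r : Ambient n) :
    form ε (p + q) r = form ε p r + form ε q r := by simp [← formL_apply]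

theorem form_add_right (ε : ℝ) (p q r : Ambient n) :
    form ε r (p + q) = form ε r p + form ε r q := by simp [← formL_apply]

theorem form_sub_left (ε : ℝ) (p q r : Ambient n) :
    form ε (p - q) r = form ε p r - form ε q r := by simp [← formL_apply]

theorem form_sub_right (ε : ℝ) (p q r : Ambient n) :
    form ε r (p - q) = form ε r p - form ε r q := by simp [← formL_apply]

theorem form_smul_left (ε a : ℝ) (p q : Ambient n) : form ε (a • p) q = a * form ε p q := by
  simp [← formL_apply]

theorem form_smul_right (ε a : ℝ) (p q : Ambient n) : form ε p (a • q) = a * form ε p q := by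
  simp [← formL_apply]

theorem form_sum_smul_left {ι : Type*} (s : Finset ι) (ε : ℝ) (a : ι → ℝ) (p : ι → Ambient n)
    (q : Ambient n) : form ε (∑ i ∈ s, a i • p i) q = ∑ i ∈ s, a i * form ε (p i) q := by
  simp [← formL_apply, map_sum]

theorem form_sum_smul_right {ι : Type*} (s : Finset ι) (ε : ℝ) (a : ι → ℝ) (p : ι → Ambient n)
    (q : Ambient n) : form ε q (∑ i ∈ s, a i • p i) = ∑ i ∈ s, a i * form ε q (p i) := by
  simp [← formL_apply, map_sum]

/-- The position vector of the space form factor, a normal vector of `Q_ε^n × ℝ` in the flat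
ambient space. -/
def posVec (p : Ambient n) : Ambient n := (p.1, 0)

theorem form_posVec (ε : ℝ) (p q : Ambient n) : form ε q (posVec p) = baseForm ε q.1 p.1 := by
  simp [form, posVec]

theorem contDiff_posVec {m : ℕ∞ω} : ContDiff ℝ m (posVec : Ambient n → Ambient n) := by
  unfold posVec; fun_prop

theorem form_posVec_self {ε : ℝ} {p : Ambient n} (hp : p ∈ productSpace n ε) :
    form ε (posVec p) (posVec p) = ε := by
  rw [form_posVec]; exact hp.1

/-- The form is positive definite on the tangent spaces of `Q_ε^n × ℝ`. -/
theorem form_self_pos {ε : ℝ} (hε : ε = 1 ∨ ε = -1) {p w : Ambient n} (hp : p ∈ productSpace n ε)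
    (hw : baseForm ε w.1 p.1 = 0) (h0 : w ≠ 0) : 0 < form ε w w := by
  obtain ⟨⟨x0, x⟩, t⟩ := p
  obtain ⟨⟨w0, w⟩, s⟩ := w
  have hp1 : ε * x0 * x0 + inner ℝ x x = ε := hp.1
  change ε * w0 * x0 + inner ℝ w x = 0 at hw
  change 0 < ε * w0 * w0 + inner ℝ w w + s * s
  have hne : w0 ≠ 0 ∨ w ≠ 0 ∨ s ≠ 0 := by
    by_contra! h
    exact h0 (by simp [h.1, h.2.1, h.2.2])
  have hww : 0 ≤ inner ℝ w w := real_inner_self_nonneg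
  have hwp : w ≠ 0 → 0 < inner ℝ w w := fun h => real_inner_self_pos.2 h
  rcases hε with rfl | rfl
  · rcases hne with h | h | h
    · have := mul_self_pos.2 h; nlinarith [mul_self_nonneg s]
    · have := hwp h; nlinarith [mul_self_nonneg s, mul_self_nonneg w0]
    · have := mul_self_pos.2 h; nlinarith [mul_self_nonneg w0]
  · have hcs : inner ℝ w x * inner ℝ w x ≤ inner ℝ w w * inner ℝ x x :=
      real_inner_mul_inner_self_le w x
    have hwx : inner ℝ w x = w0 * x0 := by linarith
    have hxx : inner ℝ x x = x0 * x0 - 1 := by linarith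
    rw [hwx, hxx] at hcs
    have hx0 : 1 ≤ x0 * x0 := by
      have : 0 ≤ inner ℝ x x := real_inner_self_nonneg
      linarith
    -- Cauchy-Schwarz gives `x₀² w₀² ≤ |w|² (x₀² - 1)`
    have key : inner ℝ w w ≤ x0 * x0 * (inner ℝ w w - w0 * w0) := by nlinarith
    by_cases h : w = 0
    · subst h
      have hw0 : w0 = 0 := by
        have : w0 * x0 = 0 := by simpa using hwx.symm
        rcases mul_eq_zero.1 this with h | h
        · exact h
        · rw [h] at hx0; norm_num at hx0
      have hs : s ≠ 0 := by simpa [hw0] using hne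
      have := mul_self_pos.2 hs
      simp [hw0]; exact hs
    · have := hwp h
      have : 0 < inner ℝ w w - w0 * w0 := by
        by_contra! h'
        nlinarith
      nlinarith [mul_self_nonneg s]

end Form

/-! ### Calculus in a local parametrization -/

section Calculus
variable {n : ℕ}

theorem pderiv_eq {F : Type*} [NormedAddCommGroup F] [NormedSpace ℝ F] (i : Fin n) (f : Euc n → F)
    (u : Euc n) : pderiv i f u = fderiv ℝ f u (EuclideanSpace.single i 1) := rfl

theorem apply_eq_sum {F : Type*} [NormedAddCommGroup F] [NormedSpace ℝ F] (D : Euc n →L[ℝ] F)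
    (v : Euc n) : D v = ∑ i, v i • D (EuclideanSpace.single i 1) := by
  conv_lhs => rw [← (EuclideanSpace.basisFun (Fin n) ℝ).sum_repr v]
  simp [map_sum]

theorem differentiableAt_form {ε : ℝ} {f g : Euc n → Ambient n} {u : Euc n}
    (hf : DifferentiableAt ℝ f u) (hg : DifferentiableAt ℝ g u) :
    DifferentiableAt ℝ (fun y => form ε (f y) (g y)) u :=
  ((formL n ε).differentiableAt.comp u hf).clm_apply hg

theorem fderiv_form {ε : ℝ} {f g : Euc n → Ambient n} {u : Euc n}
    (hf : DifferentiableAt ℝ f u) (hg : DifferentiableAt ℝ g u) (v : Euc n) :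
    fderiv ℝ (fun y => form ε (f y) (g y)) u v =
      form ε (fderiv ℝ f u v) (g u) + form ε (f u) (fderiv ℝ g u v) := by
  have h := ((formL n ε).hasFDerivAt.comp u hf.hasFDerivAt).clm_apply hg.hasFDerivAt
  have h2 : fderiv ℝ (fun y => form ε (f y) (g y)) u = _ := h.fderiv
  rw [h2]
  simp [formL_apply, add_comm]

variable {ε : ℝ} {S : Set (Ambient n)} {U : Set (Euc n)} {X : Euc n → Ambient n}

namespace IsLocalParam

theorem contDiffAt (hX : IsLocalParam S U X) {u : Euc n} (hu : u ∈ U) : ContDiffAt ℝ ∞ X u :=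
  hX.smooth.contDiffAt (hX.isOpen.mem_nhds hu)

theorem differentiableAt (hX : IsLocalParam S U X) {u : Euc n} (hu : u ∈ U) :
    DifferentiableAt ℝ X u := (hX.contDiffAt hu).differentiableAt (by simp)

theorem contDiffAt_fderiv (hX : IsLocalParam S U X) {u : Euc n} (hu : u ∈ U) :
    ContDiffAt ℝ ∞ (fderiv ℝ X) u := (hX.contDiffAt hu).fderiv_right (by simp)

theorem contDiffAt_fderiv_apply (hX : IsLocalParam S U X) {u : Euc n} (hu : u ∈ U) (v : Euc n) :
    ContDiffAt ℝ ∞ (fun y => fderiv ℝ X y v) u :=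
  (hX.contDiffAt_fderiv hu).clm_apply contDiffAt_const

theorem differentiableAt_fderiv (hX : IsLocalParam S U X) {u : Euc n} (hu : u ∈ U) :
    DifferentiableAt ℝ (fderiv ℝ X) u := (hX.contDiffAt_fderiv hu).differentiableAt (by simp)

theorem differentiableAt_fderiv_apply (hX : IsLocalParam S U X) {u : Euc n} (hu : u ∈ U)
    (v : Euc n) : DifferentiableAt ℝ (fun y => fderiv ℝ X y v) u :=
  (hX.contDiffAt_fderiv_apply hu v).differentiableAt (by simp)

theorem fderiv_fderiv_apply (hX : IsLocalParam S U X) {u : Euc n} (hu : u ∈ U) (v w : Euc n) :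
    fderiv ℝ (fun y => fderiv ℝ X y w) u v = fderiv ℝ (fderiv ℝ X) u v w := by
  have h := (hX.differentiableAt_fderiv hu).hasFDerivAt.clm_apply (hasFDerivAt_const w u)
  rw [h.fderiv]; simp

theorem pderiv_pderiv (hX : IsLocalParam S U X) {u : Euc n} (hu : u ∈ U) (i j : Fin n) :
    pderiv i (pderiv j X) u = fderiv ℝ (fderiv ℝ X) u (EuclideanSpace.single i 1)
      (EuclideanSpace.single j 1) := hX.fderiv_fderiv_apply hu _ _

theorem fderiv_fderiv_comm (hX : IsLocalParam S U X) {u : Euc n} (hu : u ∈ U) (v w : Euc n) :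
    fderiv ℝ (fderiv ℝ X) u v w = fderiv ℝ (fderiv ℝ X) u w v :=
  (hX.contDiffAt hu).isSymmSndFDerivAt (by simp only [minSmoothness_of_isRCLikeNormedField]; exact WithTop.coe_le_coe.2 le_top) v w

/-- Tangent vectors of `S` are tangent to `Q_ε^n × ℝ`. -/
theorem form_fderiv_posVec (hS : S ⊆ productSpace n ε) (hX : IsLocalParam S U X) {u : Euc n}
    (hu : u ∈ U) (v : Euc n) : form ε (fderiv ℝ X u v) (posVec (X u)) = 0 := by
  have hd := hX.differentiableAt hu
  have hpd : DifferentiableAt ℝ (fun y => posVec (X y)) u :=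
    ((contDiff_posVec (m := 1)).differentiable (by simp)).differentiableAt.comp u hd
  have hc : (fun y => form ε (posVec (X y)) (posVec (X y))) =ᶠ[nhds u] fun _ => ε := by
    filter_upwards [hX.isOpen.mem_nhds hu] with y hy
    exact form_posVec_self (hS (hX.mapsTo hy))
  have h := fderiv_form (ε := ε) hpd hpd v
  rw [hc.fderiv_eq, form_comm ε (posVec (X u))] at h
  have h2 : fderiv ℝ (fun y => posVec (X y)) u v = posVec (fderiv ℝ X u v) := by
    have := ((hd.hasFDerivAt.fst).prodMk (hasFDerivAt_const (0 : ℝ) u)).fderiv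
    have h3 : fderiv ℝ (fun y => posVec (X y)) u = _ := this
    rw [h3]; simp [posVec]
  rw [h2] at h
  rw [form_posVec] at h ⊢
  simp [posVec] at h
  linarith

/-- The component of the second derivatives of a parametrization along the position vector. -/
theorem form_fderiv_fderiv_posVec (hS : S ⊆ productSpace n ε) (hX : IsLocalParam S U X)
    {u : Euc n} (hu : u ∈ U) (v w : Euc n) :
    form ε (fderiv ℝ (fderiv ℝ X) u v w) (posVec (X u)) =
      - baseForm ε (fderiv ℝ X u v).1 (fderiv ℝ X u w).1 := by
  have hd := hX.differentiableAt hu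
  have hpd : DifferentiableAt ℝ (fun y => posVec (X y)) u :=
    ((contDiff_posVec (m := 1)).differentiable (by simp)).differentiableAt.comp u hd
  have hc : (fun y => form ε (fderiv ℝ X y w) (posVec (X y))) =ᶠ[nhds u] fun _ => 0 := by
    filter_upwards [hX.isOpen.mem_nhds hu] with y hy
    exact hX.form_fderiv_posVec hS hy w
  have h := fderiv_form (ε := ε) (hX.differentiableAt_fderiv_apply hu w) hpd v
  have h2 : fderiv ℝ (fun y => posVec (X y)) u v = posVec (fderiv ℝ X u v) := by
    have := ((hd.hasFDerivAt.fst).prodMk (hasFDerivAt_const (0 : ℝ) u)).fderiv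
    have h3 : fderiv ℝ (fun y => posVec (X y)) u = _ := this
    rw [h3]; simp [posVec]
  rw [hc.fderiv_eq, h2, hX.fderiv_fderiv_apply hu, form_posVec ε (fderiv ℝ X u v),
    baseForm_comm] at h
  simp at h
  linarith

theorem fderiv_ne_zero (hX : IsLocalParam S U X) {u : Euc n} (hu : u ∈ U) {v : Euc n}
    (hv : v ≠ 0) : fderiv ℝ X u v ≠ 0 := fun h =>
  hv (hX.immersion u hu (by simpa using h))

theorem form_fderiv_pos (hε : ε = 1 ∨ ε = -1) (hS : S ⊆ productSpace n ε)
    (hX : IsLocalParam S U X) {u : Euc n} (hu : u ∈ U) {v : Euc n} (hv : v ≠ 0) :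
    0 < form ε (fderiv ℝ X u v) (fderiv ℝ X u v) :=
  form_self_pos hε (hS (hX.mapsTo hu))
    (by rw [← form_posVec]; exact hX.form_fderiv_posVec hS hu v) (hX.fderiv_ne_zero hu hv)

end IsLocalParam

/-- In the ambient space, the tangent space of `S` at a point, a unit normal and the position vector
of the space form factor span everything. -/
theorem exists_decomposition (hε : ε = 1 ∨ ε = -1) (D : Euc n →L[ℝ] Ambient n)
    (hD : Function.Injective D) {N P : Ambient n} (hN : form ε N N = 1) (hP : form ε P P = ε)
    (hNP : form ε N P = 0) (hDN : ∀ v, form ε (D v) N = 0) (hDP : ∀ v, form ε (D v) P = 0)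
    (w : Ambient n) : ∃ a, w = D a + form ε w N • N + (ε * form ε w P) • P := by
  have hεε : ε * ε = 1 := by rcases hε with rfl | rfl <;> norm_num
  have hε0 : ε ≠ 0 := by rcases hε with rfl | rfl <;> norm_num
  have hPN : form ε P N = 0 := by rw [form_comm, hNP]
  let L : ((Euc n × ℝ) × ℝ) →ₗ[ℝ] Ambient n :=
    (D.toLinearMap.coprod (LinearMap.toSpanSingleton ℝ _ N)).coprod
      (LinearMap.toSpanSingleton ℝ _ P)
  have hL : ∀ z, L z = D z.1.1 + z.1.2 • N + z.2 • P := fun z => by simp [L]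
  have hLN : ∀ z, form ε (L z) N = z.1.2 := fun z => by
    rw [hL, form_add_left, form_add_left, form_smul_left, form_smul_left, hDN, hN, hPN]; ring
  have hLP : ∀ z, form ε (L z) P = z.2 * ε := fun z => by
    rw [hL, form_add_left, form_add_left, form_smul_left, form_smul_left, hDP, hP, hNP]; ring
  have hinj : Function.Injective L := by
    rw [← LinearMap.ker_eq_bot, LinearMap.ker_eq_bot']
    intro z hz
    have h1 := hLN z
    have h2 := hLP z
    have h0 : ∀ q, form ε (0 : Ambient n) q = 0 := fun q => by simp [← formL_apply]
    rw [hz, h0] at h1 h2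
    have h2 : z.2 = 0 := by simpa [hε0] using h2.symm
    have h3 := hL z
    rw [hz, ← h1, h2] at h3
    have : z.1.1 = 0 := hD (by simpa using h3.symm)
    ext1
    · ext1
      · exact this
      · exact h1.symm
    · exact h2
  have hsurj : Function.Surjective L :=
    (LinearMap.injective_iff_surjective_of_finrank_eq_finrank (by simp; ring)).1 hinj
  obtain ⟨z, rfl⟩ := hsurj w
  refine ⟨z.1.1, ?_⟩
  rw [hLN, hLP, mul_comm z.2, ← mul_assoc, hεε, one_mul]
  exact hL z

end Calculus

/-! ### The Gauss equation in coordinates -/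

section Gauss
variable {n : ℕ}

theorem differentiableAt_det {E : Type*} [NormedAddCommGroup E] [NormedSpace ℝ E]
    {m : ℕ} {M : E → Matrix (Fin m) (Fin m) ℝ} {u : E}
    (hM : ∀ i j, DifferentiableAt ℝ (fun y => M y i j) u) :
    DifferentiableAt ℝ (fun y => (M y).det) u := by
  simp only [Matrix.det_apply']
  refine DifferentiableAt.fun_sum fun σ _ => (differentiableAt_const _).mul ?_
  exact (HasFDerivAt.finsetProd fun i _ => (hM (σ i) i).hasFDerivAt).differentiableAt

theorem differentiableAt_inv_apply {E : Type*} [NormedAddCommGroup E] [NormedSpace ℝ E]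
    {m : ℕ} {M : E → Matrix (Fin m) (Fin m) ℝ} {u : E}
    (hM : ∀ i j, DifferentiableAt ℝ (fun y => M y i j) u) (h0 : (M u).det ≠ 0) (i j : Fin m) :
    DifferentiableAt ℝ (fun y => (M y)⁻¹ i j) u := by
  simp only [Matrix.inv_def, Ring.inverse_eq_inv', Matrix.smul_apply, smul_eq_mul,
    Matrix.adjugate_apply]
  refine ((differentiableAt_det hM).inv h0).mul (differentiableAt_det fun a b => ?_)
  by_cases h : a = j
  · subst h; simp
  · simpa [Matrix.updateRow_ne h] using hM a b

variable {ε : ℝ} {S : Set (Ambient n)} {U : Set (Euc n)} {X : Euc n → Ambient n}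

theorem inducedMetric_apply (u : Euc n) (i j : Fin n) :
    inducedMetric ε X u i j = form ε (fderiv ℝ X u (EuclideanSpace.single i 1))
      (fderiv ℝ X u (EuclideanSpace.single j 1)) := rfl

theorem inducedMetric_comm (u : Euc n) (i j : Fin n) :
    inducedMetric ε X u i j = inducedMetric ε X u j i := form_comm _ _ _

theorem sum_inducedMetric_mul (u v : Euc n) (i : Fin n) :
    ∑ j, inducedMetric ε X u i j * v j =
      form ε (fderiv ℝ X u (EuclideanSpace.single i 1)) (fderiv ℝ X u v) := by
  rw [apply_eq_sum _ v, form_sum_smul_right]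
  simp [inducedMetric_apply, mul_comm]

theorem metricPair_inducedMetric (u v w : Euc n) :
    metricPair (inducedMetric ε X) u v w = form ε (fderiv ℝ X u v) (fderiv ℝ X u w) := by
  rw [apply_eq_sum _ v, form_sum_smul_left]
  simp only [metricPair, ← sum_inducedMetric_mul, Finset.mul_sum]
  exact Finset.sum_congr rfl fun i _ => Finset.sum_congr rfl fun j _ => by ring

namespace IsLocalParam

theorem isUnit_inducedMetric (hε : ε = 1 ∨ ε = -1) (hS : S ⊆ productSpace n ε)
    (hX : IsLocalParam S U X) {u : Euc n} (hu : u ∈ U) : IsUnit (inducedMetric ε X u) := by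
  rw [← Matrix.mulVec_injective_iff_isUnit]
  intro v w hvw
  have h : (inducedMetric ε X u).mulVec (v - w) = 0 := by
    rw [Matrix.mulVec_sub]; exact sub_eq_zero.2 hvw
  by_contra hne
  have hz : (WithLp.toLp 2 (v - w) : Euc n) ≠ 0 := by
    intro h0
    have := (WithLp.toLp_eq_zero 2).1 h0
    exact hne (sub_eq_zero.1 this)
  have hpos := hX.form_fderiv_pos hε hS hu hz
  rw [← metricPair_inducedMetric] at hpos
  have : metricPair (inducedMetric ε X) u (WithLp.toLp 2 (v - w)) (WithLp.toLp 2 (v - w)) =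
      ∑ i, (v - w) i * (inducedMetric ε X u).mulVec (v - w) i := by
    simp only [metricPair, Matrix.mulVec, dotProduct, Finset.mul_sum]
    exact Finset.sum_congr rfl fun i _ => Finset.sum_congr rfl fun j _ => by ring
  rw [this, h] at hpos
  simp at hpos

theorem det_inducedMetric_ne_zero (hε : ε = 1 ∨ ε = -1) (hS : S ⊆ productSpace n ε)
    (hX : IsLocalParam S U X) {u : Euc n} (hu : u ∈ U) : (inducedMetric ε X u).det ≠ 0 :=
  ((Matrix.isUnit_iff_isUnit_det _).1 (hX.isUnit_inducedMetric hε hS hu)).ne_zero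

theorem sum_inducedMetric_mul_inv (hε : ε = 1 ∨ ε = -1) (hS : S ⊆ productSpace n ε)
    (hX : IsLocalParam S U X) {u : Euc n} (hu : u ∈ U) (i k : Fin n) :
    ∑ j, inducedMetric ε X u i j * (inducedMetric ε X u)⁻¹ j k = if i = k then 1 else 0 := by
  have h := Matrix.mul_nonsing_inv _
    ((Matrix.isUnit_iff_isUnit_det _).1 (hX.isUnit_inducedMetric hε hS hu))
  have := congrFun (congrFun h i) k
  rwa [Matrix.mul_apply, Matrix.one_apply] at this

theorem differentiableAt_inducedMetric (hX : IsLocalParam S U X) {u : Euc n} (hu : u ∈ U)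
    (i j : Fin n) : DifferentiableAt ℝ (fun y => inducedMetric ε X y i j) u :=
  differentiableAt_form (hX.differentiableAt_fderiv_apply hu _)
    (hX.differentiableAt_fderiv_apply hu _)

theorem differentiableAt_inducedMetric_inv (hε : ε = 1 ∨ ε = -1) (hS : S ⊆ productSpace n ε)
    (hX : IsLocalParam S U X) {u : Euc n} (hu : u ∈ U) (i j : Fin n) :
    DifferentiableAt ℝ (fun y => (inducedMetric ε X y)⁻¹ i j) u :=
  differentiableAt_inv_apply (hX.differentiableAt_inducedMetric hu)
    (hX.det_inducedMetric_ne_zero hε hS hu) i j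

theorem pderiv_inducedMetric (hX : IsLocalParam S U X) {u : Euc n} (hu : u ∈ U)
    (k i j : Fin n) : pderiv k (fun y => inducedMetric ε X y i j) u =
      form ε (pderiv k (pderiv i X) u) (pderiv j X u) +
        form ε (pderiv i X u) (pderiv k (pderiv j X) u) :=
  fderiv_form (hX.differentiableAt_fderiv_apply hu _) (hX.differentiableAt_fderiv_apply hu _) _

theorem pderiv_pderiv_comm (hX : IsLocalParam S U X) {u : Euc n} (hu : u ∈ U) (i j : Fin n) :
    pderiv i (pderiv j X) u = pderiv j (pderiv i X) u := by
  rw [hX.pderiv_pderiv hu, hX.pderiv_pderiv hu, hX.fderiv_fderiv_comm hu]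

theorem christoffel_eq (hX : IsLocalParam S U X) {u : Euc n} (hu : u ∈ U) (k i j : Fin n) :
    christoffel (inducedMetric ε X) k i j u =
      ∑ l, (inducedMetric ε X u)⁻¹ k l * form ε (pderiv i (pderiv j X) u) (pderiv l X u) := by
  simp only [christoffel, Finset.mul_sum]
  refine Finset.sum_congr rfl fun l _ => ?_
  rw [hX.pderiv_inducedMetric hu, hX.pderiv_inducedMetric hu, hX.pderiv_inducedMetric hu,
    hX.pderiv_pderiv_comm hu i l, hX.pderiv_pderiv_comm hu j l, hX.pderiv_pderiv_comm hu j i,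
    form_comm ε (pderiv j X u), form_comm ε (pderiv i X u)]
  ring

theorem contDiffAt_pderiv (hX : IsLocalParam S U X) {u : Euc n} (hu : u ∈ U) (i : Fin n) :
    ContDiffAt ℝ ∞ (pderiv i X) u := hX.contDiffAt_fderiv_apply hu _

theorem contDiffAt_pderiv_pderiv (hX : IsLocalParam S U X) {u : Euc n} (hu : u ∈ U)
    (i j : Fin n) : ContDiffAt ℝ ∞ (pderiv i (pderiv j X)) u :=
  ((hX.contDiffAt_pderiv hu j).fderiv_right (m := ∞) (by simp)).clm_apply contDiffAt_const

theorem pderiv_pderiv_pderiv_comm (hX : IsLocalParam S U X) {u : Euc n} (hu : u ∈ U)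
    (i j k : Fin n) :
    pderiv i (pderiv j (pderiv k X)) u = pderiv j (pderiv i (pderiv k X)) u := by
  have hY := hX.contDiffAt_pderiv hu k
  have hd : DifferentiableAt ℝ (fderiv ℝ (pderiv k X)) u :=
    (hY.fderiv_right (m := ∞) (by simp)).differentiableAt (by simp)
  have key : ∀ v w, fderiv ℝ (fun y => fderiv ℝ (pderiv k X) y w) u v =
      fderiv ℝ (fderiv ℝ (pderiv k X)) u v w := fun v w => by
    rw [(hd.hasFDerivAt.clm_apply (hasFDerivAt_const w u)).fderiv]; simp
  have hs := hY.isSymmSndFDerivAt (by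
    simp only [minSmoothness_of_isRCLikeNormedField]; exact WithTop.coe_le_coe.2 le_top)
  change fderiv ℝ (fun y => fderiv ℝ (pderiv k X) y _) u _ =
    fderiv ℝ (fun y => fderiv ℝ (pderiv k X) y _) u _
  rw [key, key, hs]

theorem differentiableAt_christoffel (hε : ε = 1 ∨ ε = -1) (hS : S ⊆ productSpace n ε)
    (hX : IsLocalParam S U X) {u : Euc n} (hu : u ∈ U) (k i j : Fin n) :
    DifferentiableAt ℝ (christoffel (inducedMetric ε X) k i j) u := by
  have h : christoffel (inducedMetric ε X) k i j =ᶠ[nhds u] fun y =>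
      ∑ l, (inducedMetric ε X y)⁻¹ k l * form ε (pderiv i (pderiv j X) y) (pderiv l X y) := by
    filter_upwards [hX.isOpen.mem_nhds hu] with y hy
    exact hX.christoffel_eq hy k i j
  refine DifferentiableAt.congr_of_eventuallyEq ?_ h
  refine DifferentiableAt.fun_sum fun l _ => ?_
  exact (hX.differentiableAt_inducedMetric_inv hε hS hu k l).mul
    (differentiableAt_form ((hX.contDiffAt_pderiv_pderiv hu i j).differentiableAt (by simp))
      ((hX.contDiffAt_pderiv hu l).differentiableAt (by simp)))

theorem sum_inducedMetric_mul_christoffel (hε : ε = 1 ∨ ε = -1) (hS : S ⊆ productSpace n ε)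
    (hX : IsLocalParam S U X) {u : Euc n} (hu : u ∈ U) (m i j : Fin n) :
    ∑ l, inducedMetric ε X u m l * christoffel (inducedMetric ε X) l i j u =
      form ε (pderiv i (pderiv j X) u) (pderiv m X u) := by
  simp only [hX.christoffel_eq hu, Finset.mul_sum]
  rw [Finset.sum_comm]
  simp only [← mul_assoc, ← Finset.sum_mul, hX.sum_inducedMetric_mul_inv hε hS hu]
  simp

/-- Lowering the upper index of the first half of the curvature tensor. -/
theorem sum_inducedMetric_mul_pderiv_christoffel (hε : ε = 1 ∨ ε = -1)
    (hS : S ⊆ productSpace n ε) (hX : IsLocalParam S U X) {u : Euc n} (hu : u ∈ U)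
    (m i j k : Fin n) :
    ∑ l, inducedMetric ε X u m l * (pderiv i (christoffel (inducedMetric ε X) l j k) u +
      ∑ p, christoffel (inducedMetric ε X) p j k u * christoffel (inducedMetric ε X) l i p u) =
      form ε (pderiv i (pderiv j (pderiv k X)) u) (pderiv m X u) +
      form ε (pderiv j (pderiv k X) u) (pderiv i (pderiv m X) u) -
      ∑ l, christoffel (inducedMetric ε X) l j k u *
        form ε (pderiv l X u) (pderiv i (pderiv m X) u) := by
  have h1 : pderiv i (fun y => ∑ l, inducedMetric ε X y m l *
        christoffel (inducedMetric ε X) l j k y) u =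
      ∑ l, (inducedMetric ε X u m l * pderiv i (christoffel (inducedMetric ε X) l j k) u +
        christoffel (inducedMetric ε X) l j k u *
          pderiv i (fun y => inducedMetric ε X y m l) u) := by
    have := (HasFDerivAt.fun_sum fun l (_ : l ∈ Finset.univ) =>
      ((hX.differentiableAt_inducedMetric (ε := ε) hu m l).hasFDerivAt.fun_mul
      (hX.differentiableAt_christoffel hε hS hu l j k).hasFDerivAt)).fderiv
    rw [pderiv_eq, this]
    simp [pderiv_eq]
  have h2 : (fun y => ∑ l, inducedMetric ε X y m l *
        christoffel (inducedMetric ε X) l j k y) =ᶠ[nhds u]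
      fun y => form ε (pderiv j (pderiv k X) y) (pderiv m X y) := by
    filter_upwards [hX.isOpen.mem_nhds hu] with y hy
    exact hX.sum_inducedMetric_mul_christoffel hε hS hy m j k
  have h3 : pderiv i (fun y => form ε (pderiv j (pderiv k X) y) (pderiv m X y)) u =
      form ε (pderiv i (pderiv j (pderiv k X)) u) (pderiv m X u) +
        form ε (pderiv j (pderiv k X) u) (pderiv i (pderiv m X) u) :=
    fderiv_form ((hX.contDiffAt_pderiv_pderiv hu j k).differentiableAt (by simp))
      ((hX.contDiffAt_pderiv hu m).differentiableAt (by simp)) _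
  rw [pderiv_eq, h2.fderiv_eq, ← pderiv_eq, h3] at h1
  have h4 : ∑ l, inducedMetric ε X u m l * ∑ p, christoffel (inducedMetric ε X) p j k u *
      christoffel (inducedMetric ε X) l i p u =
      ∑ p, christoffel (inducedMetric ε X) p j k u *
        form ε (pderiv i (pderiv p X) u) (pderiv m X u) := by
    simp only [← hX.sum_inducedMetric_mul_christoffel hε hS hu m i, Finset.mul_sum]
    rw [Finset.sum_comm]
    exact Finset.sum_congr rfl fun p _ => Finset.sum_congr rfl fun l _ => by ring
  simp only [mul_add, Finset.sum_add_distrib] at h1 ⊢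
  rw [h4, h1]
  simp only [hX.pderiv_inducedMetric hu, mul_add, Finset.sum_add_distrib,
    form_comm ε (pderiv m X u)]
  simp only [form_comm ε _ (pderiv i (pderiv m X) u)]
  ring

end IsLocalParam

/-- The base part `⟨v, w⟩ - dt(v) dt(w)` of the first fundamental form. -/
def baseMetric (ε : ℝ) (X : Euc n → Ambient n) (u : Euc n) (i j : Fin n) : ℝ :=
  baseForm ε (pderiv i X u).1 (pderiv j X u).1

theorem baseMetric_eq (u : Euc n) (i j : Fin n) : baseMetric ε X u i j =
    inducedMetric ε X u i j - (pderiv i X u).2 * (pderiv j X u).2 := by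
  simp [baseMetric, inducedMetric, form]

/-- The Gauss equation: the curvature tensor of `S`, with its upper index lowered, in terms of the
second fundamental form and of the curvature of `Q_ε^n × ℝ`. -/
theorem IsLocalParam.gauss_equation (hε : ε = 1 ∨ ε = -1) (hS : S ⊆ productSpace n ε)
    (hX : IsLocalParam S U X) {N : Ambient n → Ambient n} (hN : IsUnitNormalField ε S N)
    {u : Euc n} (hu : u ∈ U) (m i j k : Fin n) :
    ∑ l, inducedMetric ε X u m l * riemann (inducedMetric ε X) l i j k u =
      secondForm ε N X u j k * secondForm ε N X u i m -
        secondForm ε N X u i k * secondForm ε N X u j m +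
      ε * (baseMetric ε X u j k * baseMetric ε X u i m -
        baseMetric ε X u i k * baseMetric ε X u j m) := by
  have hp := hX.mapsTo hu
  -- the normal part of the second derivatives of `X`
  have key : ∀ i j k m, form ε (pderiv j (pderiv k X) u) (pderiv i (pderiv m X) u) -
      ∑ l, christoffel (inducedMetric ε X) l j k u *
        form ε (pderiv l X u) (pderiv i (pderiv m X) u) =
      secondForm ε N X u j k * secondForm ε N X u i m +
        ε * (baseMetric ε X u j k * baseMetric ε X u i m) := by
    intro i j k m
    have hP : ∀ a b, form ε (pderiv a (pderiv b X) u) (posVec (X u)) = - baseMetric ε X u a b :=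
      fun a b => by rw [hX.pderiv_pderiv hu, hX.form_fderiv_fderiv_posVec hS hu]; rfl
    obtain ⟨a, ha⟩ := exists_decomposition hε (fderiv ℝ X u) (hX.immersion u hu)
      (hN.unit _ hp) (form_posVec_self (hS hp)) (by rw [form_posVec]; exact hN.tangent _ hp)
      (fun v => by rw [form_comm]; exact hN.normal U X hX u hu v)
      (fun v => hX.form_fderiv_posVec hS hu v) (pderiv j (pderiv k X) u)
    have hΓ : ∀ l, christoffel (inducedMetric ε X) l j k u = a l := by
      have h1 : (inducedMetric ε X u).mulVec
          (fun l => christoffel (inducedMetric ε X) l j k u) =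
          (inducedMetric ε X u).mulVec (fun l => a l) := by
        funext m
        have h2 := hX.sum_inducedMetric_mul_christoffel hε hS hu m j k
        have h3 := sum_inducedMetric_mul (ε := ε) (X := X) u a m
        simp only [Matrix.mulVec, dotProduct]
        rw [h2, h3, ha, form_add_left, form_add_left, form_smul_left, form_smul_left,
          form_comm ε (posVec (X u)), pderiv_eq, hX.form_fderiv_posVec hS hu,
          hN.normal U X hX u hu, form_comm]
        ring
      exact fun l => congrFun ((Matrix.mulVec_injective_iff_isUnit.2
        (hX.isUnit_inducedMetric hε hS hu)) h1) l
    simp only [hΓ]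
    rw [← form_sum_smul_left Finset.univ ε (fun l => a l) (fun l => pderiv l X u)]
    have hDa : ∑ l, a l • pderiv l X u = fderiv ℝ X u a := (apply_eq_sum _ a).symm
    rw [hDa]
    conv_lhs => rw [ha]
    rw [form_add_left, form_add_left, form_smul_left, form_smul_left, hP,
      form_comm ε (N (X u)), form_comm ε (posVec (X u)), hP]
    simp only [secondForm, Matrix.of_apply]
    ring
  have e1 := hX.sum_inducedMetric_mul_pderiv_christoffel hε hS hu m i j k
  have e2 := hX.sum_inducedMetric_mul_pderiv_christoffel hε hS hu m j i k
  rw [hX.pderiv_pderiv_pderiv_comm hu j i k] at e2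
  have e3 : ∑ l, inducedMetric ε X u m l * riemann (inducedMetric ε X) l i j k u =
      ∑ l, inducedMetric ε X u m l * (pderiv i (christoffel (inducedMetric ε X) l j k) u +
      ∑ p, christoffel (inducedMetric ε X) p j k u * christoffel (inducedMetric ε X) l i p u) -
      ∑ l, inducedMetric ε X u m l * (pderiv j (christoffel (inducedMetric ε X) l i k) u +
      ∑ p, christoffel (inducedMetric ε X) p i k u * christoffel (inducedMetric ε X) l j p u) := by
    rw [← Finset.sum_sub_distrib]
    refine Finset.sum_congr rfl fun l _ => ?_
    rw [riemann, Finset.sum_sub_distrib]; ring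
  rw [e3, e1, e2]
  have k1 := key i j k m
  have k2 := key j i k m
  linarith

end Gauss

/-! ### Curvature of hypersurfaces with `h = κ g + m dt²` -/

section Traces
variable {n : ℕ}

/-- The trace computation behind the scalar curvature of a curvature tensor of the shape
`a g ∧ g + 2 d g ∧ τ²`. -/
theorem sum_inv_mul_sum_eq {G Gi : Matrix (Fin n) (Fin n) ℝ} {R : Fin n → Fin n → Fin n → Fin n → ℝ}
    {τ : Fin n → ℝ} {a d : ℝ} (hG : ∀ i j, G i j = G j i)
    (hi : ∀ i k, ∑ j, Gi i j * G j k = if i = k then 1 else 0)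
    (hi' : ∀ i k, ∑ j, G i j * Gi j k = if i = k then 1 else 0)
    (hR : ∀ m i j k, ∑ l, G m l * R l i j k = a * (G j k * G i m - G i k * G j m) +
      d * (G j k * τ i * τ m + τ j * τ k * G i m - G i k * τ j * τ m - τ i * τ k * G j m)) :
    ∑ j, ∑ k, Gi j k * ∑ i, R i i j k =
      n * (n - 1) * a + 2 * (n - 1) * d * ∑ j, ∑ k, Gi j k * τ j * τ k := by
  set T := ∑ j, ∑ k, Gi j k * τ j * τ k with hT
  have hup : ∀ l i j k, R l i j k = ∑ m, Gi l m * ∑ p, G m p * R p i j k := by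
    intro l i j k
    simp only [Finset.mul_sum, ← mul_assoc]
    rw [Finset.sum_comm]
    simp only [← Finset.sum_mul, hi]
    simp
  have e1 : ∀ i j, ∑ m, Gi i m * G j m = if i = j then 1 else 0 := fun i j => by
    simp only [hG j]; exact hi i j
  have e2 : ∀ m k, ∑ i, G i k * Gi i m = if k = m then 1 else 0 := fun m k => by
    simp only [hG _ k]; exact hi' k m
  have ricci : ∀ j k, ∑ i, R i i j k =
      a * (n - 1) * G j k + d * (T * G j k + (n - 2) * (τ j * τ k)) := by
    intro j k
    have h1 : ∑ i, ∑ m, Gi i m * G i m = (n : ℝ) := by simp [e1]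
    have h2 : ∑ i, ∑ m, Gi i m * (G i k * G j m) = G j k := by
      have : ∀ i, ∑ m, Gi i m * (G i k * G j m) = G i k * ∑ m, Gi i m * G j m := fun i => by
        rw [Finset.mul_sum]; exact Finset.sum_congr rfl fun m _ => by ring
      simp [this, e1]
    have h3 : ∑ i, ∑ m, Gi i m * (G i k * τ j * τ m) = τ j * τ k := by
      rw [Finset.sum_comm]
      have : ∀ m, ∑ i, Gi i m * (G i k * τ j * τ m) = (∑ i, G i k * Gi i m) * (τ j * τ m) :=
        fun m => by rw [Finset.sum_mul]; exact Finset.sum_congr rfl fun m _ => by ring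
      simp [this, e2]
    have h4 : ∑ i, ∑ m, Gi i m * (τ i * τ k * G j m) = τ j * τ k := by
      have : ∀ i, ∑ m, Gi i m * (τ i * τ k * G j m) = (τ i * τ k) * ∑ m, Gi i m * G j m :=
        fun i => by rw [Finset.mul_sum]; exact Finset.sum_congr rfl fun m _ => by ring
      simp [this, e1]
    calc ∑ i, R i i j k = ∑ i, ∑ m, (a * G j k * (Gi i m * G i m)
            - a * (Gi i m * (G i k * G j m)) + d * G j k * (Gi i m * τ i * τ m)
            + d * (τ j * τ k) * (Gi i m * G i m) - d * (Gi i m * (G i k * τ j * τ m))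
            - d * (Gi i m * (τ i * τ k * G j m))) := by
          refine Finset.sum_congr rfl fun i _ => ?_
          rw [hup]
          refine Finset.sum_congr rfl fun m _ => ?_
          rw [hR]; ring
      _ = _ := by
          simp only [Finset.sum_add_distrib, Finset.sum_sub_distrib, ← Finset.mul_sum]
          rw [h1, h2, h3, h4, ← hT]; ring
  have t1 : ∑ j, ∑ k, Gi j k * G j k = (n : ℝ) := by simp [e1]
  calc ∑ j, ∑ k, Gi j k * ∑ i, R i i j k
      = ∑ j, ∑ k, ((a * (n - 1) + d * T) * (Gi j k * G j k) +
          d * (n - 2) * (Gi j k * τ j * τ k)) := by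
        refine Finset.sum_congr rfl fun j _ => Finset.sum_congr rfl fun k _ => ?_
        rw [ricci]; ring
    _ = _ := by
        simp only [Finset.sum_add_distrib, ← Finset.mul_sum]
        rw [t1, ← hT]; ring

variable {ε : ℝ} {S : Set (Ambient n)} {U : Set (Euc n)} {X : Euc n → Ambient n}

theorem IsLocalParam.sum_inducedMetric_inv_mul (hε : ε = 1 ∨ ε = -1) (hS : S ⊆ productSpace n ε)
    (hX : IsLocalParam S U X) {u : Euc n} (hu : u ∈ U) (i k : Fin n) :
    ∑ j, (inducedMetric ε X u)⁻¹ i j * inducedMetric ε X u j k = if i = k then 1 else 0 := by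
  have h := Matrix.nonsing_inv_mul _
    ((Matrix.isUnit_iff_isUnit_det _).1 (hX.isUnit_inducedMetric hε hS hu))
  have := congrFun (congrFun h i) k
  rwa [Matrix.mul_apply, Matrix.one_apply] at this

theorem IsLocalParam.scalarCurvature_eq (hε : ε = 1 ∨ ε = -1) (hS : S ⊆ productSpace n ε)
    (hX : IsLocalParam S U X) {N : Ambient n → Ambient n} (hN : IsUnitNormalField ε S N)
    {u : Euc n} (hu : u ∈ U) {κ m : ℝ}
    (hh : ∀ i j, secondForm ε N X u i j = κ * inducedMetric ε X u i j +
      m * ((pderiv i X u).2 * (pderiv j X u).2)) :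
    scalarCurvature (inducedMetric ε X) u = n * (n - 1) * (κ ^ 2 + ε) + 2 * (n - 1) * (κ * m - ε) *
      ∑ j, ∑ k, (inducedMetric ε X u)⁻¹ j k * (pderiv j X u).2 * (pderiv k X u).2 := by
  refine sum_inv_mul_sum_eq (inducedMetric_comm u) (hX.sum_inducedMetric_inv_mul hε hS hu)
    (hX.sum_inducedMetric_mul_inv hε hS hu)
    (R := fun l i j k => riemann (inducedMetric ε X) l i j k u) fun m i j k => ?_
  rw [hX.gauss_equation hε hS hN hu]
  simp only [hh, baseMetric_eq]
  ring

/-- Positivity of the Gram determinant of two independent tangent vectors. -/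
theorem IsLocalParam.gram_ne_zero (hε : ε = 1 ∨ ε = -1) (hS : S ⊆ productSpace n ε)
    (hX : IsLocalParam S U X) {u : Euc n} (hu : u ∈ U) {v w : Euc n}
    (hvw : LinearIndependent ℝ ![v, w]) :
    metricPair (inducedMetric ε X) u v v * metricPair (inducedMetric ε X) u w w -
      metricPair (inducedMetric ε X) u v w ^ 2 ≠ 0 := by
  simp only [metricPair_inducedMetric]
  have hv : v ≠ 0 := by simpa using hvw.ne_zero 0
  have hvp := hX.form_fderiv_pos hε hS hu hv
  set A := form ε (fderiv ℝ X u v) (fderiv ℝ X u v) with hA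
  set B := form ε (fderiv ℝ X u v) (fderiv ℝ X u w) with hB
  have hz : A • w - B • v ≠ 0 := by
    intro h
    have := (LinearIndependent.pair_iff.1 hvw) (-B) A (by rw [← h]; module)
    exact hvp.ne' this.2
  have h := hX.form_fderiv_pos hε hS hu hz
  have e : form ε (fderiv ℝ X u (A • w - B • v)) (fderiv ℝ X u (A • w - B • v)) =
      A * (A * form ε (fderiv ℝ X u w) (fderiv ℝ X u w) - B ^ 2) := by
    simp only [map_sub, map_smul, form_sub_left, form_sub_right, form_smul_left, form_smul_right]
    rw [form_comm ε (fderiv ℝ X u w) (fderiv ℝ X u v), ← hA, ← hB]; ring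
  rw [e] at h
  exact (pos_of_mul_pos_right h hvp.le).ne'

theorem IsLocalParam.sectionalCurvature_eq (hε : ε = 1 ∨ ε = -1) (hS : S ⊆ productSpace n ε)
    (hX : IsLocalParam S U X) {u : Euc n} (hu : u ∈ U) {K : ℝ}
    (hR : ∀ m i j k, ∑ l, inducedMetric ε X u m l * riemann (inducedMetric ε X) l i j k u =
      K * (inducedMetric ε X u j k * inducedMetric ε X u i m -
        inducedMetric ε X u i k * inducedMetric ε X u j m))
    {v w : Euc n} (hvw : LinearIndependent ℝ ![v, w]) :
    sectionalCurvature (inducedMetric ε X) u v w = K := by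
  rw [sectionalCurvature, div_eq_iff (hX.gram_ne_zero hε hS hu hvw)]
  set g := inducedMetric ε X with hg
  have h1 : ∀ i j k, ∑ l, ∑ m, g u l m * riemann g l i j k u * v i * w j * w k * v m =
      K * ((∑ m, g u i m * v i * v m) * (g u j k * w j * w k) -
        (g u i k * v i * w k) * ∑ m, g u j m * v m * w j) := by
    intro i j k
    rw [Finset.sum_comm]
    have : ∀ m, ∑ l, g u l m * riemann g l i j k u * v i * w j * w k * v m =
        (K * (g u j k * g u i m - g u i k * g u j m)) * v i * w j * w k * v m := fun m => by
      rw [← hR m i j k]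
      simp only [Finset.sum_mul]
      exact Finset.sum_congr rfl fun l _ => by rw [hg, inducedMetric_comm u l m]
    simp only [this]
    rw [Finset.sum_mul, Finset.mul_sum, ← Finset.sum_sub_distrib, Finset.mul_sum]
    exact Finset.sum_congr rfl fun m _ => by ring
  simp only [h1, metricPair]
  have h2 : (∑ i, ∑ j, g u i j * v i * w j) ^ 2 =
      (∑ i, ∑ k, g u i k * v i * w k) * ∑ j, ∑ m, g u j m * v m * w j := by
    rw [sq]; congr 1
    rw [Finset.sum_comm]
    exact Finset.sum_congr rfl fun m _ => Finset.sum_congr rfl fun j _ => by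
      rw [hg, inducedMetric_comm u j m]
  rw [h2, Finset.sum_mul_sum, Finset.sum_mul_sum, ← Finset.sum_sub_distrib, Finset.mul_sum]
  refine Finset.sum_congr rfl fun i _ => ?_
  rw [← Finset.sum_sub_distrib, Finset.mul_sum]
  refine Finset.sum_congr rfl fun j _ => ?_
  rw [← Finset.mul_sum, Finset.sum_sub_distrib, ← Finset.mul_sum, ← Finset.sum_mul]

end Traces

/-! ### Hypersurfaces `x₀ = ψ(t)` of constant sectional curvature -/

section Profile
variable {n : ℕ}

/-- A profile function for curvature `K`: `ψ` solves `ψ'' = ε K / (K - ε) ψ`, with the first integral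
`(K - ε) ψ'² = 1 - ε K + ε K ψ²`; here `w = √(K - ε)` and `σ = ε w ψ'`. -/
structure IsProfile (ε K w : ℝ) (ψ σ : ℝ → ℝ) : Prop where
  w_pos : 0 < w
  w_sq : w ^ 2 = K - ε
  hasDerivAt_psi : ∀ t, HasDerivAt ψ (ε * σ t / w) t
  hasDerivAt_sigma : ∀ t, HasDerivAt σ (K * ψ t / w) t
  energy : ∀ t, K * ψ t ^ 2 - ε * σ t ^ 2 = K - ε

/-- The unit normal field of the hypersurface `x₀ = ψ(t)`. -/
def profileNormal (w : ℝ) (σ : ℝ → ℝ) (p : Ambient n) : Ambient n :=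
  ((w * (1 - p.1.1 ^ 2) / p.1.1, -w • p.1.2), -σ p.2 / p.1.1)

variable {ε K w : ℝ} {ψ σ : ℝ → ℝ} {S : Set (Ambient n)} {U : Set (Euc n)} {X : Euc n → Ambient n}

theorem HasFDerivAt.fst_fst {f : Euc n → Ambient n} {f' : Euc n →L[ℝ] Ambient n} {u : Euc n}
    (hf : HasFDerivAt f f' u) : HasFDerivAt (fun y => (f y).1.1)
      ((ContinuousLinearMap.fst ℝ ℝ (Euc n)).comp
        ((ContinuousLinearMap.fst ℝ (ℝ × Euc n) ℝ).comp f')) u := hf.fst.fst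

/-- The first derivative of the equation `x₀ = ψ(t)`. -/
theorem IsProfile.fderiv_fst_fst (hψ : IsProfile ε K w ψ σ) (hS : ∀ p ∈ S, p.1.1 = ψ p.2)
    (hX : IsLocalParam S U X) {u : Euc n} (hu : u ∈ U) (v : Euc n) :
    (fderiv ℝ X u v).1.1 = ε * σ (X u).2 / w * (fderiv ℝ X u v).2 := by
  have hd := (hX.differentiableAt hu).hasFDerivAt
  have h1 := HasFDerivAt.fst_fst hd
  have h2 := (hψ.hasDerivAt_psi (X u).2).comp_hasFDerivAt u hd.snd
  have he : (fun y => (X y).1.1) =ᶠ[nhds u] (ψ ∘ fun y => (X y).2) := by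
    filter_upwards [hX.isOpen.mem_nhds hu] with y hy
    exact hS _ (hX.mapsTo hy)
  have h3 := (h2.congr_of_eventuallyEq he).unique h1
  have := congrArg (fun L => L v) h3
  simpa using this.symm

/-- The second derivative of the equation `x₀ = ψ(t)`. -/
theorem IsProfile.fderiv_fderiv_fst_fst (hψ : IsProfile ε K w ψ σ) (hS : ∀ p ∈ S, p.1.1 = ψ p.2)
    (hX : IsLocalParam S U X) {u : Euc n} (hu : u ∈ U) (v z : Euc n) :
    (fderiv ℝ (fderiv ℝ X) u v z).1.1 =
      ε * K * (X u).1.1 / w ^ 2 * ((fderiv ℝ X u v).2 * (fderiv ℝ X u z).2) +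
        ε * σ (X u).2 / w * (fderiv ℝ (fderiv ℝ X) u v z).2 := by
  have hd := (hX.differentiableAt hu).hasFDerivAt
  have hz := (hX.differentiableAt_fderiv_apply hu z).hasFDerivAt
  have h1 := HasFDerivAt.fst_fst hz
  have h2 := (((hψ.hasDerivAt_sigma (X u).2).comp_hasFDerivAt u hd.snd).const_mul
    (ε / w)).mul hz.snd
  have he : (fun y => (fderiv ℝ X y z).1.1) =ᶠ[nhds u]
      (fun y => ε / w * (σ ∘ fun y => (X y).2) y) * fun y => (fderiv ℝ X y z).2 := by
    filter_upwards [hX.isOpen.mem_nhds hu] with y hy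
    rw [hψ.fderiv_fst_fst hS hX hy]
    simp only [Pi.mul_apply, Function.comp]; ring
  have h3 := (h2.congr_of_eventuallyEq he).unique h1
  have h4 := congrArg (fun L => L v) h3
  have h5 := hX.fderiv_fderiv_apply hu v z
  simp only [add_apply, smul_apply, smul_eq_mul,
    ContinuousLinearMap.comp_apply, ContinuousLinearMap.coe_fst', ContinuousLinearMap.coe_snd',
    Function.comp, h5] at h4
  rw [← h4, hS _ (hX.mapsTo hu)]
  have := hψ.w_pos.ne'
  field_simp
  ring

theorem IsProfile.isUnitNormalField (hψ : IsProfile ε K w ψ σ) (hε : ε = 1 ∨ ε = -1)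
    (hS : S ⊆ productSpace n ε) (hS0 : ∀ p ∈ S, 0 < p.1.1) (hSψ : ∀ p ∈ S, p.1.1 = ψ p.2) :
    IsUnitNormalField ε S (profileNormal w σ) where
  continuousOn := by
    have hσ : Continuous σ := continuous_iff_continuousAt.2 fun t =>
      (hψ.hasDerivAt_sigma t).continuousAt
    have h0 : ∀ p ∈ S, p.1.1 ≠ 0 := fun p hp => (hS0 p hp).ne'
    unfold profileNormal
    refine ContinuousOn.prodMk (ContinuousOn.prodMk ?_ (by fun_prop)) ?_
    · exact ContinuousOn.div (by fun_prop) (by fun_prop) h0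
    · exact ContinuousOn.div (by fun_prop) (by fun_prop) h0
  unit := by
    rintro ⟨⟨x0, x⟩, t⟩ hp
    have h0 : 0 < x0 := hS0 _ hp
    have hx : ε * x0 * x0 + inner ℝ x x = ε := (hS hp).1
    have he := hψ.energy t
    have hψt : x0 = ψ t := hSψ _ hp
    rw [← hψt] at he
    have hw := hψ.w_sq
    simp only [form, baseForm, profileNormal, inner_smul_left, inner_smul_right]
    have hxx : inner ℝ x x = ε - ε * x0 * x0 := by linarith
    simp only [map_neg, RCLike.conj_to_real, hxx]
    field_simp
    rcases hε with rfl | rfl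
    · linear_combination (1 - x0 ^ 2) * hw - he
    · linear_combination -(1 - x0 ^ 2) * hw + he
  tangent := by
    rintro ⟨⟨x0, x⟩, t⟩ hp
    have h0 : 0 < x0 := hS0 _ hp
    have hx : ε * x0 * x0 + inner ℝ x x = ε := (hS hp).1
    have hxx : inner ℝ x x = ε - ε * x0 * x0 := by linarith
    simp only [baseForm, profileNormal, inner_smul_left, map_neg, RCLike.conj_to_real, hxx]
    field_simp
    ring
  normal := by
    intro U X hX u hu v
    have hp := hX.mapsTo hu
    have h0 : 0 < (X u).1.1 := hS0 _ hp
    have h1 := hψ.fderiv_fst_fst hSψ hX hu v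
    have h2 := hX.form_fderiv_posVec hS hu v
    rw [form_posVec] at h2
    simp only [form, baseForm, profileNormal, inner_smul_left, map_neg, RCLike.conj_to_real] at h2 ⊢
    rw [real_inner_comm] at h2
    have hw := hψ.w_pos
    have h3 : inner ℝ (X u).1.2 (fderiv ℝ X u v).1.2 =
        -(ε * (fderiv ℝ X u v).1.1 * (X u).1.1) := by linarith
    rw [h3, h1]
    have hεε : ε * ε = 1 := by rcases hε with rfl | rfl <;> norm_num
    field_simp
    linear_combination σ (X u).2 * (fderiv ℝ X u v).2 * hεε

theorem IsProfile.secondForm_eq (hψ : IsProfile ε K w ψ σ) (hε : ε = 1 ∨ ε = -1)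
    (hS : S ⊆ productSpace n ε) (hS0 : ∀ p ∈ S, 0 < p.1.1) (hSψ : ∀ p ∈ S, p.1.1 = ψ p.2)
    (hX : IsLocalParam S U X) {u : Euc n} (hu : u ∈ U) (i j : Fin n) :
    secondForm ε (profileNormal w σ) X u i j = w * inducedMetric ε X u i j +
      ε / w * ((pderiv i X u).2 * (pderiv j X u).2) := by
  have hp := hX.mapsTo hu
  have h0 : 0 < (X u).1.1 := hS0 _ hp
  have h1 := hψ.fderiv_fderiv_fst_fst hSψ hX hu (EuclideanSpace.single i 1)
    (EuclideanSpace.single j 1)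
  have h2 := hX.form_fderiv_fderiv_posVec hS hu (EuclideanSpace.single i 1)
    (EuclideanSpace.single j 1)
  rw [form_posVec] at h2
  simp only [secondForm, inducedMetric, Matrix.of_apply, hX.pderiv_pderiv hu]
  simp only [pderiv_eq]
  set A := fderiv ℝ (fderiv ℝ X) u (EuclideanSpace.single i 1) (EuclideanSpace.single j 1)
  set v := fderiv ℝ X u (EuclideanSpace.single i 1)
  set z := fderiv ℝ X u (EuclideanSpace.single j 1)
  have e1 : form ε v z = baseForm ε v.1 z.1 + v.2 * z.2 := rfl
  have e2 : form ε A (profileNormal w σ (X u)) = ε * A.1.1 * (w * (1 - (X u).1.1 ^ 2) / (X u).1.1)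
      - w * inner ℝ A.1.2 (X u).1.2 - A.2 * σ (X u).2 / (X u).1.1 := by
    simp only [form, baseForm, profileNormal, inner_smul_right]; ring
  have e3 : inner ℝ A.1.2 (X u).1.2 = - baseForm ε v.1 z.1 - ε * A.1.1 * (X u).1.1 := by
    rw [← h2]; simp only [baseForm]; ring
  rw [e1, e2, e3, h1]
  have hw := hψ.w_pos
  have hεε : ε * ε = 1 := by rcases hε with rfl | rfl <;> norm_num
  have hK : K = w ^ 2 + ε := by linarith [hψ.w_sq]
  rw [hK]
  field_simp
  ring_nf
  simp only [show ε ^ 2 = 1 by rw [sq, hεε]]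
  rcases hε with rfl | rfl <;> ring

theorem IsProfile.isStrictlyConvex (hψ : IsProfile ε K w ψ σ) (hε : ε = 1 ∨ ε = -1)
    (hS : S ⊆ productSpace n ε) (hS0 : ∀ p ∈ S, 0 < p.1.1) (hSψ : ∀ p ∈ S, p.1.1 = ψ p.2) :
    IsStrictlyConvex ε S := by
  refine ⟨profileNormal w σ, hψ.isUnitNormalField hε hS hS0 hSψ, ?_⟩
  rintro U X hX u hu k ⟨v', hv', hk⟩
  let v : Euc n := WithLp.toLp 2 v'
  have hv : v ≠ 0 := by simpa [v] using hv'
  have hg := hX.form_fderiv_pos hε hS hu hv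
  have hw := hψ.w_pos
  have hτ : ∑ i, v i * (pderiv i X u).2 = (fderiv ℝ X u v).2 := by
    rw [apply_eq_sum _ v]; simp [Prod.snd_sum, pderiv_eq]
  have hgv : ∑ i, v' i * (inducedMetric ε X u).mulVec v' i =
      form ε (fderiv ℝ X u v) (fderiv ℝ X u v) := by
    rw [← metricPair_inducedMetric]
    simp only [metricPair, Matrix.mulVec, dotProduct, Finset.mul_sum]
    exact Finset.sum_congr rfl fun i _ => Finset.sum_congr rfl fun j _ => by
      simp only [v]; ring
  have hh : ∑ i, v' i * (secondForm ε (profileNormal w σ) X u).mulVec v' i =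
      w * form ε (fderiv ℝ X u v) (fderiv ℝ X u v) + ε / w * (fderiv ℝ X u v).2 ^ 2 := by
    rw [← hgv, ← hτ, sq, Finset.sum_mul_sum]
    simp only [Matrix.mulVec, dotProduct, Finset.mul_sum, hψ.secondForm_eq hε hS hS0 hSψ hX hu,
      ← Finset.sum_add_distrib]
    exact Finset.sum_congr rfl fun i _ => Finset.sum_congr rfl fun j _ => by
      simp only [v]; ring
  rw [hk] at hh
  have hkg : k * form ε (fderiv ℝ X u v) (fderiv ℝ X u v) =
      w * form ε (fderiv ℝ X u v) (fderiv ℝ X u v) + ε / w * (fderiv ℝ X u v).2 ^ 2 := by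
    rw [← hh, ← hgv, Finset.mul_sum]
    exact Finset.sum_congr rfl fun i _ => by simp only [Pi.smul_apply, smul_eq_mul]; ring
  have hp := hX.mapsTo hu
  have h0 := hψ.fderiv_fst_fst hSψ hX hu v
  have h2 := hX.form_fderiv_posVec hS hu v
  rw [form_posVec] at h2
  have hen := hψ.energy (X u).2
  rw [← hSψ _ hp] at hen
  have hx := (hS hp).1
  have hwsq := hψ.w_sq
  set D := fderiv ℝ X u v
  -- it remains to see that the second fundamental form is positive definite
  suffices hpos : 0 < w ^ 2 * form ε D D + ε * D.2 ^ 2 by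
    have : k * (w * form ε D D) = w ^ 2 * form ε D D + ε * D.2 ^ 2 := by
      rw [← mul_assoc, mul_comm k, mul_assoc, hkg]; field_simp
    rw [← this] at hpos
    exact pos_of_mul_pos_left hpos (by positivity)
  rcases hε with rfl | rfl
  · positivity
  · have hcs := real_inner_mul_inner_self_le D.1.2 (X u).1.2
    simp only [baseForm, form] at h2 hx hg ⊢
    set r := (X u).1.1 ^ 2 - 1 with hr
    have hxx : inner ℝ (X u).1.2 (X u).1.2 = r := by rw [hr]; linarith
    have hr0 : 0 ≤ r := by rw [← hxx]; exact real_inner_self_nonneg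
    have hDx : inner ℝ D.1.2 (X u).1.2 = D.1.1 * (X u).1.1 := by linarith
    rw [hxx, hDx] at hcs
    set b := -1 * D.1.1 * D.1.1 + inner ℝ D.1.2 D.1.2 with hb
    have hDD : inner ℝ D.1.2 D.1.2 = b + D.1.1 * D.1.1 := by rw [hb]; ring
    rw [hDD] at hcs
    have h3 : w * D.1.1 = - (σ (X u).2 * D.2) := by rw [h0]; field_simp
    have h4 : w ^ 2 * D.1.1 ^ 2 = (1 - K * r) * D.2 ^ 2 := by
      have hσ : σ (X u).2 ^ 2 = 1 - K * r := by rw [hr]; linarith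
      rw [← hσ, ← mul_pow, h3]; ring
    have h5 : D.1.1 ^ 2 ≤ b * r := by nlinarith
    have h6 : (1 - K * r) * D.2 ^ 2 ≤ w ^ 2 * (b * r) := by
      rw [← h4]; exact mul_le_mul_of_nonneg_left h5 (by positivity)
    by_cases hD : D.2 = 0
    · rw [hD] at hg ⊢
      have : 0 < w ^ 2 := by positivity
      nlinarith
    · have hD2 : 0 < D.2 ^ 2 := by positivity
      have h7 : D.2 ^ 2 ≤ r * (w ^ 2 * (b + D.2 * D.2) + -1 * D.2 ^ 2) := by
        have : w ^ 2 * (b + D.2 * D.2) + -1 * D.2 ^ 2 = w ^ 2 * b + K * D.2 ^ 2 := by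
          rw [mul_add, hwsq]; ring
        rw [this]; nlinarith
      exact pos_of_mul_pos_right (lt_of_lt_of_le hD2 h7) hr0

theorem IsProfile.hasConstantSectionalCurvature (hψ : IsProfile ε K w ψ σ) (hε : ε = 1 ∨ ε = -1)
    (hS : S ⊆ productSpace n ε) (hS0 : ∀ p ∈ S, 0 < p.1.1) (hSψ : ∀ p ∈ S, p.1.1 = ψ p.2) :
    HasConstantSectionalCurvature ε S K := by
  intro U X hX u hu v z hvz
  refine hX.sectionalCurvature_eq hε hS hu (fun m i j k => ?_) hvz
  rw [hX.gauss_equation hε hS (hψ.isUnitNormalField hε hS hS0 hSψ) hu]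
  simp only [hψ.secondForm_eq hε hS hS0 hSψ hX hu, baseMetric_eq]
  have hw := hψ.w_pos
  rw [show K = w ^ 2 + ε by linarith [hψ.w_sq]]
  field_simp
  ring

theorem IsProfile.hasConstantScalarCurvature (hψ : IsProfile ε K w ψ σ) (hε : ε = 1 ∨ ε = -1)
    (hS : S ⊆ productSpace n ε) (hS0 : ∀ p ∈ S, 0 < p.1.1) (hSψ : ∀ p ∈ S, p.1.1 = ψ p.2) :
    HasConstantScalarCurvature ε S (n * (n - 1) * K) := by
  intro U X hX u hu
  rw [hX.scalarCurvature_eq hε hS (hψ.isUnitNormalField hε hS hS0 hSψ) hu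
    (hψ.secondForm_eq hε hS hS0 hSψ hX hu)]
  have hw := hψ.w_pos
  rw [show w * (ε / w) - ε = 0 by field_simp; ring, hψ.w_sq]
  ring

end Profile

/-! ### Rotational entire graphs -/

section Graph
variable {n : ℕ}

/-- A smooth map with a smooth left inverse which also inverts it on a relatively open subset of `S`
is a local parametrization of `S`. -/
theorem isLocalParam_of_leftInverse {S O : Set (Ambient n)} {U : Set (Euc n)}
    {X : Euc n → Ambient n} {Φ : Ambient n → Euc n} (hU : IsOpen U) (hX : ContDiffOn ℝ ∞ X U)
    (hO : IsOpen O) (hΦ : DifferentiableOn ℝ Φ O) (hmaps : ∀ u ∈ U, X u ∈ S ∩ O)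
    (hleft : ∀ u ∈ U, Φ (X u) = u) (hright : ∀ p ∈ S ∩ O, Φ p ∈ U ∧ X (Φ p) = p) :
    IsLocalParam S U X where
  isOpen := hU
  smooth := hX
  mapsTo := fun u hu => (hmaps u hu).1
  injOn := fun u hu v hv h => by rw [← hleft u hu, h, hleft v hv]
  immersion := fun u hu => by
    have h1 : HasFDerivAt X (fderiv ℝ X u) u :=
      ((hX.contDiffAt (hU.mem_nhds hu)).differentiableAt (by simp)).hasFDerivAt
    have h2 : HasFDerivAt Φ (fderiv ℝ Φ (X u)) (X u) :=
      (hΦ.differentiableAt (hO.mem_nhds (hmaps u hu).2)).hasFDerivAt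
    have h3 : HasFDerivAt (Φ ∘ X) (ContinuousLinearMap.id ℝ (Euc n)) u := by
      refine (hasFDerivAt_id u).congr_of_eventuallyEq ?_
      filter_upwards [hU.mem_nhds hu] with y hy using hleft y hy
    have h4 := (h2.comp u h1).unique h3
    refine Function.LeftInverse.injective (g := fderiv ℝ Φ (X u)) fun v => ?_
    simpa using congrArg (fun L => L v) h4
  isOpenMap := fun W hWU hW => by
    refine ⟨O ∩ Φ ⁻¹' W, hΦ.continuousOn.isOpen_inter_preimage hO hW, ?_⟩
    ext p
    constructor
    · rintro ⟨u, hu, rfl⟩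
      refine ⟨(hmaps u (hWU hu)).1, (hmaps u (hWU hu)).2, ?_⟩
      rw [mem_preimage, hleft u (hWU hu)]
      exact hu
    · rintro ⟨hp, hpO, hpW⟩
      exact ⟨Φ p, hpW, (hright p ⟨hp, hpO⟩).2⟩

theorem mem_spaceForm_neg_one (x : ℝ × Euc n) :
    x ∈ spaceForm n (-1) ↔ x.1 = √(1 + ‖x.2‖ ^ 2) := by
  simp only [spaceForm, mem_ofPred_eq, baseForm, real_inner_self_eq_norm_sq]
  constructor
  · rintro ⟨h1, h2⟩
    rw [eq_comm, Real.sqrt_eq_iff_mul_self_eq_of_pos (by simpa using h2)]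
    linarith
  · intro h
    have h0 : 0 < x.1 := by rw [h]; positivity
    have h1 : x.1 * x.1 = 1 + ‖x.2‖ ^ 2 := by rw [h, Real.mul_self_sqrt (by positivity)]
    exact ⟨by linarith, fun _ => h0⟩

/-- The rotational graph of height `φ(x₀)` over hyperbolic space. -/
def rotationalGraph (n : ℕ) (φ : ℝ → ℝ) : Set (Ambient n) :=
  {p | p.1 ∈ spaceForm n (-1) ∧ p.2 = φ p.1.1}

theorem isProperlyEmbeddedHypersurface_rotationalGraph {φ : ℝ → ℝ} (hφ : ContDiff ℝ ∞ φ) :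
    IsProperlyEmbeddedHypersurface (-1) (rotationalGraph n φ) where
  subset := fun p hp => hp.1
  locally_param := by
    intro p hp
    have hsqrt : ContDiff ℝ ∞ fun u : Euc n => √(1 + ‖u‖ ^ 2) :=
      (contDiff_const.add (contDiff_norm_sq ℝ)).sqrt fun u => by positivity
    refine ⟨univ, fun u => ((√(1 + ‖u‖ ^ 2), u), φ √(1 + ‖u‖ ^ 2)),
      isLocalParam_of_leftInverse (O := univ) (Φ := fun p => p.1.2) isOpen_univ ?_ isOpen_univ
        (by fun_prop) ?_ (fun u _ => rfl) ?_, p.1.2, mem_univ _, ?_⟩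
    · exact ((hsqrt.prodMk contDiff_id).prodMk (hφ.comp hsqrt)).contDiffOn
    · exact fun u _ => ⟨⟨(mem_spaceForm_neg_one _).2 rfl, rfl⟩, mem_univ _⟩
    · rintro ⟨⟨x0, x⟩, t⟩ ⟨⟨h1, h2⟩, -⟩
      have h1 : x0 = √(1 + ‖x‖ ^ 2) := (mem_spaceForm_neg_one _).1 h1
      have h2 : t = φ x0 := h2
      exact ⟨mem_univ _, by simp [← h1, h2]⟩
    · obtain ⟨⟨x0, x⟩, t⟩ := p
      have h1 : x0 = √(1 + ‖x‖ ^ 2) := (mem_spaceForm_neg_one _).1 hp.1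
      have h2 : t = φ x0 := hp.2
      simp [← h1, h2]
  isClosed := by
    have : rotationalGraph n φ = {p | p.1.1 = √(1 + ‖p.1.2‖ ^ 2)} ∩ {p | p.2 = φ p.1.1} := by
      ext p; simp [rotationalGraph, mem_spaceForm_neg_one]
    rw [this]
    have := hφ.continuous
    exact (isClosed_eq (by fun_prop) (by fun_prop)).inter (isClosed_eq (by fun_prop) (by fun_prop))

theorem isRotational_rotationalGraph (φ : ℝ → ℝ) : IsRotational (rotationalGraph n φ) := by
  intro A p hp
  refine ⟨?_, hp.2⟩
  have := hp.1
  rw [mem_spaceForm_neg_one] at this ⊢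
  simpa using this

theorem isEntireGraph_rotationalGraph {φ : ℝ → ℝ} (hφ : ContDiff ℝ ∞ φ) :
    IsEntireGraph (-1) (rotationalGraph n φ) :=
  ⟨fun x => φ x.1, hφ.comp contDiff_fst, rfl⟩

theorem isBowl_rotationalGraph (hn : 0 < n) {φ : ℝ → ℝ} (h1 : φ 1 = 0)
    (hmono : StrictMonoOn φ (Ici 1)) (htop : Filter.Tendsto φ Filter.atTop Filter.atTop) :
    IsBowl (rotationalGraph n φ) := by
  have hge : ∀ p ∈ rotationalGraph n φ, 1 ≤ p.1.1 := fun p hp => by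
    rw [(mem_spaceForm_neg_one _).1 hp.1]
    exact Real.one_le_sqrt.2 (by nlinarith [sq_nonneg ‖p.1.2‖])
  have hnn : ∀ p ∈ rotationalGraph n φ, 0 ≤ p.2 := fun p hp => by
    rw [hp.2, ← h1]
    exact hmono.monotoneOn self_mem_Ici (hge p hp) (hge p hp)
  refine ⟨hnn, ⟨((1, 0), 0), ⟨(mem_spaceForm_neg_one _).2 (by simp), h1.symm⟩, rfl, ?_, ?_⟩, ?_⟩
  · rintro ⟨⟨x0, x⟩, t⟩ hp ht
    have ht : t = 0 := ht
    have h2 : t = φ x0 := hp.2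
    have h3 : x0 = 1 := hmono.injOn (hge _ hp) self_mem_Ici (by rw [h1, ← h2, ht])
    have h4 : x0 = √(1 + ‖x‖ ^ 2) := (mem_spaceForm_neg_one _).1 hp.1
    have h5 : x = 0 := by
      rw [h3, eq_comm, Real.sqrt_eq_one] at h4
      simpa using h4
    rw [h3, h5, ht]
  · intro U X hX u hu hXu v
    -- the height function has a minimum at the point of contact
    have hmin : IsLocalMin (fun y => (X y).2) u := by
      filter_upwards [hX.isOpen.mem_nhds hu] with y hy
      rw [hXu]
      exact hnn _ (hX.mapsTo hy)
    have h2 := hmin.fderiv_eq_zero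
    have h3 := (hX.differentiableAt hu).hasFDerivAt.snd.fderiv
    have h4 : fderiv ℝ (fun y => (X y).2) u v = (fderiv ℝ X u v).2 := by rw [h3]; rfl
    rw [← h4, h2]; rfl
  · intro M
    obtain ⟨a, ha1, haM⟩ := ((Filter.eventually_ge_atTop (1 : ℝ)).and
      (htop.eventually (Filter.eventually_gt_atTop M))).exists
    refine ⟨((a, EuclideanSpace.single ⟨0, hn⟩ √(a ^ 2 - 1)), φ a), ⟨?_, rfl⟩, haM⟩
    have ha : 0 ≤ a ^ 2 - 1 := by nlinarith
    rw [mem_spaceForm_neg_one, eq_comm, Real.sqrt_eq_iff_mul_self_eq_of_pos (by linarith)]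
    simp [Real.sq_sqrt ha, ← sq]

theorem isProfile_one_add : IsProfile (-1) 0 1 (fun t => 1 + t) (fun _ => -1) where
  w_pos := one_pos
  w_sq := by norm_num
  hasDerivAt_psi := fun t => by simpa using (hasDerivAt_id t).const_add 1
  hasDerivAt_sigma := fun t => by simpa using hasDerivAt_const t (-1 : ℝ)
  energy := fun t => by norm_num

theorem isProfile_sinh {K w : ℝ} (hK : K < 0) (hw : 0 < w) (hwK : w ^ 2 = K + 1) (t₁ : ℝ) :
    IsProfile (-1) K w (fun t => w / √(-K) * Real.sinh (√(-K) / w * t + t₁))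
      (fun t => -w * Real.cosh (√(-K) / w * t + t₁)) := by
  have hs : 0 < √(-K) := Real.sqrt_pos.2 (by linarith)
  have hs2 : √(-K) ^ 2 = -K := Real.sq_sqrt (by linarith)
  have hlin : ∀ t, HasDerivAt (fun t => √(-K) / w * t + t₁) (√(-K) / w) t := fun t => by
    simpa using ((hasDerivAt_id t).const_mul (√(-K) / w)).add_const t₁
  refine ⟨hw, by linarith, fun t => ?_, fun t => ?_, fun t => ?_⟩
  · refine ((hlin t).sinh.const_mul (w / √(-K))).congr_deriv ?_
    generalize Real.cosh (√(-K) / w * t + t₁) = C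
    field_simp
  · refine ((hlin t).cosh.const_mul (-w)).congr_deriv ?_
    generalize Real.sinh (√(-K) / w * t + t₁) = C
    field_simp
    linear_combination (-C) * hs2
  · have hK0 : K ≠ 0 := hK.ne
    have h := Real.cosh_sq (√(-K) / w * t + t₁)
    rw [mul_pow, mul_pow, div_pow, hs2, hwK, neg_sq, hwK, h]
    generalize Real.sinh (√(-K) / w * t + t₁) = C
    field_simp
    ring

/-- For `-1 < K ≤ 0` some profile hypersurface in `ℍⁿ × ℝ` is an entire bowl-shaped graph: the
profile equation `x₀ = ψ(t)` is solved for the height by `t = x₀ - 1` if `K = 0`, and by an inverse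
hyperbolic sine if `K < 0`. -/
theorem exists_profile_bowl (hn : 0 < n) {K : ℝ} (hK : -1 < K) (hK0 : K ≤ 0) :
    ∃ (S : Set (Ambient n)) (w : ℝ) (ψ σ : ℝ → ℝ), IsProfile (-1) K w ψ σ ∧
      IsProperlyEmbeddedHypersurface (-1) S ∧ IsRotational S ∧ (∀ p ∈ S, 0 < p.1.1) ∧
      (∀ p ∈ S, p.1.1 = ψ p.2) ∧ IsEntireGraph (-1) S ∧ IsBowl S := by
  suffices h : ∃ (φ : ℝ → ℝ) (w : ℝ) (ψ σ : ℝ → ℝ), IsProfile (-1) K w ψ σ ∧ ContDiff ℝ ∞ φ ∧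
      φ 1 = 0 ∧ StrictMono φ ∧ Filter.Tendsto φ Filter.atTop Filter.atTop ∧
      ∀ x, ψ (φ x) = x by
    obtain ⟨φ, w, ψ, σ, hψ, hφ, h1, hmono, htop, hinv⟩ := h
    exact ⟨rotationalGraph n φ, w, ψ, σ, hψ, isProperlyEmbeddedHypersurface_rotationalGraph hφ,
      isRotational_rotationalGraph φ, fun p hp => hp.1.2 rfl, fun p hp => by rw [hp.2, hinv],
      isEntireGraph_rotationalGraph hφ, isBowl_rotationalGraph hn h1 (hmono.strictMonoOn _) htop⟩
  rcases hK0.eq_or_lt with rfl | hK0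
  · refine ⟨fun x => x - 1, 1, _, _, isProfile_one_add, by fun_prop, by norm_num,
      fun a b hab => by simpa using hab, ?_, fun x => by ring⟩
    exact Filter.tendsto_atTop_add_const_right _ (-1) Filter.tendsto_id
  · have hw : 0 < √(K + 1) := Real.sqrt_pos.2 (by linarith)
    have hs : 0 < √(-K) := Real.sqrt_pos.2 (by linarith)
    set a := √(K + 1) / √(-K) with ha
    have ha0 : 0 < a := div_pos hw hs
    have hmono : StrictMono fun x => a * (Real.arsinh (x / a) - Real.arsinh (1 / a)) := by
      intro x y hxy
      refine mul_lt_mul_of_pos_left (sub_lt_sub_right (Real.arsinh_strictMono ?_) _) ha0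
      exact div_lt_div_of_pos_right hxy ha0
    have hval : ∀ y, a * (Real.arsinh (a * Real.sinh (y / a + Real.arsinh (1 / a)) / a) -
        Real.arsinh (1 / a)) = y := fun y => by
      rw [mul_div_cancel_left₀ _ ha0.ne', Real.arsinh_sinh]
      field_simp
      ring
    refine ⟨fun x => a * (Real.arsinh (x / a) - Real.arsinh (1 / a)), √(K + 1), _, _,
      isProfile_sinh hK0 hw (Real.sq_sqrt (by linarith)) (Real.arsinh (1 / a)), ?_, ?_, hmono,
      ?_, fun x => ?_⟩
    · exact contDiff_const.mul
        ((Real.contDiff_arsinh.comp (contDiff_id.div_const a)).sub contDiff_const)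
    · simp
    · refine hmono.monotone.tendsto_atTop_atTop fun y => ⟨_, (hval y).ge⟩
    · have : √(-K) / √(K + 1) * (a * (Real.arsinh (x / a) - Real.arsinh (1 / a))) +
          Real.arsinh (1 / a) = Real.arsinh (x / a) := by
        rw [ha]; field_simp; ring
      simp only [this, Real.sinh_arsinh]
      rw [← ha]; field_simp

end Graph

/-! ### Rotational spheres -/

section Sphere
variable {n : ℕ}

/-- The first `n` coordinates of a vector of `ℝⁿ⁺¹`. -/
def initPart (q : Euc (n + 1)) : Euc n := WithLp.toLp 2 fun i => q i.castSucc

/-- The vector of `ℝⁿ⁺¹` with first `n` coordinates `y` and last coordinate `s`. -/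
def append (y : Euc n) (s : ℝ) : Euc (n + 1) :=
  WithLp.toLp 2 (Fin.snoc (α := fun _ => ℝ) (fun i => y i) s)

theorem append_last (y : Euc n) (s : ℝ) : append y s (Fin.last n) = s := by simp [append]

theorem initPart_append (y : Euc n) (s : ℝ) : initPart (append y s) = y := by
  ext i; simp [append, initPart]

theorem append_initPart (q : Euc (n + 1)) : append (initPart q) (q (Fin.last n)) = q := by
  ext i
  refine Fin.lastCases ?_ (fun i => ?_) i <;> simp [append, initPart]

theorem norm_append_sq (y : Euc n) (s : ℝ) : ‖append y s‖ ^ 2 = ‖y‖ ^ 2 + s ^ 2 := by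
  simp [EuclideanSpace.norm_sq_eq, Fin.sum_univ_castSucc, append]

theorem norm_sq_eq_initPart (q : Euc (n + 1)) :
    ‖q‖ ^ 2 = ‖initPart q‖ ^ 2 + q (Fin.last n) ^ 2 := by
  conv_lhs => rw [← append_initPart q, norm_append_sq]

theorem contDiff_initPart : ContDiff ℝ ∞ (initPart : Euc (n + 1) → Euc n) := by
  refine contDiff_euclidean.2 fun i => ?_
  simp only [initPart]
  fun_prop

theorem contDiff_append {f : Ambient n → Euc n} {g : Ambient n → ℝ} (hf : ContDiff ℝ ∞ f)
    (hg : ContDiff ℝ ∞ g) : ContDiff ℝ ∞ fun p => append (f p) (g p) := by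
  refine contDiff_euclidean.2 fun i => ?_
  refine Fin.lastCases ?_ (fun i => ?_) i
  · simpa [append] using hg
  · simpa [append] using contDiff_euclidean.1 hf i

/-- A profile for `K > 0` together with a function `θ` which recovers the height `t` from the value
`σ(t) ∈ [-1, 1]`. -/
structure IsClosedProfile (ε K w : ℝ) (ψ σ θ : ℝ → ℝ) : Prop extends IsProfile ε K w ψ σ where
  K_pos : 0 < K
  contDiff_psi : ContDiff ℝ ∞ ψ
  contDiff_sigma : ContDiff ℝ ∞ σ
  contDiffAt_theta : ∀ s, |s| ≤ 1 → ContDiffAt ℝ ∞ θ s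
  sigma_theta : ∀ s, |s| ≤ 1 → σ (θ s) = s
  psi_theta_pos : ∀ s, |s| ≤ 1 → 0 < ψ (θ s)
  psi_neg : ∀ t, ψ (-t) = ψ t
  theta_neg : ∀ s, θ (-s) = -θ s

/-- The isometric embedding (up to scaling by `√K`) of the unit sphere of `ℝⁿ⁺¹`:
the point `(y, s)` goes to the height `θ(s)`, and `y` becomes `√K x`. -/
def sphereMap (K : ℝ) (ψ θ : ℝ → ℝ) (q : Euc (n + 1)) : Ambient n :=
  ((ψ (θ (q (Fin.last n))), (√K)⁻¹ • initPart q), θ (q (Fin.last n)))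

/-- The left inverse of `sphereMap`. -/
def sphereInv (K : ℝ) (σ : ℝ → ℝ) (p : Ambient n) : Euc (n + 1) := append (√K • p.1.2) (σ p.2)

/-- The rotational sphere with a given closed profile. -/
def rotationalSphere (n : ℕ) (K : ℝ) (ψ θ : ℝ → ℝ) : Set (Ambient n) :=
  sphereMap K ψ θ '' Metric.sphere 0 1

variable {ε K w : ℝ} {ψ σ θ : ℝ → ℝ}

theorem abs_last_le_one {q : Euc (n + 1)} (hq : q ∈ Metric.sphere (0 : Euc (n + 1)) 1) :
    |q (Fin.last n)| ≤ 1 := by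
  have h : ‖q‖ = 1 := by simpa using hq
  rw [← h]; exact PiLp.norm_apply_le q _

namespace IsClosedProfile

theorem sphereInv_sphereMap (h : IsClosedProfile ε K w ψ σ θ) {q : Euc (n + 1)}
    (hq : q ∈ Metric.sphere (0 : Euc (n + 1)) 1) :
    sphereInv K σ (sphereMap K ψ θ q) = q := by
  have hK : √K ≠ 0 := (Real.sqrt_pos.2 h.K_pos).ne'
  simp only [sphereInv, sphereMap, smul_inv_smul₀ hK, h.sigma_theta _ (abs_last_le_one hq),
    append_initPart]

theorem contDiff_sphereInv (h : IsClosedProfile ε K w ψ σ θ) :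
    ContDiff ℝ ∞ (sphereInv (n := n) K σ) :=
  contDiff_append (by fun_prop) (h.contDiff_sigma.comp contDiff_snd)

theorem contDiffAt_sphereMap (h : IsClosedProfile ε K w ψ σ θ) {q : Euc (n + 1)}
    (hq : q ∈ Metric.sphere (0 : Euc (n + 1)) 1) : ContDiffAt ℝ ∞ (sphereMap K ψ θ) q := by
  have h1 : ContDiffAt ℝ ∞ (fun q : Euc (n + 1) => θ (q (Fin.last n))) q :=
    (h.contDiffAt_theta _ (abs_last_le_one hq)).comp q (f := fun q : Euc (n + 1) => q (Fin.last n))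
      (by fun_prop)
  exact ((h.contDiff_psi.contDiffAt.comp q h1).prodMk
    (contDiff_initPart.contDiffAt.const_smul _)).prodMk h1

theorem contDiff_sphereMap_comp (h : IsClosedProfile ε K w ψ σ θ) {f : Euc n → Euc (n + 1)}
    (hf : ContDiff ℝ ∞ f) (hmem : ∀ u, f u ∈ Metric.sphere (0 : Euc (n + 1)) 1) :
    ContDiff ℝ ∞ fun u => sphereMap K ψ θ (f u) :=
  contDiff_iff_contDiffAt.2 fun u => (h.contDiffAt_sphereMap (hmem u)).comp u hf.contDiffAt

theorem rotationalSphere_subset (h : IsClosedProfile ε K w ψ σ θ) (hε : ε = 1 ∨ ε = -1) :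
    rotationalSphere n K ψ θ ⊆ productSpace n ε := by
  rintro _ ⟨q, hq, rfl⟩
  have h1 : ‖q‖ = 1 := by simpa using hq
  have h2 := norm_sq_eq_initPart q
  have hs := abs_last_le_one hq
  have he := h.energy (θ (q (Fin.last n)))
  rw [h.sigma_theta _ hs] at he
  refine ⟨?_, fun _ => h.psi_theta_pos _ hs⟩
  simp only [sphereMap, baseForm, inner_smul_left, inner_smul_right, real_inner_self_eq_norm_sq,
    RCLike.conj_to_real]
  have hK := h.K_pos
  have hi : (√K)⁻¹ * ((√K)⁻¹ * ‖initPart q‖ ^ 2) = ‖initPart q‖ ^ 2 / K := by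
    rw [← mul_assoc, ← mul_inv, Real.mul_self_sqrt hK.le]; ring
  rw [hi]
  rw [h1] at h2
  have h3 : ‖initPart q‖ ^ 2 = 1 - q (Fin.last n) ^ 2 := by linarith
  rw [h3]
  field_simp
  rcases hε with rfl | rfl <;> linarith

theorem pos_of_mem (h : IsClosedProfile ε K w ψ σ θ) :
    ∀ p ∈ rotationalSphere n K ψ θ, 0 < p.1.1 := by
  rintro _ ⟨q, hq, rfl⟩
  exact h.psi_theta_pos _ (abs_last_le_one hq)

theorem eq_psi_of_mem : ∀ p ∈ rotationalSphere n K ψ θ, p.1.1 = ψ p.2 := by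
  rintro _ ⟨q, hq, rfl⟩
  rfl

theorem isRotational : IsRotational (rotationalSphere n K ψ θ) := by
  rintro A _ ⟨q, hq, rfl⟩
  refine ⟨append (A (initPart q)) (q (Fin.last n)), ?_, ?_⟩
  · have h1 : ‖q‖ ^ 2 = 1 := by simp [show ‖q‖ = 1 by simpa using hq]
    rw [mem_sphere_zero_iff_norm, ← sq_eq_sq₀ (norm_nonneg _) zero_le_one, norm_append_sq,
      A.norm_map, ← norm_sq_eq_initPart, h1, one_pow]
  · simp only [sphereMap, append_last, initPart_append, map_smul]

theorem isSymmetricHorizontal (h : IsClosedProfile ε K w ψ σ θ) :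
    IsSymmetricHorizontal (rotationalSphere n K ψ θ) := by
  refine ⟨0, ?_⟩
  rintro _ ⟨q, hq, rfl⟩
  refine ⟨append (initPart q) (-q (Fin.last n)), ?_, ?_⟩
  · have h1 : ‖q‖ ^ 2 = 1 := by simp [show ‖q‖ = 1 by simpa using hq]
    rw [mem_sphere_zero_iff_norm, ← sq_eq_sq₀ (norm_nonneg _) zero_le_one, norm_append_sq,
      neg_sq, ← norm_sq_eq_initPart, h1, one_pow]
  · simp [sphereMap, append_last, initPart_append, h.theta_neg, h.psi_neg]

theorem isEmbeddedSphere (h : IsClosedProfile ε K w ψ σ θ) :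
    IsEmbeddedSphere (rotationalSphere n K ψ θ) := by
  have : Fact (Module.finrank ℝ (Euc (n + 1)) = n + 1) := ⟨by simp⟩
  have hF : ∀ q : Metric.sphere (0 : Euc (n + 1)) 1,
      ContMDiffAt (𝓡 n) 𝓘(ℝ, Ambient n) ∞ (fun q : Metric.sphere (0 : Euc (n + 1)) 1 =>
        (sphereMap K ψ θ (q : Euc (n + 1)) : Ambient n)) q := fun q =>
    (h.contDiffAt_sphereMap q.2).contMDiffAt.comp q (contMDiff_coe_sphere q)
  have hinv : ∀ q : Metric.sphere (0 : Euc (n + 1)) 1,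
      sphereInv K σ (sphereMap K ψ θ (q : Euc (n + 1))) = q := fun q => h.sphereInv_sphereMap q.2
  refine ⟨fun q => sphereMap K ψ θ q, hF, fun p q hpq => ?_, fun q => ?_, ?_⟩
  · have := congrArg (sphereInv K σ) hpq
    simp only [hinv] at this
    exact Subtype.ext this
  · have h1 : MDifferentiableAt (𝓡 n) 𝓘(ℝ, Ambient n)
        (fun q : Metric.sphere (0 : Euc (n + 1)) 1 => sphereMap K ψ θ (q : Euc (n + 1))) q :=
      (hF q).mdifferentiableAt (by simp)
    have h2 : MDifferentiableAt 𝓘(ℝ, Ambient n) 𝓘(ℝ, Euc (n + 1)) (sphereInv (n := n) K σ)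
        (sphereMap K ψ θ (q : Euc (n + 1))) :=
      (h.contDiff_sphereInv.differentiable (by simp)).differentiableAt.mdifferentiableAt
    have h3 := mfderiv_comp q h2 h1
    have h4 : (sphereInv (n := n) K σ) ∘
        (fun q : Metric.sphere (0 : Euc (n + 1)) 1 => sphereMap K ψ θ (q : Euc (n + 1))) =
        ((↑) : Metric.sphere (0 : Euc (n + 1)) 1 → Euc (n + 1)) := funext hinv
    rw [h4] at h3
    have h5 : Function.Injective (mfderiv (𝓡 n) 𝓘(ℝ, Euc (n + 1))
        ((↑) : Metric.sphere (0 : Euc (n + 1)) 1 → Euc (n + 1)) q) := by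
      convert! injective_mvfderiv_subtypeVal_sphere (n := n) q
    rw [h3] at h5
    exact Function.Injective.of_comp h5
  · rw [rotationalSphere, image_eq_range]

theorem isProperlyEmbeddedHypersurface (h : IsClosedProfile ε K w ψ σ θ) (hε : ε = 1 ∨ ε = -1) :
    IsProperlyEmbeddedHypersurface ε (rotationalSphere n K ψ θ) where
  subset := h.rotationalSphere_subset hε
  isClosed := by
    refine IsCompact.isClosed ((isCompact_sphere 0 1).image_of_continuousOn fun q hq => ?_)
    exact (h.contDiffAt_sphereMap hq).continuousAt.continuousWithinAt
  locally_param := by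
    rintro _ ⟨q, hq, rfl⟩
    have : Fact (Module.finrank ℝ (Euc (n + 1)) = n + 1) := ⟨by simp⟩
    -- stereographic projection from the point `v = -q`
    set v : Euc (n + 1) := -q with hvdef
    have hv : ‖v‖ = 1 := by simpa [hvdef] using hq
    have hv0 : v ≠ 0 := by rw [← norm_ne_zero_iff, hv]; exact one_ne_zero
    let L := (OrthonormalBasis.fromOrthogonalSpanSingleton (𝕜 := ℝ) n hv0).repr
    have hmem : ∀ u, stereoInvFunAux v (L.symm u : Euc (n + 1)) ∈
        Metric.sphere (0 : Euc (n + 1)) 1 := fun u => stereoInvFunAux_mem hv (L.symm u).2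
    have hne : ∀ x ∈ Metric.sphere (0 : Euc (n + 1)) 1, innerSL ℝ v x ≠ 1 ↔ x ≠ v := by
      intro x hx
      rw [innerSL_apply_apply, ne_eq,
        inner_eq_one_iff_of_norm_eq_one hv (by simpa using hx), eq_comm]
    have hpt : ∀ x ∈ Metric.sphere (0 : Euc (n + 1)) 1, x ≠ v →
        stereoInvFunAux v (stereoToFun v x : Euc (n + 1)) = x := fun x hx hxv =>
      congrArg Subtype.val (stereo_left_inv hv (x := ⟨x, hx⟩) hxv)
    have hsmooth : ContDiff ℝ ∞ fun u => stereoInvFunAux v (L.symm u : Euc (n + 1)) :=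
      contDiff_stereoInvFunAux.comp
        ((ℝ ∙ v)ᗮ.subtypeL.contDiff.comp L.symm.toContinuousLinearEquiv.contDiff)
    have hO : IsOpen {p : Ambient n | innerSL ℝ v (sphereInv K σ p) ≠ 1} :=
      isOpen_ne_fun ((innerSL ℝ v).continuous.comp h.contDiff_sphereInv.continuous)
        continuous_const
    refine ⟨univ, fun u => sphereMap K ψ θ (stereoInvFunAux v (L.symm u : Euc (n + 1))),
      isLocalParam_of_leftInverse (O := {p | innerSL ℝ v (sphereInv K σ p) ≠ 1})
        (Φ := fun p => L (stereoToFun v (sphereInv K σ p))) isOpen_univ ?_ hO ?_ ?_ ?_ ?_,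
      L (stereoToFun v q), mem_univ _, ?_⟩
    · exact (h.contDiff_sphereMap_comp hsmooth hmem).contDiffOn
    · have h1 : ContDiffOn ℝ ∞ (fun p : Ambient n => stereoToFun v (sphereInv K σ p))
          {p | innerSL ℝ v (sphereInv K σ p) ≠ 1} :=
        (contDiffOn_stereoToFun (v := v)).comp h.contDiff_sphereInv.contDiffOn fun p hp => hp
      exact (L.toContinuousLinearEquiv.contDiff.comp_contDiffOn h1).differentiableOn (by simp)
    · intro u _
      refine ⟨mem_image_of_mem _ (hmem u), ?_⟩
      rw [mem_ofPred_eq, h.sphereInv_sphereMap (hmem u), hne _ (hmem u)]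
      exact fun h' => stereoInvFun_ne_north_pole hv (L.symm u) (Subtype.ext h')
    · intro u _
      rw [h.sphereInv_sphereMap (hmem u)]
      have := stereo_right_inv hv (L.symm u)
      rw [show stereoToFun v (stereoInvFunAux v (L.symm u : Euc (n + 1))) = L.symm u from this]
      simp
    · rintro _ ⟨⟨x, hx, rfl⟩, hxO⟩
      rw [mem_ofPred_eq, h.sphereInv_sphereMap hx, hne _ hx] at hxO
      refine ⟨mem_univ _, ?_⟩
      simp only [h.sphereInv_sphereMap hx, LinearIsometryEquiv.symm_apply_apply, hpt x hx hxO]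
    · have hqv : q ≠ v := by
        intro h'
        have h0 : q = 0 := by
          have h2 : (2 : ℝ) • q = 0 := by rw [two_smul]; nth_rewrite 1 [h']; simp [hvdef]
          exact (smul_eq_zero.1 h2).resolve_left two_ne_zero
        rw [h0] at hq; simp at hq
      simp only [LinearIsometryEquiv.symm_apply_apply, hpt q hq hqv]

end IsClosedProfile

/-- In `𝕊ⁿ × ℝ` the profile is a catenary. -/
theorem exists_isClosedProfile_one (hK : 1 < K) :
    ∃ w ψ σ θ, IsClosedProfile 1 K w ψ σ θ := by
  have hw : 0 < √(K - 1) := Real.sqrt_pos.2 (by linarith)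
  have hw2 : √(K - 1) ^ 2 = K - 1 := Real.sq_sqrt (by linarith)
  have hs : 0 < √K := Real.sqrt_pos.2 (by linarith)
  have hs2 : √K ^ 2 = K := Real.sq_sqrt (by linarith)
  set w := √(K - 1)
  have hlin : ∀ t, HasDerivAt (fun t => √K / w * t) (√K / w) t := fun t => by
    simpa using (hasDerivAt_id t).const_mul (√K / w)
  refine ⟨w, fun t => w / √K * Real.cosh (√K / w * t), fun t => w * Real.sinh (√K / w * t),
    fun s => w / √K * Real.arsinh (s / w), ⟨hw, hw2, fun t => ?_, fun t => ?_, fun t => ?_⟩,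
    by linarith, ?_, ?_, fun s _ => ?_, fun s _ => ?_, fun s _ => ?_, fun t => ?_, fun s => ?_⟩
  · refine ((hlin t).cosh.const_mul (w / √K)).congr_deriv ?_
    generalize Real.sinh (√K / w * t) = C
    field_simp
  · refine ((hlin t).sinh.const_mul w).congr_deriv ?_
    generalize Real.cosh (√K / w * t) = C
    field_simp
    linear_combination C * hs2
  · have h := Real.cosh_sq (√K / w * t)
    rw [mul_pow, mul_pow, div_pow, hs2, hw2, h]
    generalize Real.sinh (√K / w * t) = C
    have : K ≠ 0 := by linarith
    field_simp
    ring
  · exact contDiff_const.mul (Real.contDiff_cosh.comp (contDiff_const.mul contDiff_id))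
  · exact contDiff_const.mul (Real.contDiff_sinh.comp (contDiff_const.mul contDiff_id))
  · exact (contDiff_const.mul (Real.contDiff_arsinh.comp (contDiff_id.div_const w))).contDiffAt
  · have : √K / w * (w / √K * Real.arsinh (s / w)) = Real.arsinh (s / w) := by field_simp
    simp only [this, Real.sinh_arsinh]
    field_simp
  · have := Real.cosh_pos (√K / w * (w / √K * Real.arsinh (s / w)))
    positivity
  · simp only [mul_neg, Real.cosh_neg]
  · simp only [neg_div, Real.arsinh_neg, mul_neg]

/-- In `ℍⁿ × ℝ` the profile of positive curvature is an arc of a cosine curve. -/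
theorem exists_isClosedProfile_neg_one (hK : 0 < K) :
    ∃ w ψ σ θ, IsClosedProfile (-1) K w ψ σ θ := by
  have hw : 0 < √(K + 1) := Real.sqrt_pos.2 (by linarith)
  have hw2 : √(K + 1) ^ 2 = K + 1 := Real.sq_sqrt (by linarith)
  have hs : 0 < √K := Real.sqrt_pos.2 hK
  have hs2 : √K ^ 2 = K := Real.sq_sqrt hK.le
  have hw1 : 1 < √(K + 1) := Real.lt_sqrt_of_sq_lt (by linarith)
  set w := √(K + 1)
  have hlin : ∀ t, HasDerivAt (fun t => √K / w * t) (√K / w) t := fun t => by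
    simpa using (hasDerivAt_id t).const_mul (√K / w)
  have hlt : ∀ s, |s| ≤ 1 → -1 < s / w ∧ s / w < 1 := fun s h => by
    rw [lt_div_iff₀ hw, div_lt_iff₀ hw]
    exact ⟨by linarith [(abs_le.1 h).1], by linarith [(abs_le.1 h).2]⟩
  have hcancel : ∀ s, √K / w * (w / √K * Real.arcsin (s / w)) = Real.arcsin (s / w) :=
    fun s => by field_simp
  refine ⟨w, fun t => w / √K * Real.cos (√K / w * t), fun t => w * Real.sin (√K / w * t),
    fun s => w / √K * Real.arcsin (s / w), ⟨hw, by linarith, fun t => ?_, fun t => ?_,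
    fun t => ?_⟩, hK, ?_, ?_, fun s h => ?_, fun s h => ?_, fun s h => ?_, fun t => ?_,
    fun s => ?_⟩
  · refine ((hlin t).cos.const_mul (w / √K)).congr_deriv ?_
    generalize Real.sin (√K / w * t) = C
    field_simp
  · refine ((hlin t).sin.const_mul w).congr_deriv ?_
    generalize Real.cos (√K / w * t) = C
    field_simp
    linear_combination C * hs2
  · have h := Real.cos_sq' (√K / w * t)
    rw [mul_pow, mul_pow, div_pow, hs2, hw2, h]
    generalize Real.sin (√K / w * t) = C
    field_simp
    ring
  · exact contDiff_const.mul (Real.contDiff_cos.comp (contDiff_const.mul contDiff_id))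
  · exact contDiff_const.mul (Real.contDiff_sin.comp (contDiff_const.mul contDiff_id))
  · refine contDiffAt_const.mul (ContDiffAt.comp (g := Real.arcsin) s (Real.contDiffAt_arcsin (hlt s h).1.ne'
      (hlt s h).2.ne) (contDiff_id.div_const w).contDiffAt)
  · simp only [hcancel, Real.sin_arcsin (hlt s h).1.le (hlt s h).2.le]
    field_simp
  · have h2 : (s / w) ^ 2 < 1 := (sq_lt_one_iff_abs_lt_one _).2 (abs_lt.2 (hlt s h))
    have : 0 < √(1 - (s / w) ^ 2) := Real.sqrt_pos.2 (by linarith)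
    simp only [hcancel, Real.cos_arcsin]
    positivity
  · simp only [mul_neg, Real.cos_neg]
  · simp only [neg_div, Real.arcsin_neg, mul_neg]

end Sphere

/-! ### The unit normal of a rotational hypersurface -/

section Rotational
variable {n : ℕ}

/-- The rotation `((x₀, x), t) ↦ ((x₀, A x), t)`. -/
def rotate (A : Euc n ≃ₗᵢ[ℝ] Euc n) : Ambient n ≃L[ℝ] Ambient n :=
  ((ContinuousLinearEquiv.refl ℝ ℝ).prodCongr A.toContinuousLinearEquiv).prodCongr
    (ContinuousLinearEquiv.refl ℝ ℝ)

theorem rotate_apply (A : Euc n ≃ₗᵢ[ℝ] Euc n) (p : Ambient n) :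
    rotate A p = ((p.1.1, A p.1.2), p.2) := rfl

theorem form_rotate (ε : ℝ) (A : Euc n ≃ₗᵢ[ℝ] Euc n) (p q : Ambient n) :
    form ε (rotate A p) (rotate A q) = form ε p q := by
  simp [form, baseForm, rotate_apply]

variable {ε : ℝ} {S : Set (Ambient n)} {N : Ambient n → Ambient n} {U : Set (Euc n)}
  {X : Euc n → Ambient n}

theorem IsLocalParam.comp_rotate (hX : IsLocalParam S U X) (hrot : IsRotational S)
    (A : Euc n ≃ₗᵢ[ℝ] Euc n) : IsLocalParam S U (fun u => rotate A (X u)) where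
  isOpen := hX.isOpen
  smooth := (rotate A).contDiff.comp_contDiffOn hX.smooth
  mapsTo := fun u hu => hrot A _ (hX.mapsTo hu)
  injOn := fun u hu v hv h => hX.injOn hu hv ((rotate A).injective h)
  immersion := fun u hu => by
    have h : fderiv ℝ (fun u => rotate A (X u)) u = _ :=
      ((rotate A).hasFDerivAt.comp u (hX.differentiableAt hu).hasFDerivAt).fderiv
    rw [h]
    exact (rotate A).injective.comp (hX.immersion u hu)
  isOpenMap := fun W hWU hW => by
    obtain ⟨V, hV, hWV⟩ := hX.isOpenMap W hWU hW
    refine ⟨(rotate A).symm ⁻¹' V,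
      hV.preimage (rotate A).symm.continuous, ?_⟩
    ext p
    constructor
    · rintro ⟨u, hu, rfl⟩
      have : X u ∈ S ∩ V := hWV ▸ mem_image_of_mem X hu
      exact ⟨hrot A _ this.1, by simpa using this.2⟩
    · rintro ⟨hp, hpV⟩
      have h1 : (rotate A).symm p ∈ S := hrot A.symm p hp
      have h2 : (rotate A).symm p ∈ X '' W := by rw [hWV]; exact ⟨h1, hpV⟩
      obtain ⟨u, hu, hup⟩ := h2
      exact ⟨u, hu, by simp [hup]⟩

theorem IsLocalParam.fderiv_rotate (hX : IsLocalParam S U X) (A : Euc n ≃ₗᵢ[ℝ] Euc n) {u : Euc n}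
    (hu : u ∈ U) (v : Euc n) :
    fderiv ℝ (fun u => rotate A (X u)) u v =
      rotate A (fderiv ℝ X u v) := by
  have h : fderiv ℝ (fun u => rotate A (X u)) u = _ :=
    ((rotate A).hasFDerivAt.comp u (hX.differentiableAt hu).hasFDerivAt).fderiv
  rw [h]; rfl

/-- At a fixed point of a rotation, the unit normal is preserved up to a factor. -/
theorem exists_normal_eq_smul_rotate (hε : ε = 1 ∨ ε = -1) (hS : IsProperlyEmbeddedHypersurface ε S)
    (hrot : IsRotational S) (hN : IsUnitNormalField ε S N) {p : Ambient n} (hp : p ∈ S)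
    {A : Euc n ≃ₗᵢ[ℝ] Euc n} (hA : rotate A p = p) : ∃ δ : ℝ, N p = δ • rotate A (N p) := by
  obtain ⟨U, X, hX, u, hu, rfl⟩ := hS.locally_param p hp
  have hY := hX.comp_rotate hrot A
  have hpos : rotate A (posVec (X u)) = posVec (X u) := by
    rw [rotate_apply, Prod.ext_iff, Prod.ext_iff] at hA
    simp only [rotate_apply, posVec]
    rw [show A (X u).1.2 = (X u).1.2 from hA.1.2]
  have hNP : form ε (N (X u)) (posVec (X u)) = 0 := by rw [form_posVec]; exact hN.tangent _ hp
  have hDN : ∀ v, form ε (rotate A (fderiv ℝ X u v)) (rotate A (N (X u))) = 0 := fun v => by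
    rw [form_rotate, form_comm]; exact hN.normal U X hX u hu v
  obtain ⟨a, ha⟩ := exists_decomposition hε _ (hY.immersion u hu) (N := rotate A (N (X u)))
    (P := posVec (X u)) (by rw [form_rotate]; exact hN.unit _ hp)
    (form_posVec_self (hS.subset hp))
    (by rw [← hpos, form_rotate]; exact hNP)
    (fun v => by rw [hX.fderiv_rotate A hu, hDN])
    (fun v => by
      rw [hX.fderiv_rotate A hu, ← hpos, form_rotate]
      exact hX.form_fderiv_posVec hS.subset hu v) (N (X u))
  rw [hNP, mul_zero, zero_smul, add_zero] at ha
  set δ := form ε (N (X u)) (rotate A (N (X u)))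
  refine ⟨δ, ?_⟩
  by_cases h0 : a = 0
  · rw [h0, map_zero, zero_add] at ha
    exact ha
  · exfalso
    have h1 := hY.form_fderiv_pos hε hS.subset hu h0
    have h2 : fderiv ℝ (fun u => rotate A (X u)) u a = N (X u) - δ • rotate A (N (X u)) :=
      eq_sub_of_add_eq ha.symm
    have h3 := hN.normal U _ hY u hu a
    rw [hA] at h3
    have h4 := hDN a
    rw [← hX.fderiv_rotate A hu] at h4
    nth_rewrite 2 [h2] at h1
    rw [form_sub_right, form_smul_right, form_comm, h3, h4] at h1
    simp at h1

/-- The horizontal part of the unit normal of a rotational hypersurface is radial. -/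
theorem exists_normal_eq_smul (hn : 3 ≤ n) (hε : ε = 1 ∨ ε = -1)
    (hS : IsProperlyEmbeddedHypersurface ε S)
    (hrot : IsRotational S) (hN : IsUnitNormalField ε S N) {p : Ambient n} (hp : p ∈ S)
    (hp0 : p.1.2 ≠ 0) : ∃ a : ℝ, (N p).1.2 = a • p.1.2 := by
  set x := p.1.2
  set a := inner ℝ x (N p).1.2 / inner ℝ x x
  have hxx : inner ℝ x x ≠ 0 := inner_self_ne_zero.2 hp0
  set y := (N p).1.2 - a • x with hy
  have hxy : inner ℝ x y = 0 := by
    rw [hy, inner_sub_right, inner_smul_right, div_mul_cancel₀ _ hxx, sub_self]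
  refine ⟨a, ?_⟩
  by_contra hne
  have hy0 : y ≠ 0 := sub_ne_zero.2 hne
  -- a vector `z` orthogonal to `x` and `y`, of the same length as `y`
  obtain ⟨z, hzn, hzx, hzy⟩ : ∃ z : Euc n, ‖z‖ = ‖y‖ ∧ inner ℝ x z = 0 ∧ inner ℝ y z = 0 := by
    have hdim : Module.finrank ℝ (Submodule.span ℝ {x, y}) < Module.finrank ℝ (Euc n) := by
      have h1 := finrank_span_finset_le_card (R := ℝ) ({x, y} : Finset (Euc n))
      rw [Finset.coe_pair, Set.finrank] at h1
      have h2 := h1.trans Finset.card_le_two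
      simp only [finrank_euclideanSpace, Fintype.card_fin]
      omega
    have hne : (Submodule.span ℝ {x, y})ᗮ ≠ ⊥ := by
      rw [ne_eq, Submodule.orthogonal_eq_bot_iff]
      intro h
      rw [h, finrank_top] at hdim
      exact lt_irrefl _ hdim
    obtain ⟨z, hz, hz0⟩ := Submodule.exists_mem_ne_zero_of_ne_bot hne
    have hzn : ‖z‖ ≠ 0 := norm_ne_zero_iff.2 hz0
    refine ⟨(‖y‖ / ‖z‖) • z, ?_, ?_, ?_⟩
    · rw [norm_smul, norm_div, norm_norm, norm_norm, div_mul_cancel₀ _ hzn]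
    · rw [inner_smul_right, (Submodule.mem_orthogonal _ z).1 hz x
        (Submodule.subset_span (by simp)), mul_zero]
    · rw [inner_smul_right, (Submodule.mem_orthogonal _ z).1 hz y
        (Submodule.subset_span (by simp)), mul_zero]
  -- the reflection which exchanges `y` and `z` fixes `x`
  let A := (ℝ ∙ (y - z))ᗮ.reflection
  have hAy : A y = z := Submodule.reflection_sub hzn.symm
  have hAx : A x = x := by
    refine Submodule.reflection_mem_subspace_eq_self ?_
    rw [Submodule.mem_orthogonal_singleton_iff_inner_right, inner_sub_left, real_inner_comm, hxy,
      real_inner_comm, hzx, sub_self]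
  obtain ⟨δ, hδ⟩ := exists_normal_eq_smul_rotate hε hS hrot hN hp (A := A)
    (by rw [rotate_apply]; change ((p.1.1, A x), p.2) = p; rw [hAx])
  have h1 : (N p).1.2 = δ • A (N p).1.2 := congrArg (fun q => q.1.2) hδ
  have h2 : (N p).1.2 = y + a • x := by rw [hy]; abel
  rw [h2, map_add, map_smul, hAx, hAy] at h1
  have h3 := congrArg (fun q => inner ℝ y q) h1
  simp only [inner_add_right, inner_smul_right, hzy, real_inner_comm x y, hxy, mul_zero,
    add_zero] at h3
  exact hy0 (inner_self_eq_zero.1 h3)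

end Rotational

/-! ### Second fundamental form of a strictly convex rotational hypersurface -/

section TangentPart
variable {n : ℕ} {ε : ℝ} {S : Set (Ambient n)} {N : Ambient n → Ambient n} {U : Set (Euc n)}
  {X : Euc n → Ambient n}

/-- The coordinates of the component of an ambient vector tangent to `S`. -/
def tangentPart (ε : ℝ) (X : Euc n → Ambient n) (u : Euc n) (w : Ambient n) : Euc n :=
  WithLp.toLp 2 fun i => ∑ j, (inducedMetric ε X u)⁻¹ i j * form ε (pderiv j X u) w

namespace IsLocalParam

theorem tangentPart_fderiv (hε : ε = 1 ∨ ε = -1) (hS : S ⊆ productSpace n ε)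
    (hX : IsLocalParam S U X) {u : Euc n} (hu : u ∈ U) (a : Euc n) :
    tangentPart ε X u (fderiv ℝ X u a) = a := by
  ext i
  simp only [tangentPart, pderiv_eq, ← sum_inducedMetric_mul, Finset.mul_sum]
  rw [Finset.sum_comm]
  simp only [← mul_assoc, ← Finset.sum_mul, hX.sum_inducedMetric_inv_mul hε hS hu]
  simp

/-- Decomposition of an ambient vector into its components tangent to `S`, normal to `S`, and normal
to `Q_ε^n × ℝ`. -/
theorem eq_tangentPart_add (hε : ε = 1 ∨ ε = -1) (hS : S ⊆ productSpace n ε)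
    (hX : IsLocalParam S U X) (hN : IsUnitNormalField ε S N) {u : Euc n} (hu : u ∈ U)
    (w : Ambient n) :
    fderiv ℝ X u (tangentPart ε X u w) =
      w - form ε w (N (X u)) • N (X u) - (ε * form ε w (posVec (X u))) • posVec (X u) := by
  have hp := hX.mapsTo hu
  obtain ⟨a, ha⟩ := exists_decomposition hε (fderiv ℝ X u) (hX.immersion u hu)
    (hN.unit _ hp) (form_posVec_self (hS hp)) (by rw [form_posVec]; exact hN.tangent _ hp)
    (fun v => by rw [form_comm]; exact hN.normal U X hX u hu v)
    (fun v => hX.form_fderiv_posVec hS hu v) w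
  have h : tangentPart ε X u w = a := by
    rw [← hX.tangentPart_fderiv hε hS hu a]
    ext i
    simp only [tangentPart]
    refine Finset.sum_congr rfl fun j _ => ?_
    conv_lhs => rw [ha]
    rw [form_add_right, form_add_right, form_smul_right, form_smul_right, pderiv_eq,
      hX.form_fderiv_posVec hS hu,
      form_comm ε (fderiv ℝ X u (EuclideanSpace.single j 1)) (N (X u)), hN.normal U X hX u hu]
    ring
  rw [h, eq_sub_iff_add_eq, eq_sub_iff_add_eq, add_right_comm]
  exact ha.symm

theorem differentiableAt_tangentPart (hε : ε = 1 ∨ ε = -1) (hS : S ⊆ productSpace n ε)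
    (hX : IsLocalParam S U X) {u : Euc n} (hu : u ∈ U) {Y : Euc n → Ambient n}
    (hY : DifferentiableAt ℝ Y u) :
    DifferentiableAt ℝ (fun y => tangentPart ε X y (Y y)) u := by
  rw [differentiableAt_euclidean]
  intro i
  simp only [tangentPart]
  refine DifferentiableAt.fun_sum fun j _ => ?_
  exact (hX.differentiableAt_inducedMetric_inv hε hS hu i j).mul
    (differentiableAt_form ((hX.contDiffAt_pderiv hu j).differentiableAt (by simp)) hY)

theorem fderiv_fderiv_tangent (hX : IsLocalParam S U X) {u : Euc n} (hu : u ∈ U)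
    {V : Euc n → Euc n} (hV : DifferentiableAt ℝ V u) (w : Euc n) :
    fderiv ℝ (fun y => fderiv ℝ X y (V y)) u w =
      fderiv ℝ (fderiv ℝ X) u w (V u) + fderiv ℝ X u (fderiv ℝ V u w) := by
  rw [((hX.differentiableAt_fderiv hu).hasFDerivAt.clm_apply hV.hasFDerivAt).fderiv]
  simp [add_comm]

theorem isPrincipalCurvature_of_forall (hX : IsLocalParam S U X) {u : Euc n} (hu : u ∈ U)
    {v : Euc n} (hv : v ≠ 0) {k : ℝ}
    (h : ∀ w, form ε (fderiv ℝ (fderiv ℝ X) u w v) (N (X u)) =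
      k * form ε (fderiv ℝ X u w) (fderiv ℝ X u v)) : IsPrincipalCurvature ε N X u k := by
  refine ⟨fun i => v i, fun h0 => hv (by ext i; exact congrFun h0 i), ?_⟩
  ext i
  have h1 := sum_inducedMetric_mul (ε := ε) (X := X) u v i
  have h2 : ∑ j, secondForm ε N X u i j * v j =
      form ε (fderiv ℝ (fderiv ℝ X) u (EuclideanSpace.single i 1) v) (N (X u)) := by
    rw [apply_eq_sum _ v, form_sum_smul_left]
    refine Finset.sum_congr rfl fun j _ => ?_
    rw [mul_comm, secondForm, Matrix.of_apply, hX.pderiv_pderiv hu]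
  simp only [Matrix.mulVec, dotProduct, Pi.smul_apply, smul_eq_mul]
  rw [h1, h2, h]

end IsLocalParam

end TangentPart

/-- A strictly convex rotational hypersurface, with the unit normal field `N` for which the principal
curvatures are positive. -/
structure IsConvexRotational {n : ℕ} (ε : ℝ) (S : Set (Ambient n)) (N : Ambient n → Ambient n) :
    Prop where
  three_le : 3 ≤ n
  eps : ε = 1 ∨ ε = -1
  embedded : IsProperlyEmbeddedHypersurface ε S
  rotational : IsRotational S
  normalField : IsUnitNormalField ε S N
  convex : ∀ U X, IsLocalParam S U X → ∀ u ∈ U, ∀ k : ℝ, IsPrincipalCurvature ε N X u k → 0 < k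

/-- The principal curvature of a rotational hypersurface in the directions of the parallels. -/
def parallelCurvature {n : ℕ} (N : Ambient n → Ambient n) (p : Ambient n) : ℝ :=
  -(inner ℝ p.1.2 (N p).1.2 / inner ℝ p.1.2 p.1.2)

namespace IsConvexRotational
variable {n : ℕ} {ε : ℝ} {S : Set (Ambient n)} {N : Ambient n → Ambient n} {U : Set (Euc n)}
  {X : Euc n → Ambient n}

theorem normal_eq (h : IsConvexRotational ε S N) {p : Ambient n} (hp : p ∈ S)
    (hp0 : p.1.2 ≠ 0) : (N p).1.2 = (-parallelCurvature N p) • p.1.2 := by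
  obtain ⟨a, ha⟩ := exists_normal_eq_smul h.three_le h.eps h.embedded h.rotational h.normalField
    hp hp0
  have hxx : inner ℝ p.1.2 p.1.2 ≠ 0 := inner_self_ne_zero.2 hp0
  rw [parallelCurvature, ha, inner_smul_right, mul_div_cancel_right₀ _ hxx, neg_neg]

/-- Tangent vectors to the parallels are principal directions, at points off the axis. The proof
differentiates the tangent fields that are induced by infinitesimal rotations. -/
theorem form_fderiv_fderiv_of_parallel (h : IsConvexRotational ε S N) (hX : IsLocalParam S U X)
    {u : Euc n} (hu : u ∈ U) (hu0 : (X u).1.2 ≠ 0) {v : Euc n} {y : Euc n}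
    (hy : inner ℝ (X u).1.2 y = 0) (hv : fderiv ℝ X u v = ((0, y), 0)) (w : Euc n) :
    form ε (fderiv ℝ (fderiv ℝ X) u w v) (N (X u)) =
      parallelCurvature N (X u) * form ε (fderiv ℝ X u w) (fderiv ℝ X u v) := by
  set x := (X u).1.2 with hx
  have hxx : inner ℝ x x ≠ 0 := inner_self_ne_zero.2 hu0
  -- the skew-symmetric map which sends `x` to `y`
  let B : Euc n →L[ℝ] Euc n := (inner ℝ x x)⁻¹ •
    ((innerSL ℝ x).smulRight y - (innerSL ℝ y).smulRight x)
  have hB : ∀ z, B z = (inner ℝ x x)⁻¹ • (inner ℝ x z • y - inner ℝ y z • x) := fun z => by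
    simp [B]
  have hBskew : ∀ z, inner ℝ (B z) z = 0 := fun z => by
    rw [hB, inner_smul_left, inner_sub_left, inner_smul_left, inner_smul_left]
    simp only [RCLike.conj_to_real]; ring
  have hyx : inner ℝ y x = 0 := by rw [real_inner_comm]; exact hy
  have hBx : B x = y := by rw [hB, hyx, zero_smul, sub_zero, inv_smul_smul₀ hxx]
  let R : Ambient n →L[ℝ] Ambient n :=
    ((0 : Ambient n →L[ℝ] ℝ).prod (B.comp ((ContinuousLinearMap.snd ℝ ℝ (Euc n)).comp
      (ContinuousLinearMap.fst ℝ (ℝ × Euc n) ℝ)))).prod 0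
  have hR : ∀ p, R p = ((0, B p.1.2), 0) := fun p => rfl
  have hRd : DifferentiableAt ℝ (fun y => R (X y)) u :=
    R.differentiableAt.comp u (hX.differentiableAt hu)
  have hRf : fderiv ℝ (fun y => R (X y)) u w = R (fderiv ℝ X u w) := by
    have : fderiv ℝ (fun y => R (X y)) u = _ :=
      (R.hasFDerivAt.comp u (hX.differentiableAt hu).hasFDerivAt).fderiv
    rw [this]; rfl
  have hV := hX.differentiableAt_tangentPart h.eps h.embedded.subset hu hRd
  set V : Euc n → Euc n := fun y => tangentPart ε X y (R (X y)) with hVdef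
  have hDV : ∀ y ∈ U, fderiv ℝ X y (V y) = R (X y) := by
    intro y hyU
    rw [hVdef, hX.eq_tangentPart_add h.eps h.embedded.subset h.normalField hyU]
    have h1 : form ε (R (X y)) (N (X y)) = 0 := by
      by_cases h0 : (X y).1.2 = 0
      · simp [hR, form, baseForm, h0]
      · simp [hR, form, baseForm, h.normal_eq (hX.mapsTo hyU) h0, inner_smul_right, hBskew]
    have h2 : form ε (R (X y)) (posVec (X y)) = 0 := by
      simp [hR, form_posVec, baseForm, hBskew]
    rw [h1, h2]; simp
  have hVu : V u = v := by
    apply hX.immersion u hu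
    rw [hDV u hu, hv, hR]
    change ((0, B x), (0 : ℝ)) = _
    rw [hBx]
  have hev : (fun y => fderiv ℝ X y (V y)) =ᶠ[nhds u] fun y => R (X y) := by
    filter_upwards [hX.isOpen.mem_nhds hu] with y hy using hDV y hy
  have h3 := hX.fderiv_fderiv_tangent hu hV w
  rw [hev.fderiv_eq, hRf, hVu] at h3
  have h4 : fderiv ℝ (fderiv ℝ X) u w v = R (fderiv ℝ X u w) - fderiv ℝ X u (fderiv ℝ V u w) := by
    rw [h3]; abel
  rw [h4, form_sub_left, form_comm ε (fderiv ℝ X u (fderiv ℝ V u w)),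
    h.normalField.normal U X hX u hu, hv, hR]
  simp only [form, baseForm, h.normal_eq (hX.mapsTo hu) hu0, inner_smul_right]
  rw [← hx, hB, inner_smul_left, inner_sub_left, inner_smul_left, inner_smul_left, hyx]
  simp only [RCLike.conj_to_real, real_inner_comm y]
  field_simp
  ring

theorem eps_mul_self (h : IsConvexRotational ε S N) : ε * ε = 1 := by
  rcases h.eps with rfl | rfl <;> norm_num

theorem inner_self_eq (h : IsConvexRotational ε S N) {p : Ambient n} (hp : p ∈ S) :
    inner ℝ p.1.2 p.1.2 = ε - ε * p.1.1 ^ 2 := by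
  have := (h.embedded.subset hp).1
  simp only [baseForm] at this
  linarith

theorem sq_fst_eq (h : IsConvexRotational ε S N) {p : Ambient n} (hp : p ∈ S) :
    p.1.1 ^ 2 = 1 - ε * inner ℝ p.1.2 p.1.2 := by
  rw [h.inner_self_eq hp]
  linear_combination (1 - p.1.1 ^ 2) * h.eps_mul_self

/-- The condition that `N = ((N₀, -κ x), N_t)` is tangent to `Q_ε^n × ℝ`, namely `ε N₀ x₀ = κ |x|²`. -/
theorem eps_mul_normal_mul (h : IsConvexRotational ε S N) {p : Ambient n} (hp : p ∈ S)
    (hp0 : p.1.2 ≠ 0) :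
    ε * (N p).1.1 * p.1.1 = parallelCurvature N p * inner ℝ p.1.2 p.1.2 := by
  have := h.normalField.tangent p hp
  simp only [baseForm, h.normal_eq hp hp0, inner_smul_left, RCLike.conj_to_real] at this
  linarith

/-- Off the axis, `|∇t|² x₀² = κ² |x|²`. -/
theorem one_sub_sq_mul (h : IsConvexRotational ε S N) {p : Ambient n} (hp : p ∈ S)
    (hp0 : p.1.2 ≠ 0) : (1 - (N p).2 ^ 2) * p.1.1 ^ 2 =
      parallelCurvature N p ^ 2 * inner ℝ p.1.2 p.1.2 := by
  have h1 := h.normalField.unit p hp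
  simp only [form, baseForm, h.normal_eq hp hp0, inner_smul_left, inner_smul_right,
    RCLike.conj_to_real] at h1
  have h2 := h.eps_mul_normal_mul hp hp0
  have h3 := h.inner_self_eq hp
  have h4 := h.eps_mul_self
  set κ := parallelCurvature N p
  set ρ := inner ℝ p.1.2 p.1.2
  have h5 : (N p).1.1 * p.1.1 = ε * κ * ρ := by linear_combination ε * h2 - (N p).1.1 * p.1.1 * h4
  have h6 : p.1.1 ^ 2 = 1 - ε * ρ := h.sq_fst_eq hp
  linear_combination (-p.1.1 ^ 2) * h1 + ε * ((N p).1.1 * p.1.1 + ε * κ * ρ) * h5 +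
    κ ^ 2 * ρ * h6 + ε * κ ^ 2 * ρ ^ 2 * h4

theorem parallelCurvature_pos (h : IsConvexRotational ε S N) {p : Ambient n} (hp : p ∈ S)
    (hp0 : p.1.2 ≠ 0) : 0 < parallelCurvature N p := by
  obtain ⟨U, X, hX, u, hu, rfl⟩ := h.embedded.locally_param p hp
  obtain ⟨y, hy, hy0⟩ : ∃ y : Euc n, inner ℝ (X u).1.2 y = 0 ∧ y ≠ 0 := by
    have hne : (ℝ ∙ (X u).1.2)ᗮ ≠ ⊥ := by
      rw [ne_eq, Submodule.orthogonal_eq_bot_iff]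
      intro h'
      have h1 := finrank_span_singleton (K := ℝ) hp0
      rw [h', finrank_top, finrank_euclideanSpace, Fintype.card_fin] at h1
      have := h.three_le
      omega
    obtain ⟨y, hy, hy0⟩ := Submodule.exists_mem_ne_zero_of_ne_bot hne
    exact ⟨y, Submodule.mem_orthogonal_singleton_iff_inner_right.1 hy, hy0⟩
  have hyx : inner ℝ y (X u).1.2 = 0 := by rw [real_inner_comm]; exact hy
  have hD : fderiv ℝ X u (tangentPart ε X u ((0, y), 0)) = ((0, y), 0) := by
    rw [hX.eq_tangentPart_add h.eps h.embedded.subset h.normalField hu]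
    have h1 : form ε (((0, y), 0) : Ambient n) (N (X u)) = 0 := by
      simp [form, baseForm, h.normal_eq hp hp0, inner_smul_right, hyx]
    have h2 : form ε (((0, y), 0) : Ambient n) (posVec (X u)) = 0 := by
      simp [form_posVec, baseForm, hyx]
    rw [h1, h2]; simp
  have hv0 : tangentPart ε X u ((0, y), 0) ≠ 0 := by
    intro h0
    rw [h0, map_zero] at hD
    exact hy0 (congrArg (fun q => q.1.2) hD).symm
  exact h.convex U X hX u hu _ (hX.isPrincipalCurvature_of_forall hu hv0
    (h.form_fderiv_fderiv_of_parallel hX hu hp0 hy hD))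

theorem inner_self_pos {p : Ambient n} (hp0 : p.1.2 ≠ 0) : 0 < inner ℝ p.1.2 p.1.2 :=
  real_inner_self_pos.2 hp0

theorem fst_ne_zero (h : IsConvexRotational ε S N) {p : Ambient n} (hp : p ∈ S)
    (hp0 : p.1.2 ≠ 0) : p.1.1 ≠ 0 := by
  intro h0
  have h1 := h.eps_mul_normal_mul hp hp0
  have := mul_pos (h.parallelCurvature_pos hp hp0) (inner_self_pos hp0)
  rw [h0] at h1
  linarith

theorem one_sub_sq_pos (h : IsConvexRotational ε S N) {p : Ambient n} (hp : p ∈ S)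
    (hp0 : p.1.2 ≠ 0) : 0 < 1 - (N p).2 ^ 2 := by
  have h1 := h.one_sub_sq_mul hp hp0
  have h2 := h.parallelCurvature_pos hp hp0
  have h3 := inner_self_pos hp0
  have h4 : 0 < p.1.1 ^ 2 := by have := h.fst_ne_zero hp hp0; positivity
  have h5 : 0 < (1 - (N p).2 ^ 2) * p.1.1 ^ 2 := by rw [h1]; positivity
  exact pos_of_mul_pos_left h5 h4.le

/-- The coordinates of the gradient of the height function on `S`. -/
def heightGrad (ε : ℝ) (X : Euc n → Ambient n) (u : Euc n) : Euc n :=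
  tangentPart ε X u ((0, 0), 1)

theorem fderiv_heightGrad (h : IsConvexRotational ε S N) (hX : IsLocalParam S U X) {u : Euc n}
    (hu : u ∈ U) :
    fderiv ℝ X u (heightGrad ε X u) = ((0, 0), 1) - (N (X u)).2 • N (X u) := by
  rw [heightGrad, hX.eq_tangentPart_add h.eps h.embedded.subset h.normalField hu]
  have h1 : form ε (((0, 0), 1) : Ambient n) (N (X u)) = (N (X u)).2 := by simp [form, baseForm]
  have h2 : form ε (((0, 0), 1) : Ambient n) (posVec (X u)) = 0 := by simp [form_posVec, baseForm]
  rw [h1, h2]; simp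

theorem form_fderiv_heightGrad (h : IsConvexRotational ε S N) (hX : IsLocalParam S U X) {u : Euc n}
    (hu : u ∈ U) (v : Euc n) :
    form ε (fderiv ℝ X u v) (fderiv ℝ X u (heightGrad ε X u)) = (fderiv ℝ X u v).2 := by
  rw [h.fderiv_heightGrad hX hu, form_sub_right, form_smul_right, form_comm ε _ (N (X u)),
    h.normalField.normal U X hX u hu]
  simp [form, baseForm]

theorem fderiv_heightGrad_snd (h : IsConvexRotational ε S N) (hX : IsLocalParam S U X) {u : Euc n}
    (hu : u ∈ U) : (fderiv ℝ X u (heightGrad ε X u)).2 = 1 - (N (X u)).2 ^ 2 := by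
  rw [h.fderiv_heightGrad hX hu]; simp; ring

/-- `κ ⟨x, dx⟩ = N_t x₀² dt` on tangent vectors, off the axis. -/
theorem parallelCurvature_mul_inner (h : IsConvexRotational ε S N) (hX : IsLocalParam S U X)
    {u : Euc n} (hu : u ∈ U) (hu0 : (X u).1.2 ≠ 0) (v : Euc n) :
    parallelCurvature N (X u) * inner ℝ (X u).1.2 (fderiv ℝ X u v).1.2 =
      (N (X u)).2 * (X u).1.1 ^ 2 * (fderiv ℝ X u v).2 := by
  have hp := hX.mapsTo hu
  have h1 := h.normalField.normal U X hX u hu v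
  have h2 := hX.form_fderiv_posVec h.embedded.subset hu v
  have h3 := h.eps_mul_normal_mul hp hu0
  have h4 := h.inner_self_eq hp
  have h5 := h.eps_mul_self
  rw [form_posVec, baseForm, real_inner_comm] at h2
  simp only [form, baseForm, h.normal_eq hp hu0, inner_smul_left, RCLike.conj_to_real] at h1
  set x0 := (X u).1.1
  set κ := parallelCurvature N (X u)
  set ρ := inner ℝ (X u).1.2 (X u).1.2
  set i := inner ℝ (X u).1.2 (fderiv ℝ X u v).1.2
  have h6 : x0 ^ 2 = 1 - ε * ρ := h.sq_fst_eq hp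
  have h7 : (N (X u)).1.1 * x0 = ε * κ * ρ := by
    linear_combination ε * h3 - (N (X u)).1.1 * x0 * h5
  linear_combination (-x0 ^ 2) * h1 + ((N (X u)).1.1 * x0) * h2 - i * h7 - i * κ * h6

/-- The second fundamental form off the axis: the gradient of the height is a principal direction,
with a positive principal curvature `k`, and `h = κ g + m dt²`. -/
theorem exists_secondForm_eq (h : IsConvexRotational ε S N) (hX : IsLocalParam S U X)
    {u : Euc n} (hu : u ∈ U) (hu0 : (X u).1.2 ≠ 0) :
    ∃ k : ℝ, 0 < k ∧ ∀ v w, form ε (fderiv ℝ (fderiv ℝ X) u v w) (N (X u)) =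
      parallelCurvature N (X u) * form ε (fderiv ℝ X u v) (fderiv ℝ X u w) +
      (k - parallelCurvature N (X u)) / (1 - (N (X u)).2 ^ 2) *
        ((fderiv ℝ X u v).2 * (fderiv ℝ X u w).2) := by
  have hp := hX.mapsTo hu
  have hT := h.one_sub_sq_pos hp hu0
  have hκ := h.parallelCurvature_pos hp hu0
  set T := 1 - (N (X u)).2 ^ 2 with hTdef
  set κ := parallelCurvature N (X u) with hκdef
  set z := heightGrad ε X u with hz
  have hzT : (fderiv ℝ X u z).2 = T := h.fderiv_heightGrad_snd hX hu
  have hz0 : z ≠ 0 := by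
    intro h0
    rw [h0, map_zero] at hzT
    exact hT.ne hzT
  -- tangent vectors with `dt = 0` are tangent to the parallels
  have key : ∀ v, (fderiv ℝ X u v).2 = 0 → ∀ w,
      form ε (fderiv ℝ (fderiv ℝ X) u w v) (N (X u)) =
        κ * form ε (fderiv ℝ X u w) (fderiv ℝ X u v) := by
    intro v hv w
    have h1 := h.parallelCurvature_mul_inner hX hu hu0 v
    rw [hv, mul_zero] at h1
    have h2 : inner ℝ (X u).1.2 (fderiv ℝ X u v).1.2 = 0 := (mul_eq_zero.1 h1).resolve_left hκ.ne'
    have h3 := hX.form_fderiv_posVec h.embedded.subset hu v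
    rw [form_posVec, baseForm, real_inner_comm, h2, add_zero] at h3
    have hε0 : ε ≠ 0 := by rcases h.eps with rfl | rfl <;> norm_num
    have h4 : (fderiv ℝ X u v).1.1 = 0 := by
      simpa [hε0, h.fst_ne_zero hp hu0] using h3
    exact h.form_fderiv_fderiv_of_parallel hX hu hu0 h2
      (Prod.ext (Prod.ext h4 rfl) hv) w
  set H := form ε (fderiv ℝ (fderiv ℝ X) u z z) (N (X u)) with hH
  have hsplit : ∀ v w, form ε (fderiv ℝ (fderiv ℝ X) u w v) (N (X u)) =
      κ * (form ε (fderiv ℝ X u w) (fderiv ℝ X u v) -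
        (fderiv ℝ X u v).2 / T * (fderiv ℝ X u w).2) +
        (fderiv ℝ X u v).2 / T * form ε (fderiv ℝ (fderiv ℝ X) u w z) (N (X u)) := by
    intro v w
    set s := (fderiv ℝ X u v).2 / T with hs
    have h1 := key (v - s • z) (by
      rw [map_sub, map_smul, Prod.snd_sub, Prod.smul_snd, hzT, smul_eq_mul, hs,
        div_mul_cancel₀ _ hT.ne', sub_self]) w
    rw [map_sub, map_smul, map_sub, map_smul, form_sub_left, form_smul_left, form_sub_right,
      form_smul_right, h.form_fderiv_heightGrad hX hu] at h1
    linarith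
  have hz2 : ∀ w, form ε (fderiv ℝ (fderiv ℝ X) u w z) (N (X u)) =
      (fderiv ℝ X u w).2 / T * H := by
    intro w
    rw [hX.fderiv_fderiv_comm hu, hsplit w z, form_comm, h.form_fderiv_heightGrad hX hu, hzT, ← hH]
    field_simp
    ring
  have hk : 0 < H / T := by
    refine h.convex U X hX u hu _ (hX.isPrincipalCurvature_of_forall hu hz0 fun w => ?_)
    rw [hz2, h.form_fderiv_heightGrad hX hu]
    ring
  refine ⟨H / T, hk, fun v w => ?_⟩
  rw [hsplit w v, hz2]
  field_simp
  ring

end IsConvexRotational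

/-! ### The first integral of the constant scalar curvature equation -/

namespace IsConvexRotational
variable {n : ℕ} {ε K : ℝ} {S : Set (Ambient n)} {N : Ambient n → Ambient n} {U : Set (Euc n)}
  {X : Euc n → Ambient n}

theorem sum_inv_mul_height (h : IsConvexRotational ε S N) (hX : IsLocalParam S U X) {u : Euc n}
    (hu : u ∈ U) :
    ∑ j, ∑ k, (inducedMetric ε X u)⁻¹ j k * (pderiv j X u).2 * (pderiv k X u).2 =
      1 - (N (X u)).2 ^ 2 := by
  rw [← h.fderiv_heightGrad_snd hX hu, apply_eq_sum, Prod.snd_sum]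
  refine Finset.sum_congr rfl fun j _ => ?_
  rw [Prod.smul_snd, smul_eq_mul, heightGrad, tangentPart, Finset.sum_mul]
  refine Finset.sum_congr rfl fun k _ => ?_
  rw [pderiv_eq, pderiv_eq]
  simp only [form, baseForm]
  simp
  ring

/-- The constant scalar curvature equation for a hypersurface with principal curvatures `k` (once)
and `κ` (`n - 1` times). -/
theorem scalar_equation (h : IsConvexRotational ε S N) (hX : IsLocalParam S U X) {u : Euc n}
    (hu : u ∈ U) (hu0 : (X u).1.2 ≠ 0)
    (hK : scalarCurvature (inducedMetric ε X) u = n * (n - 1) * K) {k : ℝ}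
    (hk : ∀ v w, form ε (fderiv ℝ (fderiv ℝ X) u v w) (N (X u)) =
      parallelCurvature N (X u) * form ε (fderiv ℝ X u v) (fderiv ℝ X u w) +
      (k - parallelCurvature N (X u)) / (1 - (N (X u)).2 ^ 2) *
        ((fderiv ℝ X u v).2 * (fderiv ℝ X u w).2)) :
    n * (parallelCurvature N (X u) ^ 2 + ε - K) + 2 * (parallelCurvature N (X u) *
      (k - parallelCurvature N (X u)) - ε * (1 - (N (X u)).2 ^ 2)) = 0 := by
  have hT := (h.one_sub_sq_pos (hX.mapsTo hu) hu0).ne'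
  rw [hX.scalarCurvature_eq h.eps h.embedded.subset h.normalField hu
    (κ := parallelCurvature N (X u))
    (m := (k - parallelCurvature N (X u)) / (1 - (N (X u)).2 ^ 2)) (fun i j => by
      rw [secondForm, Matrix.of_apply, hX.pderiv_pderiv hu, hk]; rfl),
    h.sum_inv_mul_height hX hu] at hK
  have hn : (n : ℝ) - 1 ≠ 0 := by
    have : (3 : ℝ) ≤ n := by exact_mod_cast h.three_le
    linarith
  field_simp at hK
  linear_combination hK

/-- The derivative of `|∇t|²`. -/
theorem hasFDerivAt_one_sub_sq (h : IsConvexRotational ε S N) (hX : IsLocalParam S U X) {u : Euc n}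
    (hu : u ∈ U) (hu0 : (X u).1.2 ≠ 0) {k : ℝ}
    (hk : ∀ v w, form ε (fderiv ℝ (fderiv ℝ X) u v w) (N (X u)) =
      parallelCurvature N (X u) * form ε (fderiv ℝ X u v) (fderiv ℝ X u w) +
      (k - parallelCurvature N (X u)) / (1 - (N (X u)).2 ^ 2) *
        ((fderiv ℝ X u v).2 * (fderiv ℝ X u w).2)) :
    ∃ L : Euc n →L[ℝ] ℝ, HasFDerivAt (fun y => 1 - (N (X y)).2 ^ 2) L u ∧
      ∀ v, L v = 2 * (N (X u)).2 * k * (fderiv ℝ X u v).2 := by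
  have hT := (h.one_sub_sq_pos (hX.mapsTo hu) hu0).ne'
  have hz : DifferentiableAt ℝ (heightGrad ε X) u :=
    hX.differentiableAt_tangentPart h.eps h.embedded.subset hu (differentiableAt_const _)
  have hY : DifferentiableAt ℝ (fun y => fderiv ℝ X y (heightGrad ε X y)) u :=
    (hX.differentiableAt_fderiv hu).clm_apply hz
  have hev1 : (fun y => 1 - (N (X y)).2 ^ 2) =ᶠ[nhds u]
      fun y => (fderiv ℝ X y (heightGrad ε X y)).2 := by
    filter_upwards [hX.isOpen.mem_nhds hu] with y hy using (h.fderiv_heightGrad_snd hX hy).symm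
  have hev2 : (fun y => 1 - (N (X y)).2 ^ 2) =ᶠ[nhds u]
      fun y => form ε (fderiv ℝ X y (heightGrad ε X y)) (fderiv ℝ X y (heightGrad ε X y)) := by
    filter_upwards [hX.isOpen.mem_nhds hu] with y hy
    rw [h.form_fderiv_heightGrad hX hy, h.fderiv_heightGrad_snd hX hy]
  have h1 := hY.hasFDerivAt.snd.congr_of_eventuallyEq hev1
  refine ⟨_, h1, fun v => ?_⟩
  -- two expressions for the derivative: of `dt(∇t)` and of `⟨∇t, ∇t⟩`
  have e1 : fderiv ℝ (fun y => 1 - (N (X y)).2 ^ 2) u v =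
      (fderiv ℝ (fderiv ℝ X) u v (heightGrad ε X u)).2 +
        (fderiv ℝ X u (fderiv ℝ (heightGrad ε X) u v)).2 := by
    rw [h1.fderiv, ← Prod.snd_add, ← hX.fderiv_fderiv_tangent hu hz]; rfl
  have e2 : fderiv ℝ (fun y => 1 - (N (X y)).2 ^ 2) u v =
      2 * (form ε (fderiv ℝ (fderiv ℝ X) u v (heightGrad ε X u))
        (fderiv ℝ X u (heightGrad ε X u)) +
        (fderiv ℝ X u (fderiv ℝ (heightGrad ε X) u v)).2) := by
    rw [hev2.fderiv_eq, fderiv_form hY hY, form_comm ε (fderiv ℝ X u (heightGrad ε X u)),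
      hX.fderiv_fderiv_tangent hu hz, form_add_left, h.form_fderiv_heightGrad hX hu]
    ring
  have e3 := hk v (heightGrad ε X u)
  rw [h.form_fderiv_heightGrad hX hu, h.fderiv_heightGrad_snd hX hu] at e3
  have e4 : form ε (fderiv ℝ (fderiv ℝ X) u v (heightGrad ε X u))
      (fderiv ℝ X u (heightGrad ε X u)) =
      (fderiv ℝ (fderiv ℝ X) u v (heightGrad ε X u)).2 - (N (X u)).2 *
        form ε (fderiv ℝ (fderiv ℝ X) u v (heightGrad ε X u)) (N (X u)) := by
    rw [h.fderiv_heightGrad hX hu, form_sub_right, form_smul_right]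
    congr 1
    simp [form, baseForm]
  have e5 : form ε (fderiv ℝ (fderiv ℝ X) u v (heightGrad ε X u)) (N (X u)) =
      k * (fderiv ℝ X u v).2 := by
    rw [e3]; field_simp; ring
  rw [← h1.fderiv]
  rw [e5] at e4
  linear_combination 2 * e1 - e2 - 2 * e4

/-- The square of `(κ² + ε - K) |x|ⁿ`, where `κ² + ε` is the sectional curvature along the
parallels: a first integral of the equation of constant scalar curvature `n (n - 1) K`. It is written
without a denominator, as `κ² |x|² = |∇t|² x₀²` and `x₀² = 1 - ε |x|²`. -/
def firstIntegral (ε K : ℝ) (N : Ambient n → Ambient n) (p : Ambient n) : ℝ :=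
  ((1 - (N p).2 ^ 2) * (1 - ε * inner ℝ p.1.2 p.1.2) + (ε - K) * inner ℝ p.1.2 p.1.2) ^ 2 *
    inner ℝ p.1.2 p.1.2 ^ (n - 2)

theorem hasFDerivAt_inner_self (hX : IsLocalParam S U X) {u : Euc n} (hu : u ∈ U) :
    ∃ L : Euc n →L[ℝ] ℝ, HasFDerivAt (fun y => (inner ℝ (X y).1.2 (X y).1.2 : ℝ)) L u ∧
      ∀ v, L v = 2 * inner ℝ (X u).1.2 (fderiv ℝ X u v).1.2 := by
  have h1 := (hX.differentiableAt hu).hasFDerivAt.fst.snd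
  refine ⟨_, h1.inner ℝ h1, fun v => ?_⟩
  simp only [ContinuousLinearMap.comp_apply, ContinuousLinearMap.prod_apply, fderivInnerCLM_apply]
  rw [real_inner_comm (X u).1.2]
  change inner ℝ (X u).1.2 (fderiv ℝ X u v).1.2 + inner ℝ (X u).1.2 (fderiv ℝ X u v).1.2 = _
  ring

theorem hasFDerivAt_firstIntegral (h : IsConvexRotational ε S N) (hX : IsLocalParam S U X)
    {u : Euc n} (hu : u ∈ U) (hu0 : (X u).1.2 ≠ 0)
    (hK : scalarCurvature (inducedMetric ε X) u = n * (n - 1) * K) :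
    HasFDerivAt (fun y => firstIntegral ε K N (X y)) (0 : Euc n →L[ℝ] ℝ) u := by
  obtain ⟨k, -, hk⟩ := h.exists_secondForm_eq hX hu hu0
  obtain ⟨L, hL, hLv⟩ := h.hasFDerivAt_one_sub_sq hX hu hu0 hk
  obtain ⟨R, hR, hRv⟩ := hasFDerivAt_inner_self hX hu
  have hs := h.scalar_equation hX hu hu0 hK hk
  have hp := hX.mapsTo hu
  have hκ := h.parallelCurvature_pos hp hu0
  have hT := h.one_sub_sq_mul hp hu0
  have hx := h.sq_fst_eq hp
  have hn : ((n - 2 : ℕ) : ℝ) = n - 2 := by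
    have := h.three_le
    rw [Nat.cast_sub (by omega)]; norm_num
  have hpow : (inner ℝ (X u).1.2 (X u).1.2 : ℝ) ^ (n - 2) =
      inner ℝ (X u).1.2 (X u).1.2 * inner ℝ (X u).1.2 (X u).1.2 ^ (n - 2 - 1) := by
    have := h.three_le
    rw [← pow_succ']; congr 1; omega
  have hD := (HasFDerivAt.pow ((hL.fun_mul ((hR.const_mul ε).const_sub 1)).fun_add
    (hR.const_mul (ε - K))) 2).fun_mul (HasFDerivAt.pow hR (n - 2))
  refine hD.congr_fderiv (ContinuousLinearMap.ext fun v => ?_)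
  have hi := h.parallelCurvature_mul_inner hX hu hu0 v
  simp only [add_apply, smul_apply, neg_apply, smul_eq_mul, zero_apply, hLv,
    hRv, hn, hpow, nsmul_eq_mul]
  set κ := parallelCurvature N (X u)
  set ρ := inner ℝ (X u).1.2 (X u).1.2
  set i := inner ℝ (X u).1.2 (fderiv ℝ X u v).1.2
  set t := (fderiv ℝ X u v).2
  set ν := (N (X u)).2
  set e := n - 2 - 1
  rw [hx] at hT hi
  have hA : (1 - ν ^ 2) * (1 - ε * ρ) + (ε - K) * ρ = ρ * (κ ^ 2 + ε - K) := by
    linear_combination hT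
  have key : κ * (2 * ρ * ((1 - ν ^ 2) * -(ε * (2 * i)) + (1 - ε * ρ) * (2 * ν * k * t) +
      (ε - K) * (2 * i)) + (n - 2) * (ρ * (κ ^ 2 + ε - K)) * (2 * i)) = 0 := by
    linear_combination (4 * ρ * (ε - K - ε * (1 - ν ^ 2)) +
      2 * (n - 2) * ρ * (κ ^ 2 + ε - K)) * hi + 2 * ρ * ν * (1 - ε * ρ) * t * hs
  have key2 := (mul_eq_zero.1 key).resolve_left hκ.ne'
  push_cast
  rw [hA]
  linear_combination (ρ * (κ ^ 2 + ε - K)) * ρ ^ e * key2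

theorem eventually_firstIntegral_eq (h : IsConvexRotational ε S N)
    (hK : HasConstantScalarCurvature ε S (n * (n - 1) * K)) {p : Ambient n} (hp : p ∈ S)
    (hp0 : p.1.2 ≠ 0) : ∀ᶠ q in nhdsWithin p S, firstIntegral ε K N q = firstIntegral ε K N p := by
  obtain ⟨U, X, hX, u, hu, rfl⟩ := h.embedded.locally_param p hp
  have hev : ∀ᶠ y in nhds u, y ∈ U ∧ (X y).1.2 ≠ 0 := by
    refine (hX.isOpen.eventually_mem hu).and ?_
    exact (hX.differentiableAt hu).continuousAt.fst.snd.eventually_ne hp0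
  obtain ⟨r, hr, hball⟩ := Metric.eventually_nhds_iff_ball.1 hev
  obtain ⟨V, hV, hXV⟩ := hX.isOpenMap (Metric.ball u r) (fun y hy => (hball y hy).1)
    Metric.isOpen_ball
  have huV : X u ∈ S ∩ V := hXV ▸ mem_image_of_mem X (Metric.mem_ball_self hr)
  have hder : ∀ y ∈ Metric.ball u r,
      HasFDerivAt (fun y => firstIntegral ε K N (X y)) (0 : Euc n →L[ℝ] ℝ) y := fun y hy =>
    h.hasFDerivAt_firstIntegral hX (hball y hy).1 (hball y hy).2 (hK U X hX y (hball y hy).1)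
  filter_upwards [inter_mem_nhdsWithin S (hV.mem_nhds huV.2)] with q hq
  rw [← hXV] at hq
  obtain ⟨y, hy, rfl⟩ := hq
  exact Metric.isOpen_ball.is_const_of_fderiv_eq_zero (convex_ball u r).isPreconnected
    (fun y hy => (hder y hy).differentiableAt.differentiableWithinAt)
    (fun y hy => (hder y hy).fderiv) hy (Metric.mem_ball_self hr)

end IsConvexRotational

/-! ### Minima of `log |x|² + μ t` -/

open Filter Topology in
/-- The second order necessary condition for a local minimum. -/
theorem nonneg_of_isLocalMin_of_hasDerivAt {f f' : ℝ → ℝ} {a f'' : ℝ} (hmin : IsLocalMin f a)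
    (hf : ∀ᶠ s in 𝓝 a, HasDerivAt f (f' s) s) (hf' : HasDerivAt f' f'' a) : 0 ≤ f'' := by
  by_contra! hneg
  have h1 : deriv f =ᶠ[𝓝 a] f' := by filter_upwards [hf] with s hs using hs.deriv
  have h2 : deriv (deriv f) a = f'' := by rw [h1.deriv_eq, hf'.deriv]
  have hmax : IsLocalMax f a := isLocalMax_of_deriv_deriv_neg (by rwa [h2]) hmin.deriv_eq_zero
    hf.self_of_nhds.continuousAt
  have h3 : f =ᶠ[𝓝 a] fun _ => f a := by
    filter_upwards [hmin, hmax] with s h1 h2 using le_antisymm h2 h1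
  have h4 : deriv (deriv f) a = 0 := by
    rw [h3.deriv.deriv_eq]; simp
  linarith

open Filter Topology in
/-- First and second order conditions for a minimum of `log |x|² + μ t` along a curve. -/
theorem isLocalMin_log_along_curve {n : ℕ} {c c' : ℝ → Ambient n} {a : Ambient n} {μ : ℝ}
    (hc : ∀ᶠ s in 𝓝 0, HasDerivAt c (c' s) s) (hc' : HasDerivAt c' a 0) (h0 : (c 0).1.2 ≠ 0)
    (hmin : IsLocalMin (fun s => Real.log (inner ℝ (c s).1.2 (c s).1.2) + μ * (c s).2) 0) :
    2 * inner ℝ (c 0).1.2 (c' 0).1.2 / inner ℝ (c 0).1.2 (c 0).1.2 + μ * (c' 0).2 = 0 ∧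
    0 ≤ (2 * (inner ℝ (c 0).1.2 a.1.2 + inner ℝ (c' 0).1.2 (c' 0).1.2) *
      inner ℝ (c 0).1.2 (c 0).1.2 - 2 * inner ℝ (c 0).1.2 (c' 0).1.2 *
        (2 * inner ℝ (c 0).1.2 (c' 0).1.2)) / inner ℝ (c 0).1.2 (c 0).1.2 ^ 2 + μ * a.2 := by
  have hx : ∀ {c : ℝ → Ambient n} {d : Ambient n} {s : ℝ}, HasDerivAt c d s →
      HasDerivAt (fun s => (c s).1.2) d.1.2 s := fun h =>
    (h.hasFDerivAt.fst.snd).hasDerivAt.congr_deriv (by simp)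
  have ht : ∀ {c : ℝ → Ambient n} {d : Ambient n} {s : ℝ}, HasDerivAt c d s →
      HasDerivAt (fun s => (c s).2) d.2 s := fun h =>
    (h.hasFDerivAt.snd).hasDerivAt.congr_deriv (by simp)
  have hρ : ∀ {s}, HasDerivAt c (c' s) s →
      HasDerivAt (fun s => (inner ℝ (c s).1.2 (c s).1.2 : ℝ))
        (2 * inner ℝ (c s).1.2 (c' s).1.2) s := fun {s} h =>
    ((hx h).inner ℝ (hx h)).congr_deriv (by rw [real_inner_comm (c s).1.2]; ring)
  have hf : ∀ᶠ s in 𝓝 0,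
      HasDerivAt (fun s => Real.log (inner ℝ (c s).1.2 (c s).1.2) + μ * (c s).2)
      (2 * inner ℝ (c s).1.2 (c' s).1.2 / inner ℝ (c s).1.2 (c s).1.2 + μ * (c' s).2) s := by
    have hne : ∀ᶠ s in 𝓝 0, (c s).1.2 ≠ 0 :=
      (hx hc.self_of_nhds).continuousAt.eventually_ne h0
    filter_upwards [hc, hne] with s hs hs0
    exact ((hρ hs).log (inner_self_ne_zero.2 hs0)).add ((ht hs).const_mul μ)
  refine ⟨hmin.hasDerivAt_eq_zero hf.self_of_nhds, nonneg_of_isLocalMin_of_hasDerivAt hmin hf ?_⟩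
  have hc0 := hc.self_of_nhds
  have h1 := (((hx hc0).inner ℝ (hx hc')).const_mul 2).div (hρ hc0) (inner_self_ne_zero.2 h0)
  exact h1.add ((ht hc').const_mul μ)

namespace IsConvexRotational
variable {n : ℕ} {ε K : ℝ} {S : Set (Ambient n)} {N : Ambient n → Ambient n} {U : Set (Euc n)}
  {X : Euc n → Ambient n}

open Filter Topology in
/-- Strict convexity excludes local minima of `log |x|² + μ t` on `S` off the axis: the profile
curve, as a graph over the axis, is strictly concave. -/
theorem not_eventually_log_le (h : IsConvexRotational ε S N) {p : Ambient n} (hp : p ∈ S)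
    (hp0 : p.1.2 ≠ 0) (μ : ℝ) :
    ¬ ∀ᶠ q in 𝓝[S] p, Real.log (inner ℝ p.1.2 p.1.2) + μ * p.2 ≤
      Real.log (inner ℝ q.1.2 q.1.2) + μ * q.2 := by
  intro hmin
  obtain ⟨U, X, hX, u, hu, rfl⟩ := h.embedded.locally_param p hp
  obtain ⟨k, hk0, hk⟩ := h.exists_secondForm_eq hX hu hp0
  have hline : ∀ s : ℝ, HasDerivAt (fun s : ℝ => u + s • heightGrad ε X u) (heightGrad ε X u) s :=
    fun s => by simpa using ((hasDerivAt_id s).smul_const (heightGrad ε X u)).const_add u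
  have hU : ∀ᶠ s : ℝ in 𝓝 0, u + s • heightGrad ε X u ∈ U :=
    (hline 0).continuousAt.eventually_mem (by simpa using hX.isOpen.mem_nhds hu)
  -- the curve in `S` whose velocity at `p` is the gradient of the height
  have hc : ∀ᶠ s : ℝ in 𝓝 0, HasDerivAt (fun s : ℝ => X (u + s • heightGrad ε X u))
      (fderiv ℝ X (u + s • heightGrad ε X u) (heightGrad ε X u)) s := by
    filter_upwards [hU] with s hs
    exact (hX.differentiableAt hs).hasFDerivAt.comp_hasDerivAt s (hline s)
  have hc' : HasDerivAt (fun s : ℝ => fderiv ℝ X (u + s • heightGrad ε X u) (heightGrad ε X u))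
      (fderiv ℝ (fderiv ℝ X) u (heightGrad ε X u) (heightGrad ε X u)) 0 := by
    rw [← hX.fderiv_fderiv_apply hu]
    have h1 := (hX.differentiableAt_fderiv_apply hu (heightGrad ε X u)).hasFDerivAt
    exact HasFDerivAt.comp_hasDerivAt (0 : ℝ) (by simpa using h1) (hline 0)
  have hlocal : IsLocalMin (fun s : ℝ => Real.log (inner ℝ (X (u + s • heightGrad ε X u)).1.2
      (X (u + s • heightGrad ε X u)).1.2) + μ * (X (u + s • heightGrad ε X u)).2) 0 := by
    have ht : Tendsto (fun s : ℝ => X (u + s • heightGrad ε X u)) (𝓝 0) (𝓝[S] (X u)) := by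
      refine tendsto_nhdsWithin_iff.2 ⟨?_, hU.mono fun s hs => hX.mapsTo hs⟩
      simpa [ContinuousAt] using hc.self_of_nhds.continuousAt
    have := ht.eventually hmin
    simpa [IsLocalMin, IsMinFilter] using this
  obtain ⟨h1, h2⟩ := isLocalMin_log_along_curve hc hc' (by simpa using hp0) hlocal
  simp only [zero_smul, add_zero] at h1 h2
  have hρ := inner_self_pos hp0
  have hκ := h.parallelCurvature_pos hp hp0
  have hT0 := h.one_sub_sq_pos hp hp0
  have hT := h.one_sub_sq_mul hp hp0
  have hx := h.sq_fst_eq hp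
  have hN := h.eps_mul_normal_mul hp hp0
  have hεε := h.eps_mul_self
  have hzt := h.fderiv_heightGrad_snd hX hu
  have hform := h.form_fderiv_heightGrad hX hu (heightGrad ε X u)
  have hzx : (fderiv ℝ X u (heightGrad ε X u)).1.2 =
      ((N (X u)).2 * parallelCurvature N (X u)) • (X u).1.2 := by
    rw [h.fderiv_heightGrad hX hu]
    simp [h.normal_eq hp hp0, smul_smul]
  have h3 := hk (heightGrad ε X u) (heightGrad ε X u)
  have h4 := hX.form_fderiv_fderiv_posVec h.embedded.subset hu (heightGrad ε X u)
    (heightGrad ε X u)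
  rw [hform] at h3
  rw [show baseForm ε (fderiv ℝ X u (heightGrad ε X u)).1 (fderiv ℝ X u (heightGrad ε X u)).1 =
    form ε (fderiv ℝ X u (heightGrad ε X u)) (fderiv ℝ X u (heightGrad ε X u)) -
      (fderiv ℝ X u (heightGrad ε X u)).2 * (fderiv ℝ X u (heightGrad ε X u)).2 by
    simp only [form]; ring, hform, form_posVec] at h4
  rw [hzt] at h1 h3 h4
  rw [hzx] at h1 h2
  generalize fderiv ℝ (fderiv ℝ X) u (heightGrad ε X u) (heightGrad ε X u) = a at *
  simp only [form, baseForm, h.normal_eq hp hp0, inner_smul_left, inner_smul_right,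
    RCLike.conj_to_real] at h1 h2 h3 h4
  rw [real_inner_comm] at h3 h4
  set x0 := (X u).1.1
  set κ := parallelCurvature N (X u)
  set ρ := inner ℝ (X u).1.2 (X u).1.2
  set ν := (N (X u)).2
  set I := inner ℝ (X u).1.2 a.1.2
  have hN0 : (N (X u)).1.1 * x0 = ε * κ * ρ := by
    linear_combination ε * hN - (N (X u)).1.1 * x0 * hεε
  have h5 : ε * a.1.1 * (N (X u)).1.1 + -κ * I + a.2 * ν = k * (1 - ν ^ 2) := by
    rw [h3]; field_simp; ring
  have hI : I * κ = ν * a.2 * x0 ^ 2 - k * (1 - ν ^ 2) * x0 ^ 2 -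
      (1 - ν ^ 2) * ν ^ 2 * ε * κ * ρ := by
    linear_combination -x0 ^ 2 * h5 + ε * a.1.1 * x0 * hN0 + ε * κ * ρ * h4 - I * κ * hx
  have h6 : 2 * ν * κ + μ * (1 - ν ^ 2) = 0 := by
    field_simp at h1
    linarith
  have h7 : (2 * (I + ν * κ * (ν * κ * ρ)) * ρ - 2 * (ν * κ * ρ) * (2 * (ν * κ * ρ))) / ρ ^ 2 +
      μ * a.2 = (2 * I - 2 * ν ^ 2 * κ ^ 2 * ρ + μ * a.2 * ρ) / ρ := by
    field_simp; ring
  have h8 : (2 * I - 2 * ν ^ 2 * κ ^ 2 * ρ + μ * a.2 * ρ) * (κ * (1 - ν ^ 2)) =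
      -(2 * k * (1 - ν ^ 2) ^ 2 * x0 ^ 2 + 2 * ν ^ 2 * κ * (1 - ν ^ 2) ^ 2) := by
    linear_combination 2 * (1 - ν ^ 2) * hI + a.2 * κ * ρ * h6 + 2 * ν * a.2 * hT +
      2 * ν ^ 2 * κ * (1 - ν ^ 2) * hT - 2 * ν ^ 2 * κ * (1 - ν ^ 2) ^ 2 * hx
  have hx0 : 0 < x0 ^ 2 := by have := h.fst_ne_zero hp hp0; positivity
  have h9 : 0 < 2 * k * (1 - ν ^ 2) ^ 2 * x0 ^ 2 + 2 * ν ^ 2 * κ * (1 - ν ^ 2) ^ 2 := by positivity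
  rw [h7] at h2
  have h10 : 0 ≤ 2 * I - 2 * ν ^ 2 * κ ^ 2 * ρ + μ * a.2 * ρ := by
    by_contra! hlt
    exact absurd h2 (not_le.2 (div_neg_of_neg_of_pos hlt hρ))
  have h11 : 0 ≤ (2 * I - 2 * ν ^ 2 * κ ^ 2 * ρ + μ * a.2 * ρ) * (κ * (1 - ν ^ 2)) := by positivity
  linarith

end IsConvexRotational

/-! ### Rigidity -/

namespace IsConvexRotational
variable {n : ℕ} {ε K : ℝ} {S : Set (Ambient n)} {N : Ambient n → Ambient n} {U : Set (Euc n)}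
  {X : Euc n → Ambient n}

theorem isBounded_of_le (h : IsConvexRotational ε S N) {T : Set (Ambient n)} (hT : T ⊆ S)
    {R M t₀ : ℝ} (hR : ∀ p ∈ T, inner ℝ p.1.2 p.1.2 ≤ R) (hM : ∀ p ∈ T, |p.2 - t₀| ≤ M) :
    Bornology.IsBounded T := by
  refine (Metric.isBounded_closedBall (x := (0 : Ambient n))
    (r := max (1 + R) (|t₀| + M))).subset fun p hp => ?_
  have h1 := hR p hp
  have h2 : (0 : ℝ) ≤ inner ℝ p.1.2 p.1.2 := real_inner_self_nonneg
  have h3 := h.sq_fst_eq (hT hp)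
  have h4 : p.1.1 ^ 2 ≤ (1 + R) ^ 2 := by
    rcases h.eps with rfl | rfl <;> nlinarith
  have h5 : ‖p.1.2‖ ^ 2 ≤ (1 + R) ^ 2 := by
    rw [← real_inner_self_eq_norm_sq]; nlinarith
  rw [mem_closedBall_zero_iff, Prod.norm_def, Prod.norm_def, max_le_iff, max_le_iff]
  refine ⟨⟨?_, ?_⟩, ?_⟩
  · exact le_max_of_le_left (abs_le_of_sq_le_sq h4 (by linarith))
  · exact le_max_of_le_left (le_of_sq_le_sq h5 (by linarith))
  · refine le_max_of_le_right ?_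
    have := hM p hp
    have h6 : |p.2| ≤ |t₀| + |p.2 - t₀| := by
      simpa using abs_add_le t₀ (p.2 - t₀)
    exact h6.trans (by linarith)

/-- A nonzero value of the first integral is only attained away from the axis. -/
theorem exists_le_inner_self (h : IsConvexRotational ε S N) (K : ℝ) {γ : ℝ} (hγ : γ ≠ 0) :
    ∃ δ > 0, ∀ p ∈ S, firstIntegral ε K N p = γ → δ ≤ inner ℝ p.1.2 p.1.2 := by
  set C := (2 + |ε - K|) ^ 2 with hC
  have hC0 : 0 < C := by positivity
  refine ⟨min 1 (|γ| / C), lt_min one_pos (div_pos (abs_pos.2 hγ) hC0), fun p hp hpγ => ?_⟩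
  by_contra! hlt
  obtain ⟨h1, h2⟩ := lt_min_iff.1 hlt
  have hn := h.three_le
  have hp0 : p.1.2 ≠ 0 := by
    intro h0
    apply hγ
    rw [← hpγ, firstIntegral, h0, inner_zero_left, zero_pow (by omega), mul_zero]
  have hρ := inner_self_pos hp0
  have hT := h.one_sub_sq_pos hp hp0
  rw [firstIntegral] at hpγ
  set ρ := inner ℝ p.1.2 p.1.2
  have h3 : |(1 - (N p).2 ^ 2) * (1 - ε * ρ) + (ε - K) * ρ| ≤ 2 + |ε - K| := by
    refine (abs_add_le _ _).trans (add_le_add ?_ ?_)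
    · rw [abs_mul, abs_of_pos hT]
      have h4 : |1 - ε * ρ| ≤ 2 := by
        rw [abs_le]; rcases h.eps with rfl | rfl <;> constructor <;> linarith
      have h5 : 1 - (N p).2 ^ 2 ≤ 1 := by nlinarith [sq_nonneg (N p).2]
      nlinarith [abs_nonneg (1 - ε * ρ)]
    · rw [abs_mul, abs_of_pos hρ]
      nlinarith [abs_nonneg (ε - K)]
  have h4 : ρ ^ (n - 2) ≤ ρ := by
    simpa using pow_le_pow_of_le_one hρ.le h1.le (show 1 ≤ n - 2 by omega)
  have h5 : γ ≤ C * ρ := by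
    rw [← hpγ, hC]
    refine mul_le_mul ?_ h4 (by positivity) (by positivity)
    rw [← sq_abs]
    exact pow_le_pow_left₀ (abs_nonneg _) h3 2
  have h6 : 0 ≤ γ := by rw [← hpγ]; positivity
  rw [abs_of_nonneg h6, lt_div_iff₀ hC0] at h2
  linarith

theorem continuousOn_firstIntegral (h : IsConvexRotational ε S N) :
    ContinuousOn (firstIntegral ε K N) S := by
  have := h.normalField.continuousOn
  unfold firstIntegral
  fun_prop

open Filter Topology in
/-- The first integral vanishes. Otherwise the part of `S` where it has a given nonzero value would be
a closed hypersurface which stays away from the axis; on it the function `log |x|² + η |t - t₀|`, for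
a suitable `t₀` and a small `η > 0`, attains its minimum off the hyperplane `t = t₀`. -/
theorem firstIntegral_eq_zero (h : IsConvexRotational ε S N)
    (hK : HasConstantScalarCurvature ε S (n * (n - 1) * K)) {p : Ambient n} (hp : p ∈ S) :
    firstIntegral ε K N p = 0 := by
  by_contra hγ
  set γ := firstIntegral ε K N p with hγdef
  set t₀ := p.2
  obtain ⟨δ, hδ, hδS⟩ := h.exists_le_inner_self K hγ
  let T : Set (Ambient n) := {q | q ∈ S ∧ firstIntegral ε K N q = γ}
  have hTS : T ⊆ S := fun q hq => hq.1
  have hTclosed : IsClosed T := h.continuousOn_firstIntegral.preimage_isClosed_of_isClosed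
    h.embedded.isClosed isClosed_singleton
  have hTρ : ∀ q ∈ T, δ ≤ inner ℝ q.1.2 q.1.2 := fun q hq => hδS q hq.1 hq.2
  have hT0 : ∀ q ∈ T, q.1.2 ≠ 0 := fun q hq h0 => by
    have := hTρ q hq
    rw [h0, inner_zero_left] at this
    linarith
  have hTopen : ∀ q ∈ T, ∀ᶠ q' in 𝓝[S] q, q' ∈ T := fun q hq => by
    filter_upwards [self_mem_nhdsWithin, h.eventually_firstIntegral_eq hK hq.1 (hT0 q hq)]
      with q' h1 h2
    exact ⟨h1, h2.trans hq.2⟩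
  let φ : ℝ → Ambient n → ℝ := fun η q => Real.log (inner ℝ q.1.2 q.1.2) + η * |q.2 - t₀|
  have hmin : ∀ T' ⊆ T, IsClosed T' → T'.Nonempty → ∀ η > 0, ∃ q ∈ T', ∀ q' ∈ T', φ η q ≤ φ η q' := by
    rintro T' hT' hcl ⟨p₁, hp₁⟩ η hη
    have hφ : ContinuousOn (φ η) T' := by
      refine ContinuousOn.add (ContinuousOn.log (by fun_prop) fun q hq => ?_) (by fun_prop)
      exact inner_self_ne_zero.2 (hT0 q (hT' hq))
    have hCcl : IsClosed (T' ∩ φ η ⁻¹' Iic (φ η p₁)) :=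
      hφ.preimage_isClosed_of_isClosed hcl isClosed_Iic
    have hlog : ∀ q ∈ T', Real.log δ ≤ Real.log (inner ℝ q.1.2 q.1.2) := fun q hq =>
      Real.log_le_log hδ (hTρ q (hT' hq))
    have hCb : Bornology.IsBounded (T' ∩ φ η ⁻¹' Iic (φ η p₁)) := by
      refine h.isBounded_of_le (fun q hq => hTS (hT' hq.1)) (R := Real.exp (φ η p₁))
        (M := (φ η p₁ - Real.log δ) / η) (t₀ := t₀) (fun q hq => ?_) fun q hq => ?_
      · have h1 : φ η q ≤ φ η p₁ := hq.2
        rw [← Real.log_le_iff_le_exp (inner_self_pos (hT0 q (hT' hq.1)))]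
        have : 0 ≤ η * |q.2 - t₀| := by positivity
        simp only [φ] at h1 ⊢
        linarith
      · have h1 : φ η q ≤ φ η p₁ := hq.2
        have h2 := hlog q hq.1
        rw [le_div_iff₀ hη]
        simp only [φ] at h1 ⊢
        linarith
    have hC := Metric.isCompact_of_isClosed_isBounded hCcl hCb
    obtain ⟨q, hq, hqmin⟩ := hC.exists_isMinOn ⟨p₁, hp₁, le_refl (φ η p₁)⟩
      (hφ.mono inter_subset_left)
    refine ⟨q, hq.1, fun q' hq' => ?_⟩
    by_cases h1 : φ η q' ≤ φ η p₁
    · exact hqmin ⟨hq', h1⟩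
    · exact (show φ η q ≤ φ η p₁ from hq.2).trans (not_le.1 h1).le
  -- the smallest value of `|x|` on `t = t₀`
  obtain ⟨p₂, ⟨hp₂, hp₂t⟩, hp₂min⟩ := hmin (T ∩ {q | q.2 = t₀}) inter_subset_left
    (hTclosed.inter (isClosed_eq continuous_snd continuous_const)) ⟨p, ⟨hp, rfl⟩, rfl⟩ 1 one_pos
  have hp₂t : p₂.2 = t₀ := hp₂t
  -- some point of `T` has a smaller value of `|x|`
  obtain ⟨q, hq, hqlt⟩ : ∃ q ∈ T, Real.log (inner ℝ q.1.2 q.1.2) <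
      Real.log (inner ℝ p₂.1.2 p₂.1.2) := by
    have h1 := Filter.not_eventually.1 (h.not_eventually_log_le hp₂.1 (hT0 p₂ hp₂) 0)
    obtain ⟨q, hq1, hq2⟩ := (h1.and_eventually (hTopen p₂ hp₂)).exists
    exact ⟨q, hq2, by simpa using hq1⟩
  obtain ⟨η, hη, hηq⟩ : ∃ η > 0, φ η q < Real.log (inner ℝ p₂.1.2 p₂.1.2) := by
    have hd := sub_pos.2 hqlt
    set d := Real.log (inner ℝ p₂.1.2 p₂.1.2) - Real.log (inner ℝ q.1.2 q.1.2) with hddef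
    have hs := abs_nonneg (q.2 - t₀)
    refine ⟨d / (|q.2 - t₀| + 1), by positivity, ?_⟩
    have : d / (|q.2 - t₀| + 1) * |q.2 - t₀| < d := by
      rw [div_mul_eq_mul_div, div_lt_iff₀ (by linarith)]
      nlinarith
    simp only [φ]
    linarith
  obtain ⟨q', hq', hq'min⟩ := hmin T subset_rfl hTclosed ⟨q, hq⟩ η hη
  have hne : q'.2 ≠ t₀ := by
    intro h0
    have h1 := hp₂min q' ⟨hq', h0⟩
    have h2 := hq'min q hq
    simp only [φ, h0, hp₂t, sub_self, abs_zero, mul_zero, add_zero] at h1 h2 hηq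
    linarith
  have hcont : ContinuousAt (fun q : Ambient n => q.2) q' := continuous_snd.continuousAt
  rcases hne.lt_or_gt with hlt | hgt
  · refine h.not_eventually_log_le hq'.1 (hT0 q' hq') (-η) ?_
    filter_upwards [hTopen q' hq',
      mem_nhdsWithin_of_mem_nhds (hcont.eventually_lt_const hlt)] with r hr1 hr2
    have h1 := hq'min r hr1
    simp only [φ, abs_of_neg (sub_neg.2 hlt), abs_of_neg (sub_neg.2 hr2)] at h1
    linarith
  · refine h.not_eventually_log_le hq'.1 (hT0 q' hq') η ?_
    filter_upwards [hTopen q' hq',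
      mem_nhdsWithin_of_mem_nhds (hcont.eventually_const_lt hgt)] with r hr1 hr2
    have h1 := hq'min r hr1
    simp only [φ, abs_of_pos (sub_pos.2 hgt), abs_of_pos (sub_pos.2 hr2)] at h1
    linarith

/-- Off the axis the curvature tensor is that of constant curvature `K`. -/
theorem sum_inducedMetric_mul_riemann_eq (h : IsConvexRotational ε S N)
    (hK : HasConstantScalarCurvature ε S (n * (n - 1) * K)) (hX : IsLocalParam S U X) {u : Euc n}
    (hu : u ∈ U) (hu0 : (X u).1.2 ≠ 0) (i j k m : Fin n) :
    secondForm ε N X u j k * secondForm ε N X u i m -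
        secondForm ε N X u i k * secondForm ε N X u j m +
      ε * (baseMetric ε X u j k * baseMetric ε X u i m -
        baseMetric ε X u i k * baseMetric ε X u j m) =
      K * (inducedMetric ε X u j k * inducedMetric ε X u i m -
        inducedMetric ε X u i k * inducedMetric ε X u j m) := by
  have hp := hX.mapsTo hu
  obtain ⟨l, -, hl⟩ := h.exists_secondForm_eq hX hu hu0
  have hs := h.scalar_equation hX hu hu0 (hK U X hX u hu) hl
  have hρ := inner_self_pos hu0
  have hT0 := (h.one_sub_sq_pos hp hu0).ne'
  have hz := h.firstIntegral_eq_zero hK hp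
  rw [firstIntegral] at hz
  have hA := (pow_eq_zero_iff two_ne_zero).1
    ((mul_eq_zero.1 hz).resolve_right (pow_pos hρ _).ne')
  rw [← h.sq_fst_eq hp, h.one_sub_sq_mul hp hu0] at hA
  have hQ : parallelCurvature N (X u) ^ 2 + ε = K := by
    apply mul_right_cancel₀ hρ.ne'
    linarith
  have hm : parallelCurvature N (X u) * ((l - parallelCurvature N (X u)) /
      (1 - (N (X u)).2 ^ 2)) = ε := by
    rw [hQ, sub_self, mul_zero, zero_add] at hs
    field_simp
    linarith
  have hII : ∀ i j, secondForm ε N X u i j =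
      parallelCurvature N (X u) * inducedMetric ε X u i j +
      (l - parallelCurvature N (X u)) / (1 - (N (X u)).2 ^ 2) *
        ((pderiv i X u).2 * (pderiv j X u).2) := fun i j => by
    rw [secondForm, Matrix.of_apply, hX.pderiv_pderiv hu, hl]; rfl
  simp only [hII, baseMetric_eq]
  set m' := (l - parallelCurvature N (X u)) / (1 - (N (X u)).2 ^ 2)
  set κ := parallelCurvature N (X u)
  set g := inducedMetric ε X u
  linear_combination (g j k * g i m - g i k * g j m) * hQ +
    (g j k * ((pderiv i X u).2 * (pderiv m X u).2) + (pderiv j X u).2 * (pderiv k X u).2 * g i m -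
      g i k * ((pderiv j X u).2 * (pderiv m X u).2) -
      (pderiv i X u).2 * (pderiv k X u).2 * g j m) * hm

open Filter Topology in
/-- The points off the axis are dense in `S`. -/
theorem frequently_ne_zero (h : IsConvexRotational ε S N) (hX : IsLocalParam S U X) {u : Euc n}
    (hu : u ∈ U) : ∃ᶠ y in 𝓝 u, (X y).1.2 ≠ 0 := by
  intro hev
  have hev : (fun y => (X y).1.2) =ᶠ[𝓝 u] fun _ => 0 := by
    filter_upwards [hev] with y hy using not_not.1 hy
  have hx0 : (X u).1.2 = 0 := hev.self_of_nhds
  have hsq := h.sq_fst_eq (hX.mapsTo hu)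
  rw [hx0, inner_zero_left, mul_zero, sub_zero] at hsq
  have hx0' : (X u).1.1 ≠ 0 := by intro h0; rw [h0] at hsq; norm_num at hsq
  have hε0 : ε ≠ 0 := by rcases h.eps with rfl | rfl <;> norm_num
  have hD : ∀ v, (fderiv ℝ X u v).1 = 0 := by
    intro v
    have h1 := (hX.differentiableAt hu).hasFDerivAt.fst.snd.fderiv
    rw [hev.fderiv_eq] at h1
    have h2 : (fderiv ℝ X u v).1.2 = 0 := by
      have := congrArg (fun L => L v) h1
      simpa using this.symm
    have h3 := hX.form_fderiv_posVec h.embedded.subset hu v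
    rw [form_posVec, baseForm, h2, inner_zero_left, add_zero] at h3
    exact Prod.ext (by simpa [hε0, hx0'] using h3) h2
  -- so the differential of `X` would be an injection into the vertical line
  let L : Euc n →ₗ[ℝ] ℝ := (LinearMap.snd ℝ (ℝ × Euc n) ℝ).comp (fderiv ℝ X u).toLinearMap
  have hL : Function.Injective L := fun v w hvw =>
    hX.immersion u hu (Prod.ext (by rw [hD, hD]) hvw)
  have h1 := LinearMap.finrank_le_finrank_of_injective hL
  rw [finrank_euclideanSpace, Fintype.card_fin, Module.finrank_self] at h1
  have := h.three_le
  omega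

open Filter Topology in
theorem hasConstantSectionalCurvature (h : IsConvexRotational ε S N)
    (hK : HasConstantScalarCurvature ε S (n * (n - 1) * K)) :
    HasConstantSectionalCurvature ε S K := by
  intro U X hX u hu v w hvw
  refine hX.sectionalCurvature_eq h.eps h.embedded.subset hu (fun m i j k => ?_) hvw
  rw [hX.gauss_equation h.eps h.embedded.subset h.normalField hu]
  have hN : ContinuousAt (fun y => N (X y)) u := by
    have h1 : ContinuousOn (fun y => N (X y)) U :=
      h.normalField.continuousOn.comp hX.smooth.continuousOn hX.mapsTo
    exact h1.continuousAt (hX.isOpen.mem_nhds hu)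
  have hform : ∀ {f g : Euc n → Ambient n}, ContinuousAt f u → ContinuousAt g u →
      ContinuousAt (fun y => form ε (f y) (g y)) u := fun hf hg =>
    ((formL n ε).continuous.continuousAt.comp hf).clm_apply hg
  have hd : ∀ a, ContinuousAt (pderiv a X) u := fun a => (hX.contDiffAt_pderiv hu a).continuousAt
  have hII : ∀ a b, ContinuousAt (fun y => secondForm ε N X y a b) u := fun a b =>
    hform (hX.contDiffAt_pderiv_pderiv hu a b).continuousAt hN
  have hg : ∀ a b, ContinuousAt (fun y => inducedMetric ε X y a b) u := fun a b =>
    hform (hd a) (hd b)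
  have hb : ∀ a b, ContinuousAt (fun y => baseMetric ε X y a b) u := fun a b => by
    simp only [baseMetric_eq]
    exact (hg a b).sub ((hd a).snd.mul (hd b).snd)
  set s : Set (Euc n) := {y | y ∈ U ∧ (X y).1.2 ≠ 0}
  have hs : (𝓝[s] u).NeBot := by
    rw [← mem_closure_iff_nhdsWithin_neBot, mem_closure_iff_frequently]
    exact ((h.frequently_ne_zero hX hu).and_eventually (hX.isOpen.eventually_mem hu)).mono
      fun y hy => ⟨hy.2, hy.1⟩
  have hl := ((((hII j k).mul (hII i m)).sub ((hII i k).mul (hII j m))).add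
    ((((hb j k).mul (hb i m)).sub ((hb i k).mul (hb j m))).const_mul ε)).mono_left
    (nhdsWithin_le_nhds (s := s))
  have hr := ((((hg j k).mul (hg i m)).sub ((hg i k).mul (hg j m))).const_mul K).mono_left
    (nhdsWithin_le_nhds (s := s))
  refine tendsto_nhds_unique_of_eventuallyEq hl hr ?_
  filter_upwards [self_mem_nhdsWithin] with y hy
  exact h.sum_inducedMetric_mul_riemann_eq hK hX hy.1 hy.2 i j k m

end IsConvexRotational

end ProductSpaceForm

end

theorem mainTheorem5 (n : ℕ) (hn : 3 ≤ n) (ε : ℝ) (hε : ε = 1 ∨ ε = -1)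
    (c : ℝ) (hc : ε * (n * (n - 1)) < c) :
    ε < c / (n * (n - 1)) ∧
    (∃ S : Set (ProductSpaceForm.Ambient n),
      ProductSpaceForm.IsProperlyEmbeddedHypersurface ε S ∧
      ProductSpaceForm.IsStrictlyConvex ε S ∧
      ProductSpaceForm.IsRotational S ∧
      ProductSpaceForm.HasConstantScalarCurvature ε S c ∧
      ProductSpaceForm.HasConstantSectionalCurvature ε S (c / (n * (n - 1))) ∧
      (0 < c → ProductSpaceForm.IsEmbeddedSphere S ∧
        ProductSpaceForm.IsSymmetricHorizontal S) ∧
      (c ≤ 0 → ProductSpaceForm.IsEntireGraph ε S ∧ ProductSpaceForm.IsBowl S)) ∧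
    (∀ S : Set (ProductSpaceForm.Ambient n),
      ProductSpaceForm.IsProperlyEmbeddedHypersurface ε S →
      ProductSpaceForm.IsStrictlyConvex ε S →
      ProductSpaceForm.IsRotational S →
      ProductSpaceForm.HasConstantScalarCurvature ε S c →
      ProductSpaceForm.HasConstantSectionalCurvature ε S (c / (n * (n - 1)))) := by
  have hn3 : (3 : ℝ) ≤ n := by exact_mod_cast hn
  have hd : (0 : ℝ) < n * (n - 1) := by nlinarith
  set K : ℝ := c / (n * (n - 1)) with hKdef
  have hcK : (n : ℝ) * (n - 1) * K = c := mul_div_cancel₀ c hd.ne'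
  have hεK : ε < K := by rwa [hKdef, lt_div_iff₀ hd]
  refine ⟨hεK, ?_, ?_⟩
  · rcases lt_or_ge 0 c with hc0 | hc0
    · have hK0 : 0 < K := div_pos hc0 hd
      obtain ⟨w, ψ, σ, θ, h⟩ : ∃ w ψ σ θ, ProductSpaceForm.IsClosedProfile ε K w ψ σ θ := by
        rcases hε with rfl | rfl
        · exact ProductSpaceForm.exists_isClosedProfile_one hεK
        · exact ProductSpaceForm.exists_isClosedProfile_neg_one hK0
      have hS := h.rotationalSphere_subset (n := n) hε
      have hpos := h.pos_of_mem (n := n)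
      have heq := ProductSpaceForm.IsClosedProfile.eq_psi_of_mem (n := n) (K := K) (ψ := ψ) (θ := θ)
      refine ⟨ProductSpaceForm.rotationalSphere n K ψ θ, h.isProperlyEmbeddedHypersurface hε,
        h.isStrictlyConvex hε hS hpos heq, ProductSpaceForm.IsClosedProfile.isRotational, ?_,
        h.hasConstantSectionalCurvature hε hS hpos heq,
        fun _ => ⟨h.isEmbeddedSphere, h.isSymmetricHorizontal⟩, fun h' => absurd h' (not_le.2 hc0)⟩
      have := h.hasConstantScalarCurvature hε hS hpos heq
      rwa [hcK] at this
    · have hK0 : K ≤ 0 := div_nonpos_of_nonpos_of_nonneg hc0 hd.le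
      obtain rfl : ε = -1 := hε.resolve_left fun h1 => by linarith
      obtain ⟨S, w, ψ, σ, h, hS, hrot, hpos, heq, hgraph, hbowl⟩ :=
        ProductSpaceForm.exists_profile_bowl (n := n) (by omega) hεK hK0
      refine ⟨S, hS, h.isStrictlyConvex hε hS.subset hpos heq, hrot, ?_,
        h.hasConstantSectionalCurvature hε hS.subset hpos heq, fun h' => absurd h' (not_lt.2 hc0),
        fun _ => ⟨hgraph, hbowl⟩⟩
      have := h.hasConstantScalarCurvature hε hS.subset hpos heq
      rwa [hcK] at this
  · rintro S hS ⟨N, hN, hconv⟩ hrot hscal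
    have h : ProductSpaceForm.IsConvexRotational ε S N := ⟨hn, hε, hS, hrot, hN, hconv⟩
    rw [← hcK] at hscal
    exact h.hasConstantSectionalCurvature hscal
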